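/- Let $d\ge 2$ and let $\phi_0\in\mathcal S(\mathbb R^d)$ be real-valued with $\operatorname{supp}\widehat{\phi_0}\subset\{2^{-1}\le|\xi|\le 2\}$ and, with $\phi_j(x)=2^{dj}\phi_0(2^jx)$ for $j\in\mathbb Z$, $\sum_{j\in\mathbb Z}\widehat{\phi_j}(\xi)=1$ for $\xi\ne0$, where $\widehat f(\xi)=\int e^{-ix\cdot\xi}f(x)\,dx$. Put $$\|f\|_{\dot B^s_{p,1}}=\sum_{j\in\mathbb Z}2^{sj}\|\phi_j*f\|_{L^p}\in[0,\infty].$$ Let $\mu>0$, $2\mu+\lambda>0$, $\kappa>0$ and $\mathcal L=\mu\Delta+(\lambda+\mu)\nabla\operatorname{div}$. For $0<\delta<1$, $R>0$ and $N\in\{1,2,\dots\}$ let $$u_{0,N}(x)=\Big(RN^{-\frac1d}\sum_{-\delta N\le j\le 0}2^{-(d-1)j}\phi_j\big(x-2^{|j|+2N}e_1\big)\sin(2^Nx_1),\,0,\dots,0\Big),$$ where the sum runs over integers $j$, and for $t>0$ let $$\Theta_N(t)=\int_0^te^{(t-s)\kappa\Delta}\,|\nabla e^{s\mathcal L}u_{0,N}|^2\,ds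 .$$ The numbers $c,C$ below depend neither on $N$ nor on $R$, and they do not depend on $\delta$ unless this is said. (1) For every sufficiently small $\varepsilon_0>0$ there is $c>0$ such that for all $\delta,R,N$ as above and $t=\varepsilon_02^{-2N}$, $$\|\Theta_N(t)\|_{\dot B^{-1}_{d,1}(\mathbb R^d)}\ \ge\ c\,\delta R^2N^{\frac1d}-\big(RN^{-\frac1d}\big)^2\,2^{-(1-2\delta)N}.$$ (2) If $d=3$, then for every sufficiently small $\varepsilon_0>0$ there are $C>1$ and $0<c<1$ such that for all $\delta,R,N$ as above and $t=\varepsilon_02^{-2N}$, $$\|\Theta_N(t)\|_{\dot B^{-1}_{3,1}(\mathbb R^3)}\ \ge\ c\,\delta R^2N^{\frac13}-C\big(RN^{-\frac13}\big)^2\,2^{-cN},$$ and, if moreover $\delta N\ge1$, $$\|u_{0,N}\|_{\dot B^0_{3,1}(\mathbb R^3)}\le CR\,\delta^{\frac13}.$$ If $C$ may depend on $\delta$, the last estimate holds for all $N\ge1$: for each $\delta\in(0,1)$ there is $C>1$ with $\|u_{0,N}\|_{\dot B^0_{3,1}(\mathbb R^3)}\le CR\,\delta^{1/3}$ for all $N\ge1$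 and $R>0$. -/

import Mathlib

open MeasureTheory SchwartzMap FourierTransform
open scoped ENNReal

noncomputable section

namespace HighFreq

/-- Euclidean space `ℝ^d`. -/
abbrev E (d : ℕ) : Type := EuclideanSpace ℝ (Fin d)

/-- Complex vectors `ℂ^d` with the Hermitian norm (they carry the values of vector fields, so that
the Fourier transform can be applied to these). -/
abbrev V (d : ℕ) : Type := EuclideanSpace ℂ (Fin d)

/-- A real vector regarded as a complex one. -/
def toV {d : ℕ} (x : E d) : V d := WithLp.toLp 2 fun i => (x i : ℂ)

/-- The unit vector `e_1`. -/
def e₁ (d : ℕ) [NeZero d] : E d := EuclideanSpace.single 0 1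

/-! ### Littlewood-Paley functions and homogeneous Besov norms -/

/-- The Fourier transform in the angular-frequency convention,
`f^(ξ) = ∫ exp (-i x·ξ) f x dx`. Mathlib's `𝓕` is normalized with `exp (-2πi x·w)`. -/
def hat {d : ℕ} (f : E d → ℝ) (ξ : E d) : ℂ :=
  𝓕 (fun x => (f x : ℂ)) ((2 * Real.pi)⁻¹ • ξ)

/-- The `L¹`-normalized dyadic dilation `φ_j (x) = 2^(dj) φ (2^j x)`. -/
def dyadic {d : ℕ} (φ : E d → ℝ) (j : ℤ) (x : E d) : ℝ :=
  (2 : ℝ) ^ ((d : ℤ) * j) * φ ((2 : ℝ) ^ j • x)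

/-- `φ = φ_0` generates a homogeneous Littlewood-Paley decomposition `(φ_j)_{j ∈ ℤ}`. -/
structure IsLittlewoodPaley {d : ℕ} (φ : 𝓢(E d, ℝ)) : Prop where
  support : tsupport (hat φ) ⊆ {ξ : E d | 2⁻¹ ≤ ‖ξ‖ ∧ ‖ξ‖ ≤ 2}
  sum_eq_one : ∀ ξ : E d, ξ ≠ 0 → HasSum (fun j : ℤ => hat (dyadic φ j) ξ) 1

/-- The convolution `(φ_j * f)(x) = ∫ φ_j (x - y) f y dy`. -/
def block {d : ℕ} {F : Type*} [NormedAddCommGroup F] [NormedSpace ℝ F]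
    (φ : E d → ℝ) (j : ℤ) (f : E d → F) (x : E d) : F :=
  ∫ y, dyadic φ j (x - y) • f y

/-- The homogeneous Besov norm `‖f‖ = (∑_j (2^(sj) ‖φ_j * f‖_p)^q)^(1/q)` (for `q < ∞`), with values
in `[0, ∞]`. -/
def besovNorm {d : ℕ} {F : Type*} [NormedAddCommGroup F] [NormedSpace ℝ F]
    (φ : E d → ℝ) (s : ℝ) (p : ℝ≥0∞) (q : ℝ) (f : E d → F) : ℝ≥0∞ :=
  (∑' j : ℤ, (ENNReal.ofReal ((2 : ℝ) ^ (s * j)) * eLpNorm (block φ j f) p volume) ^ q) ^ (1 / q)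

/-! ### The semigroups of the Lamé operator and of the Laplacian -/

/-- The Fourier symbol `-(μ |ξ|² v + (lam + μ) (ξ·v) ξ)` of the Lamé operator
`L = μ Δ + (lam + μ) ∇ div`. -/
def lameSymbol {d : ℕ} (μ lam : ℝ) (ξ : E d) (v : V d) : V d :=
  -(((μ * ‖ξ‖ ^ 2 : ℝ) : ℂ) • v + (((lam + μ : ℝ) : ℂ) * ∑ i, (ξ i : ℂ) * v i) • toV ξ)

/-- The projection of `v` on the direction of `ξ`, namely `(ξ·v / |ξ|²) ξ` (zero if `ξ = 0`). -/
def longitudinal {d : ℕ} (ξ : E d) (v : V d) : V d :=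
  ((∑ i, (ξ i : ℂ) * v i) / ((‖ξ‖ ^ 2 : ℝ) : ℂ)) • toV ξ

/-- The Fourier symbol of `e^{tL}`, the exponential of `t` times the symbol of `L`: it multiplies the
part of `v` orthogonal to `ξ` by `exp (-t μ |ξ|²)` and the part parallel to `ξ` by
`exp (-t (2μ + lam) |ξ|²)`. -/
def lameExpSymbol {d : ℕ} (μ lam t : ℝ) (ξ : E d) (v : V d) : V d :=
  Real.exp (-(t * μ * ‖ξ‖ ^ 2)) • (v - longitudinal ξ v)
    + Real.exp (-(t * (2 * μ + lam) * ‖ξ‖ ^ 2)) • longitudinal ξ v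

theorem lameExpSymbol_zero {d : ℕ} (μ lam : ℝ) (ξ : E d) (v : V d) :
    lameExpSymbol μ lam 0 ξ v = v := by
  simp [lameExpSymbol]

theorem sum_longitudinal {d : ℕ} (ξ : E d) (v : V d) (hξ : ξ ≠ 0) :
    ∑ i, (ξ i : ℂ) * longitudinal ξ v i = ∑ i, (ξ i : ℂ) * v i := by
  have h : (∑ i, (ξ i : ℂ) * (ξ i : ℂ)) = ((‖ξ‖ ^ 2 : ℝ) : ℂ) := by
    rw [EuclideanSpace.real_norm_sq_eq]
    push_cast
    simp only [pow_two]
  have h0 : ((‖ξ‖ ^ 2 : ℝ) : ℂ) ≠ 0 := by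
    exact_mod_cast pow_ne_zero 2 (norm_ne_zero_iff.mpr hξ)
  simp only [longitudinal, toV, PiLp.smul_apply, smul_eq_mul]
  rw [← h] at h0 ⊢
  simp only [mul_left_comm _ (_ / _), ← Finset.mul_sum]
  exact div_mul_cancel₀ _ h0

/-- `e^{t L(ξ)} v` solves `w' = L(ξ) w` (and equals `v` at `t = 0`). -/
theorem hasDerivAt_lameExpSymbol {d : ℕ} (μ lam t : ℝ) (ξ : E d) (v : V d) :
    HasDerivAt (fun t => lameExpSymbol μ lam t ξ v)
      (lameSymbol μ lam ξ (lameExpSymbol μ lam t ξ v)) t := by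
  have h1 (a : ℝ) (w : V d) : HasDerivAt (fun t : ℝ => Real.exp (-(t * a * ‖ξ‖ ^ 2)) • w)
      ((Real.exp (-(t * a * ‖ξ‖ ^ 2)) * -(a * ‖ξ‖ ^ 2)) • w) t := by
    refine HasDerivAt.smul_const ?_ w
    refine HasDerivAt.exp ?_
    simpa using (((hasDerivAt_id t).mul_const a).mul_const (‖ξ‖ ^ 2)).fun_neg
  have h2 := (h1 μ (v - longitudinal ξ v)).fun_add (h1 (2 * μ + lam) (longitudinal ξ v))
  refine h2.congr_deriv ?_
  by_cases hξ : ξ = 0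
  · subst hξ
    ext i
    simp [lameSymbol, longitudinal, toV]
  · have h0 : ((‖ξ‖ : ℝ) : ℂ) ≠ 0 := by exact_mod_cast norm_ne_zero_iff.mpr hξ
    have h3 : ∑ i, (ξ i : ℂ) * lameExpSymbol μ lam t ξ v i
        = (Real.exp (-(t * (2 * μ + lam) * ‖ξ‖ ^ 2)) : ℂ) * ∑ i, (ξ i : ℂ) * v i := by
      have h4 := sum_longitudinal ξ v hξ
      simp only [lameExpSymbol, PiLp.add_apply, PiLp.smul_apply, PiLp.sub_apply, Complex.real_smul,
        mul_add, mul_sub, Finset.sum_add_distrib, Finset.sum_sub_distrib,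
        mul_left_comm _ (Complex.ofReal (Real.exp _)), ← Finset.mul_sum, h4]
      ring
    rw [lameSymbol, h3]
    ext i
    simp only [lameExpSymbol, longitudinal, toV, PiLp.add_apply, PiLp.smul_apply, PiLp.sub_apply,
      PiLp.neg_apply, Complex.real_smul, smul_eq_mul]
    push_cast
    field_simp
    ring

/-- `e^{tL} u`, as a Fourier multiplier (`2πw` is the angular frequency that belongs to `w`). -/
def lameSemigroup {d : ℕ} (μ lam t : ℝ) (u : E d → V d) : E d → V d :=
  𝓕⁻ (fun w : E d => lameExpSymbol μ lam t ((2 * Real.pi) • w) (𝓕 u w))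

/-- The scalar heat semigroup `e^{t κ Δ} g`, as convolution with the Gauss kernel. -/
def heatSemigroup {d : ℕ} (κ t : ℝ) (g : E d → ℝ) (x : E d) : ℝ :=
  if t = 0 then g x
  else ∫ y, (4 * Real.pi * (κ * t)) ^ (-(d : ℝ) / 2)
    * Real.exp (-(‖x - y‖ ^ 2 / (4 * (κ * t)))) * g y

/-- `|∇v|² = ∑_{i,k} |∂_i v_k|²`. -/
def gradSq {d : ℕ} (v : E d → V d) (x : E d) : ℝ :=
  ∑ i : Fin d, ∑ k : Fin d, ‖(fderiv ℝ v x (EuclideanSpace.single i 1)) k‖ ^ 2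

/-- The quadratic Duhamel term `∫_0^t e^{(t-s)κΔ} |∇ e^{sL} u|² ds`. -/
def duhamel {d : ℕ} (μ lam κ t : ℝ) (u : E d → V d) (x : E d) : ℝ :=
  ∫ s in (0 : ℝ)..t, heatSemigroup κ (t - s) (gradSq (lameSemigroup μ lam s u)) x

/-! ### The initial data -/

/-- The first component of the initial velocity:
`R N^(-1/d) ∑_{-δN ≤ j ≤ 0} 2^(-(d-1)j) φ_j (x - 2^(|j|+2N) e_1) sin (2^N x_1)`. -/
def profile {d : ℕ} [NeZero d] (φ : E d → ℝ) (R δ : ℝ) (N : ℕ) (x : E d) : ℝ :=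
  R * (N : ℝ) ^ (-(1 / (d : ℝ))) * ∑ j ∈ Finset.Icc ⌈-(δ * N)⌉ (0 : ℤ),
    (2 : ℝ) ^ (-(((d : ℤ) - 1) * j))
      * dyadic φ j (x - (2 : ℝ) ^ (|j| + 2 * (N : ℤ)) • e₁ d) * Real.sin (2 ^ N * x 0)

/-- The initial velocity `u_{0,N} = (profile, 0, …, 0)`. -/
def initialVelocity {d : ℕ} [NeZero d] (φ : E d → ℝ) (R δ : ℝ) (N : ℕ) (x : E d) : V d :=
  toV (profile φ R δ N x • e₁ d)

end HighFreq

end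

noncomputable section

namespace HighFreq

/-! Write M = 2^N, n = ⌊δN⌋, a = R N^(-1/d). The data are a sin(M x₁) P(x) e₁, where P is the sum
over -n ≤ j ≤ 0 of the bumps 2^j φ(2^j (x - c_j)). The distance of two centres is at least 2^(2N)/2
times the larger of the two widths 2^(-j).

Evolution. The wave vectors ±M e₁ are parallel to the polarization e₁, so on them e^{sL} is
multiplication by exp(-s(2μ+lam)M²), which stays bounded below for s ≤ M⁻². A Lipschitz bound for
the symbol (`norm_smul_lameExpSymbol_sub_le`) and Plancherel show that the gradient of e^{sL}u is M
a exp(-s(2μ+lam)M²) cos(M x₁) P e₁, in the direction x₁, up to an L² error of the size of a∇P,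
without a factor M. Since cos² = 1/2 + cos(2·)/2, squaring produces a low-frequency part comparable
to M² a² P². Integrated up to t = ε₀ M⁻² it has size ε₀ a² P², and the heat flow displaces mass only
by √(κt), which is O(1/M).

Lower bound by duality. Pairing φ_k * Θ with φ(2^k (x - x₀)) yields Θ tested against the
autocorrelation of φ, which is positive near 0 (`integral_block_mul`). With x₀ = c_j and k = j - m
for a fixed m, Hölder's inequality gives the weight 2^((d-2)k), and the squared bump has mass
proportional to 2^((2-d)j). The powers of 2^j cancel, so each usable j contributes a multiple of ε₀
a². All errors are smaller by 1/M but carry the mass (n+1)² 2^((d-2)n) of the widest bump, so only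
the j with d(j+n) ≤ N are used. There are at least δN/d of these, for every δ in (0,1). The sum is
of order δR²N^(1-2/d), which suffices for d ≥ 3. For d = 2 the power is too small, but then the norm
is infinite: Θ is nonnegative with positive integral, and its blocks do not decay as k → -∞
(`besovNorm_eq_top`). Hence for large N no subtracted term is needed; it only absorbs finitely many
small N, after c is decreased.

Upper bound for d = 3. The frequencies of the data lie within 2 of the sphere of radius M, so for N
≥ 2 at most five blocks are nonzero. Young's inequality reduces these to the L³ norm of the data.
There the bumps are almost disjoint and each has the same norm, which gives a (n+1)^(1/3). The case
N = 1 is treated separately through L¹. -/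

/-! ### Plancherel for the Fourier integral on L¹ ∩ L² -/

theorem eLpNorm_fourier_eq {d : ℕ} {f : E d → V d} (h1 : Integrable f) (h2 : MemLp f 2) :
    MemLp (𝓕 f) 2 ∧ eLpNorm (𝓕 f) 2 = eLpNorm f 2 := by
  set g : Lp (V d) 2 (volume : Measure (E d)) := 𝓕 (h2.toLp f) with hg
  have hcont : Continuous (𝓕 f) :=
    VectorFourier.fourierIntegral_continuous Real.continuous_fourierChar
      (by exact continuous_inner) h1
  have hae : (g : E d → V d) =ᵐ[volume] 𝓕 f := by
    -- The L² extension of the Fourier transform and the Fourier integral agree as distributions: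
    -- both move onto the test function, the first by definition on tempered distributions, the
    -- second by Fubini.
    refine ae_eq_of_integral_contDiff_smul_eq ((Lp.memLp g).locallyIntegrable (by norm_num))
      hcont.locallyIntegrable ?_
    intro ρ hρ hρc
    have hg₁ : HasCompactSupport (Complex.ofRealCLM ∘ ρ) := hρc.comp_left rfl
    have hg₂ : ContDiff ℝ (⊤ : ℕ∞) (Complex.ofRealCLM ∘ ρ) := by fun_prop
    set r : 𝓢(E d, ℂ) := hg₁.toSchwartzMap hg₂
    have hr (x) : r x = (ρ x : ℂ) := rfl
    have e1 := congrArg (fun T => T r) (Lp.fourier_toTemperedDistribution_eq (h2.toLp f))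
    simp only [TemperedDistribution.fourier_apply, Lp.toTemperedDistribution_apply] at e1
    have e2 := VectorFourier.integral_fourierIntegral_smul_eq_flip (μ := (volume : Measure (E d)))
      (ν := (volume : Measure (E d)))
      (L := innerₗ (E d)) Real.continuous_fourierChar (by exact continuous_inner) r.integrable h1
    have e3 : ∫ x, (𝓕 r) x • (h2.toLp f) x = ∫ x, (𝓕 r) x • f x := by
      refine integral_congr_ae ?_
      filter_upwards [h2.coeFn_toLp] with x hx
      rw [hx]
    rw [flip_innerₗ] at e2
    calc ∫ x, ρ x • g x = ∫ x, r x • g x := by simp [hr]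
      _ = ∫ x, (𝓕 r) x • f x := by rw [← e3, e1]
      _ = ∫ x, r x • 𝓕 f x := e2
      _ = _ := by simp [hr]
  refine ⟨(memLp_congr_ae hae).1 (Lp.memLp g), ?_⟩
  rw [← eLpNorm_congr_ae hae]
  have := Lp.norm_fourier_eq (h2.toLp f)
  rw [← hg, Lp.norm_def, Lp.norm_def, ENNReal.toReal_eq_toReal_iff' (Lp.eLpNorm_ne_top _) (Lp.eLpNorm_ne_top _),
    eLpNorm_congr_ae h2.coeFn_toLp] at this
  exact this

theorem eLpNorm_fourierInv_eq {d : ℕ} {f : E d → V d} (h1 : Integrable f) (h2 : MemLp f 2) :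
    MemLp (𝓕⁻ f) 2 ∧ eLpNorm (𝓕⁻ f) 2 = eLpNorm f 2 := by
  have hm := Measure.measurePreserving_neg (volume : Measure (E d))
  obtain ⟨h3, h4⟩ := eLpNorm_fourier_eq (h1.comp_neg) (h2.comp_measurePreserving hm)
  rw [Real.fourierInv_eq_fourier_comp_neg]
  refine ⟨h3, h4.trans ?_⟩
  exact eLpNorm_comp_measurePreserving h2.1 hm

theorem integral_norm_sq_fourierInv_eq {d : ℕ} {f : E d → V d} (h1 : Integrable f)
    (h2 : MemLp f 2) : ∫ x, ‖𝓕⁻ f x‖ ^ 2 = ∫ x, ‖f x‖ ^ 2 := by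
  obtain ⟨h3, h4⟩ := eLpNorm_fourierInv_eq h1 h2
  rw [h3.eLpNorm_eq_integral_rpow_norm (by norm_num) (by norm_num),
    h2.eLpNorm_eq_integral_rpow_norm (by norm_num) (by norm_num),
    ENNReal.ofReal_eq_ofReal_iff (by positivity) (by positivity)] at h4
  simp only [ENNReal.toReal_ofNat, Real.rpow_ofNat] at h4
  exact (Real.rpow_left_inj (by positivity) (by positivity) (by norm_num)).1 h4

/-! ### The Lamé symbol near the frequency M e₁ -/

theorem norm_sub_proj_le {F : Type*} [NormedAddCommGroup F] [InnerProductSpace ℝ F] (x ξ : F)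
    (c : ℝ) : ‖x - (inner ℝ ξ x / ‖ξ‖ ^ 2) • ξ‖ ≤ ‖x - c • ξ‖ := by
  rcases eq_or_ne ξ 0 with rfl | hξ
  · simp
  have h0 : ‖ξ‖ ^ 2 ≠ 0 := pow_ne_zero 2 (norm_ne_zero_iff.mpr hξ)
  set p := inner ℝ ξ x / ‖ξ‖ ^ 2 with hp
  have e : x - c • ξ = (x - p • ξ) + (p - c) • ξ := by module
  have ho : inner ℝ (x - p • ξ) ((p - c) • ξ) = 0 := by
    rw [inner_smul_right, inner_sub_left, inner_smul_left, real_inner_self_eq_norm_sq,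
      real_inner_comm]
    simp only [conj_trivial]
    rw [hp]
    field_simp
    ring
  have h := norm_add_sq_eq_norm_sq_add_norm_sq_of_inner_eq_zero _ _ ho
  rw [← e] at h
  have : ‖x - p • ξ‖ * ‖x - p • ξ‖ ≤ ‖x - c • ξ‖ * ‖x - c • ξ‖ := by
    rw [h]; nlinarith [norm_nonneg ((p - c) • ξ)]
  exact abs_le_of_sq_le_sq' (by nlinarith) (norm_nonneg _) |>.2

/-- `toV` as a real linear isometry. -/
def toVₗᵢ (d : ℕ) : E d →ₗᵢ[ℝ] V d where
  toFun := toV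
  map_add' x y := by ext i; simp [toV]
  map_smul' c x := by ext i; simp [toV]
  norm_map' x := by simp [toV, EuclideanSpace.norm_eq]

theorem toVₗᵢ_apply {d : ℕ} (x : E d) : toVₗᵢ d x = toV x := rfl

theorem norm_toV {d : ℕ} (x : E d) : ‖toV x‖ = ‖x‖ := (toVₗᵢ d).norm_map x

theorem norm_e₁ (d : ℕ) [NeZero d] : ‖e₁ d‖ = 1 := by simp [e₁]

theorem inner_e₁ {d : ℕ} [NeZero d] (ξ : E d) : inner ℝ ξ (e₁ d) = ξ 0 := by
  simp [e₁, EuclideanSpace.inner_single_right]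

theorem longitudinal_e₁ {d : ℕ} [NeZero d] (ξ : E d) :
    longitudinal ξ (toV (e₁ d)) = toV ((inner ℝ ξ (e₁ d) / ‖ξ‖ ^ 2) • ξ) := by
  rw [inner_e₁]
  ext i
  have : ∑ i, (ξ i : ℂ) * (toV (e₁ d)) i = ξ 0 := by
    rw [Finset.sum_eq_single 0] <;> simp +contextual [toV, e₁]
  simp only [longitudinal, this]
  simp [toV]

theorem norm_sub_longitudinal_le {d : ℕ} [NeZero d] (ξ : E d) :
    ‖toV (e₁ d) - longitudinal ξ (toV (e₁ d))‖ ≤ 1 := by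
  rw [longitudinal_e₁, ← toVₗᵢ_apply, ← toVₗᵢ_apply, ← map_sub, LinearIsometry.norm_map]
  simpa [norm_e₁] using norm_sub_proj_le (e₁ d) ξ 0

/-- The orthogonal projection of e₁ on the line of ξ is the nearest point of that line, hence at
least as close as M⁻¹ξ. This is what makes the transversal part of e₁ small when ξ is near M e₁. -/
theorem mul_norm_sub_longitudinal_le {d : ℕ} [NeZero d] (ξ : E d) {M : ℝ} (hM : 0 < M) :
    M * ‖toV (e₁ d) - longitudinal ξ (toV (e₁ d))‖ ≤ ‖ξ - M • e₁ d‖ := by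
  rw [longitudinal_e₁, ← toVₗᵢ_apply, ← toVₗᵢ_apply, ← map_sub, LinearIsometry.norm_map]
  have h := norm_sub_proj_le (e₁ d) ξ M⁻¹
  have h2 : ‖ξ - M • e₁ d‖ = M * ‖e₁ d - M⁻¹ • ξ‖ := by
    rw [norm_sub_rev, ← abs_of_pos hM, ← Real.norm_eq_abs, ← norm_smul, smul_sub, smul_smul,
      Real.norm_of_nonneg hM.le, mul_inv_cancel₀ hM.ne', one_smul]
  rw [h2]
  gcongr

theorem abs_exp_neg_sub_exp_neg_le {x y : ℝ} (hx : 0 ≤ x) (hy : 0 ≤ y) :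
    |Real.exp (-x) - Real.exp (-y)| ≤ |x - y| := by
  wlog h : x ≤ y generalizing x y
  · rw [abs_sub_comm, abs_sub_comm x]
    exact this hy hx (le_of_not_ge h)
  have h1 : Real.exp (-y) ≤ Real.exp (-x) := Real.exp_le_exp.2 (by linarith)
  rw [abs_of_nonneg (by linarith), abs_sub_comm, abs_of_nonneg (by linarith)]
  have h2 : Real.exp (-y) = Real.exp (-x) * Real.exp (-(y - x)) := by
    rw [← Real.exp_add]; ring_nf
  have h3 := Real.add_one_le_exp (-(y - x))
  have h4 : Real.exp (-x) ≤ 1 := Real.exp_le_one_iff.2 (by linarith)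
  have h5 := Real.exp_pos (-x)
  rw [h2]
  nlinarith

/-- The symbol `ξ_i e^{sL(ξ)} e_1` differs from its value at `M e_1` by at most a multiple of the
distance of `ξ` and `M e_1`. -/
theorem norm_smul_lameExpSymbol_sub_le {d : ℕ} [NeZero d] {μ lam s M : ℝ} (hμ : 0 < μ)
    (hlam : 0 < 2 * μ + lam) (hs : 0 ≤ s) (hM : 0 < M) (hsM : s * M ^ 2 ≤ 1) (ξ : E d)
    (i : Fin d) :
    ‖ξ i • lameExpSymbol μ lam s ξ (toV (e₁ d))
      - (M * Real.exp (-(s * (2 * μ + lam) * M ^ 2)) * e₁ d i) • toV (e₁ d)‖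
      ≤ (4 + 3 * (2 * μ + lam)) * ‖ξ - M • e₁ d‖ := by
  set ν := 2 * μ + lam
  set T := toV (e₁ d)
  set L := longitudinal ξ T
  set ρ := ‖ξ - M • e₁ d‖ with hρ
  have hρ0 : 0 ≤ ρ := norm_nonneg _
  set a := Real.exp (-(s * μ * ‖ξ‖ ^ 2)) with ha
  set b := Real.exp (-(s * ν * ‖ξ‖ ^ 2)) with hb
  set c := Real.exp (-(s * ν * M ^ 2)) with hc
  have ha0 : 0 < a := Real.exp_pos _
  have hb0 : 0 < b := Real.exp_pos _
  have hc0 : 0 < c := Real.exp_pos _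
  have ha1 : a ≤ 1 := Real.exp_le_one_iff.2 (by have : 0 ≤ s * μ * ‖ξ‖ ^ 2 := by positivity
                                                linarith)
  have hb1 : b ≤ 1 := Real.exp_le_one_iff.2 (by have : 0 ≤ s * ν * ‖ξ‖ ^ 2 := by positivity
                                                linarith)
  have hc1 : c ≤ 1 := Real.exp_le_one_iff.2 (by have : 0 ≤ s * ν * M ^ 2 := by positivity
                                                linarith)
  have hT : ‖T‖ = 1 := by rw [norm_toV, norm_e₁]
  have hδ : |e₁ d i| ≤ 1 := by
    rw [← norm_e₁ d]; exact PiLp.norm_apply_le (e₁ d) i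
  have hξi : |ξ i - M * e₁ d i| ≤ ρ := PiLp.norm_apply_le (ξ - M • e₁ d) i
  have hξ : |ξ i| ≤ ‖ξ‖ := PiLp.norm_apply_le ξ i
  have hMe : ‖M • e₁ d‖ = M := by rw [norm_smul, norm_e₁, mul_one, Real.norm_of_nonneg hM.le]
  have hξM : ‖ξ‖ ≤ M + ρ := by
    have := norm_le_norm_add_norm_sub (M • e₁ d) ξ
    rw [hMe, norm_sub_rev] at this; linarith
  have hMξ : |‖ξ‖ - M| ≤ ρ := by
    have := abs_norm_sub_norm_le ξ (M • e₁ d)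
    rwa [hMe] at this
  -- Three sources of error: the transversal part of e₁, which decays at the rate μ instead of 2μ +
  -- lam; the coordinate ξ_i; and the damping factor at |ξ| instead of M.
  have e : ξ i • lameExpSymbol μ lam s ξ T - (M * c * e₁ d i) • T
      = (ξ i * (a - b)) • (T - L) + (b * (ξ i - M * e₁ d i)) • T
        + (M * (b - c) * e₁ d i) • T := by
    simp only [lameExpSymbol]
    module
  have h1 : ‖(ξ i * (a - b)) • (T - L)‖ ≤ 2 * ρ := by
    rw [norm_smul, Real.norm_eq_abs, abs_mul]
    have hab : |a - b| ≤ 1 := abs_le.2 ⟨by linarith, by linarith⟩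
    calc |ξ i| * |a - b| * ‖T - L‖ ≤ (M + ρ) * 1 * ‖T - L‖ := by gcongr; linarith
      _ = M * ‖T - L‖ + ρ * ‖T - L‖ := by ring
      _ ≤ ρ + ρ * 1 := by
        gcongr
        · exact mul_norm_sub_longitudinal_le ξ hM
        · exact norm_sub_longitudinal_le ξ
      _ = 2 * ρ := by ring
  have h2 : ‖(b * (ξ i - M * e₁ d i)) • T‖ ≤ ρ := by
    rw [norm_smul, Real.norm_eq_abs, abs_mul, hT, mul_one, abs_of_pos hb0]
    calc b * _ ≤ 1 * ρ := by gcongr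
      _ = ρ := one_mul _
  have h3 : ‖(M * (b - c) * e₁ d i) • T‖ ≤ (1 + 3 * ν) * ρ := by
    rw [norm_smul, Real.norm_eq_abs, abs_mul, abs_mul, hT, mul_one, abs_of_pos hM]
    have h4 : M * |b - c| ≤ (1 + 3 * ν) * ρ := by
      -- For |ξ| ≤ 2M the exponentials are compared through their exponents, and sM² ≤ 1 cancels the
      -- powers of M. For |ξ| ≥ 2M one has M ≤ ρ, so the trivial bound 1 is enough.
      rcases le_total ‖ξ‖ (2 * M) with h | h
      · have := abs_exp_neg_sub_exp_neg_le (x := s * ν * ‖ξ‖ ^ 2) (y := s * ν * M ^ 2)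
          (by positivity) (by positivity)
        calc M * |b - c| ≤ M * |s * ν * ‖ξ‖ ^ 2 - s * ν * M ^ 2| := by gcongr
          _ = M * (s * ν * ((‖ξ‖ + M) * |‖ξ‖ - M|)) := by
            have e2 : s * ν * ‖ξ‖ ^ 2 - s * ν * M ^ 2 = s * ν * ((‖ξ‖ + M) * (‖ξ‖ - M)) := by
              ring
            rw [e2, abs_mul (s * ν), abs_mul (‖ξ‖ + M), abs_of_nonneg (by positivity : 0 ≤ s * ν),
              abs_of_nonneg (by positivity : 0 ≤ ‖ξ‖ + M)]
          _ ≤ M * (s * ν * ((2 * M + M) * ρ)) := by gcongr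
          _ = 3 * ν * (s * M ^ 2) * ρ := by ring
          _ ≤ 3 * ν * 1 * ρ := by gcongr
          _ ≤ (1 + 3 * ν) * ρ := by nlinarith
      · have hbc : |b - c| ≤ 1 := abs_le.2 ⟨by linarith, by linarith⟩
        have : 0 ≤ ν * ρ := by positivity
        have : M * |b - c| ≤ M * 1 := by gcongr
        nlinarith [(abs_le.1 hMξ).2]
    calc M * |b - c| * |e₁ d i| ≤ M * |b - c| * 1 := by gcongr
      _ ≤ _ := by rw [mul_one]; exact h4
  rw [e]
  calc _ ≤ 2 * ρ + ρ + (1 + 3 * ν) * ρ := by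
        refine (norm_add_le _ _).trans (add_le_add ((norm_add_le _ _).trans (add_le_add h1 h2)) h3)
    _ = _ := by ring

/-! ### The gradient of the evolved field -/

/-- The field `sin (M x_1) Q(x) e_1`. -/
def sinField {d : ℕ} [NeZero d] (M : ℝ) (Q : 𝓢(E d, ℂ)) (x : E d) : V d :=
  ((Real.sin (M * x 0) : ℂ) * Q x) • toV (e₁ d)

/-- The field `cos (M x_1) Q(x) e_1`. -/
def cosField {d : ℕ} [NeZero d] (M : ℝ) (Q : 𝓢(E d, ℂ)) (x : E d) : V d :=
  ((Real.cos (M * x 0) : ℂ) * Q x) • toV (e₁ d)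

/-- The frequency of the modulation `exp (i M x_1)`, in the convention of `𝓕`. -/
def modFreq (d : ℕ) [NeZero d] (M : ℝ) : E d := (M / (2 * Real.pi)) • e₁ d

/-- Shift of the Fourier transform of `Q`. -/
def shiftHat {d : ℕ} (Q : 𝓢(E d, ℂ)) (a : E d) : 𝓢(E d, ℂ) := compSubConstCLM ℂ a (𝓕 Q)

theorem shiftHat_apply {d : ℕ} (Q : 𝓢(E d, ℂ)) (a w : E d) :
    shiftHat Q a w = 𝓕 (Q : E d → ℂ) (w - a) := rfl

theorem fourier_const_smul_right {d : ℕ} {f : E d → ℂ} (v : V d) (w : E d) :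
    𝓕 (fun x => f x • v) w = 𝓕 f w • v := by
  simp only [Real.fourier_eq', ← smul_assoc]
  exact integral_smul_const _ v

/-- Modulation shifts frequency; c = 1 and c = -1 give the two exponentials that make up the sine
and the cosine. -/
theorem exp_modFreq {d : ℕ} [NeZero d] (M : ℝ) (x w : E d) (c : ℝ) :
    Complex.exp ((↑(-2 * Real.pi * inner ℝ x w) * Complex.I)) * Complex.exp ((c * (M * x 0) : ℝ) * Complex.I)
      = Complex.exp ((↑(-2 * Real.pi * inner ℝ x (w - c • modFreq d M)) * Complex.I)) := by
  rw [← Complex.exp_add, ← add_mul, ← Complex.ofReal_add]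
  congr 4
  rw [inner_sub_right, inner_smul_right, modFreq, inner_smul_right, inner_e₁]
  have := Real.pi_ne_zero
  field_simp
  ring

theorem integrable_exp_mul {d : ℕ} (Q : 𝓢(E d, ℂ)) (w : E d) :
    Integrable (fun x => Complex.exp ((↑(-2 * Real.pi * inner ℝ x w) * Complex.I)) * Q x) := by
  refine Q.integrable.bdd_mul (c := 1) (Continuous.aestronglyMeasurable (by fun_prop)) ?_
  filter_upwards with x
  rw [Complex.norm_exp_ofReal_mul_I]

theorem fourier_sinField {d : ℕ} [NeZero d] (M : ℝ) (Q : 𝓢(E d, ℂ)) (w : E d) :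
    𝓕 (sinField M Q) w = ((2 * Complex.I)⁻¹ *
      (shiftHat Q (modFreq d M) w - shiftHat Q (-modFreq d M) w)) • toV (e₁ d) := by
  unfold sinField
  rw [fourier_const_smul_right]
  congr 1
  rw [shiftHat_apply, shiftHat_apply]
  simp only [Real.fourier_eq', smul_eq_mul]
  rw [← integral_sub (integrable_exp_mul Q _) (integrable_exp_mul Q _), ← integral_const_mul]
  congr 1 with x
  have h1 := exp_modFreq M x w 1
  have h2 := exp_modFreq M x w (-1)
  rw [one_smul] at h1
  rw [neg_one_smul] at h2
  rw [← h1, ← h2, Complex.ofReal_sin, Complex.sin]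
  push_cast
  field_simp
  rw [Complex.I_sq]
  ring_nf

theorem fourier_cosField {d : ℕ} [NeZero d] (M : ℝ) (Q : 𝓢(E d, ℂ)) (w : E d) :
    𝓕 (cosField M Q) w = ((2 : ℂ)⁻¹ *
      (shiftHat Q (modFreq d M) w + shiftHat Q (-modFreq d M) w)) • toV (e₁ d) := by
  unfold cosField
  rw [fourier_const_smul_right]
  congr 1
  rw [shiftHat_apply, shiftHat_apply]
  simp only [Real.fourier_eq', smul_eq_mul]
  rw [← integral_add (integrable_exp_mul Q _) (integrable_exp_mul Q _), ← integral_const_mul]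
  congr 1 with x
  have h1 := exp_modFreq M x w 1
  have h2 := exp_modFreq M x w (-1)
  rw [one_smul] at h1
  rw [neg_one_smul] at h2
  rw [← h1, ← h2, Complex.ofReal_cos, Complex.cos]
  push_cast
  ring_nf

/-- The `i`-th partial derivative of `e^{sL} u`. -/
def lameDeriv {d : ℕ} (μ lam : ℝ) (u : E d → V d) (i : Fin d) (s : ℝ) : E d → V d :=
  𝓕⁻ (fun w : E d => (2 * Real.pi * Complex.I * w i) •
    lameExpSymbol μ lam s ((2 * Real.pi) • w) (𝓕 u w))

theorem fderiv_fourierInv_apply {d : ℕ} {g : E d → V d} (h1 : Integrable g)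
    (h2 : Integrable (fun w => ‖w‖ * ‖g w‖)) (x : E d) (i : Fin d) :
    fderiv ℝ (𝓕⁻ g) x (EuclideanSpace.single i 1)
      = 𝓕⁻ (fun w : E d => (2 * Real.pi * Complex.I * w i) • g w) x := by
  have h1' := h1.comp_neg
  have h2' : Integrable (fun w => ‖w‖ * ‖g (-w)‖) := by simpa using h2.comp_neg
  rw [Real.fourierInv_eq_fourier_comp_neg, Real.fderiv_fourier h1' h2',
    Real.fourier_continuousLinearMap_apply, Real.fourierInv_eq_fourier_comp_neg]
  · refine congrArg (fun h : E d → V d => 𝓕 h x) (funext fun w => ?_)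
    rw [VectorFourier.fourierSMulRight_apply, innerSL_apply_apply,
      EuclideanSpace.inner_single_right, ← Complex.coe_smul, smul_smul]
    simp
  · refine (h2'.const_mul (2 * Real.pi * ‖innerSL ℝ (E := E d)‖)).mono'
      (h1'.1.fourierSMulRight) ?_
    filter_upwards with w
    rw [← mul_assoc]
    exact VectorFourier.norm_fourierSMulRight_le _ _ _

theorem lameExpSymbol_smul {d : ℕ} (μ lam s : ℝ) (ξ : E d) (c : ℂ) (v : V d) :
    lameExpSymbol μ lam s ξ (c • v) = c • lameExpSymbol μ lam s ξ v := by
  have : longitudinal ξ (c • v) = c • longitudinal ξ v := by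
    simp only [longitudinal, PiLp.smul_apply, smul_eq_mul, mul_left_comm _ c, ← Finset.mul_sum,
      mul_div_assoc, mul_smul]
  simp only [lameExpSymbol, this, smul_add, smul_sub, smul_comm c]

theorem _root_.Measurable.lameExpSymbol {d : ℕ} [NeZero d] {α : Type*} [MeasurableSpace α]
    (μ lam : ℝ) {f : α → ℝ} {g : α → E d} (hf : Measurable f) (hg : Measurable g) :
    Measurable fun a => lameExpSymbol μ lam (f a) (g a) (toV (e₁ d)) := by
  have h : Measurable fun a => longitudinal (g a) (toV (e₁ d)) := by
    simp only [longitudinal_e₁]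
    exact (toVₗᵢ d).continuous.measurable.comp (by fun_prop)
  have ha (c : ℝ) : Measurable fun a => Real.exp (-(f a * c * ‖g a‖ ^ 2)) := by
    fun_prop
  have h' : Measurable fun a => toV (e₁ d) - longitudinal (g a) (toV (e₁ d)) :=
    h.const_sub _
  exact ((ha μ).smul h').add ((ha (2 * μ + lam)).smul h)

theorem lameExpSymbol_neg {d : ℕ} (μ lam s : ℝ) (ξ : E d) (v : V d) :
    lameExpSymbol μ lam s (-ξ) v = lameExpSymbol μ lam s ξ v := by
  have : longitudinal (-ξ) v = longitudinal ξ v := by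
    ext i
    simp [longitudinal, toV, neg_div]
  simp only [lameExpSymbol, this, norm_neg]

theorem norm_lameExpSymbol_le {d : ℕ} [NeZero d] {μ lam s : ℝ} (hμ : 0 < μ)
    (hlam : 0 < 2 * μ + lam) (hs : 0 ≤ s) (ξ : E d) :
    ‖lameExpSymbol μ lam s ξ (toV (e₁ d))‖ ≤ 3 := by
  have hL := norm_sub_longitudinal_le ξ
  have hT : ‖toV (e₁ d)‖ = 1 := by rw [norm_toV, norm_e₁]
  have hL2 : ‖longitudinal ξ (toV (e₁ d))‖ ≤ 2 := by
    have := norm_sub_norm_le (longitudinal ξ (toV (e₁ d))) (toV (e₁ d))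
    rw [norm_sub_rev] at this
    linarith
  have ha1 : Real.exp (-(s * μ * ‖ξ‖ ^ 2)) ≤ 1 :=
    Real.exp_le_one_iff.2 (by have : 0 ≤ s * μ * ‖ξ‖ ^ 2 := by positivity
                              linarith)
  have hb1 : Real.exp (-(s * (2 * μ + lam) * ‖ξ‖ ^ 2)) ≤ 1 :=
    Real.exp_le_one_iff.2 (by have : 0 ≤ s * (2 * μ + lam) * ‖ξ‖ ^ 2 := by positivity
                              linarith)
  refine (norm_add_le _ _).trans ?_
  rw [norm_smul, norm_smul, Real.norm_of_nonneg (Real.exp_pos _).le,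
    Real.norm_of_nonneg (Real.exp_pos _).le]
  calc _ ≤ (1 : ℝ) * 1 + 1 * 2 := by gcongr
    _ = 3 := by norm_num

theorem fourierInv_sub {d : ℕ} {f g : E d → V d} (hf : Integrable f) (hg : Integrable g)
    (x : E d) : 𝓕⁻ (fun w => f w - g w) x = 𝓕⁻ f x - 𝓕⁻ g x := by
  have key {h : E d → V d} (hh : Integrable h) :
      Integrable fun v => Real.fourierChar (inner ℝ v x) • h v := by
    have := (Real.fourierIntegral_convergent_iff (f := h) (-x)).2 hh
    simpa using this
  simp only [Real.fourierInv_eq, smul_sub]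
  exact integral_sub (key hf) (key hg)

theorem fourierInv_real_smul {d : ℕ} (f : E d → V d) (r : ℝ) (x : E d) :
    𝓕⁻ (fun w => r • f w) x = r • 𝓕⁻ f x := by
  simp only [Real.fourierInv_eq, smul_comm _ r]
  exact integral_smul r _

/-- The data have the constant direction e₁, so by linearity the symbol is only ever needed on that
one vector. -/
theorem lameDeriv_hat_eq {d : ℕ} [NeZero d] (μ lam M : ℝ) (Q : 𝓢(E d, ℂ)) (i : Fin d) (s : ℝ)
    (w : E d) :
    (2 * Real.pi * Complex.I * w i) •
      lameExpSymbol μ lam s ((2 * Real.pi) • w) (𝓕 (sinField M Q) w)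
    = ((2 : ℂ)⁻¹ * (shiftHat Q (modFreq d M) w - shiftHat Q (-modFreq d M) w)) •
      (((2 * Real.pi) • w) i • lameExpSymbol μ lam s ((2 * Real.pi) • w) (toV (e₁ d))) := by
  rw [fourier_sinField, lameExpSymbol_smul, smul_smul, ← Complex.coe_smul, smul_smul]
  congr 1
  simp only [PiLp.smul_apply, smul_eq_mul]
  push_cast
  field_simp

theorem integrable_sq_norm_mul {d : ℕ} (f : 𝓢(E d, ℂ)) :
    Integrable fun w => (‖w‖ * ‖f w‖) ^ 2 := by
  have h := f.integrable_pow_mul volume 2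
  refine (h.mul_bdd (g := fun w => ‖f w‖) (c := SchwartzMap.seminorm ℝ 0 0 f)
    (f.continuous.norm.aestronglyMeasurable) ?_).congr ?_
  · filter_upwards with w
    rw [norm_norm]
    exact f.norm_le_seminorm ℝ w
  · filter_upwards with w
    ring

section evolved
variable {d : ℕ} [NeZero d] {μ lam s M : ℝ}

theorem norm_lameDeriv_hat_le (hμ : 0 < μ) (hlam : 0 < 2 * μ + lam)
    (hs : 0 ≤ s) (Q : 𝓢(E d, ℂ)) (i : Fin d) (w : E d) :
    ‖(2 * Real.pi * Complex.I * w i) •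
      lameExpSymbol μ lam s ((2 * Real.pi) • w) (𝓕 (sinField M Q) w)‖
    ≤ 3 * Real.pi * (‖w‖ * ‖shiftHat Q (modFreq d M) w‖ + ‖w‖ * ‖shiftHat Q (-modFreq d M) w‖) := by
  rw [lameDeriv_hat_eq, norm_smul, norm_smul, norm_mul]
  have h1 := norm_lameExpSymbol_le hμ hlam hs ((2 * Real.pi) • w)
  have h2 : ‖((2 * Real.pi) • w) i‖ ≤ 2 * Real.pi * ‖w‖ := by
    refine (PiLp.norm_apply_le _ i).trans ?_
    rw [norm_smul, Real.norm_of_nonneg (by positivity)]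
  have h3 : ‖(2 : ℂ)⁻¹‖ = 1 / 2 := by simp
  rw [h3]
  calc _ ≤ 1 / 2 * (‖shiftHat Q (modFreq d M) w‖ + ‖shiftHat Q (-modFreq d M) w‖)
        * ((2 * Real.pi * ‖w‖) * 3) := by
        gcongr
        exact norm_sub_le _ _
    _ = _ := by ring

theorem measurable_lameDeriv_hat (Q : 𝓢(E d, ℂ)) (i : Fin d) {α : Type*}
    [MeasurableSpace α] {f : α → ℝ} {g : α → E d} (hf : Measurable f) (hg : Measurable g) :
    Measurable fun p => (2 * Real.pi * Complex.I * (g p) i) •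
      lameExpSymbol μ lam (f p) ((2 * Real.pi) • (g p)) (𝓕 (sinField M Q) (g p)) := by
  have h1 := (shiftHat Q (modFreq d M)).continuous.measurable
  have h2 := (shiftHat Q (-modFreq d M)).continuous.measurable
  have h3 : Measurable fun p =>
      lameExpSymbol μ lam (f p) ((2 * Real.pi) • (g p)) (toV (e₁ d)) :=
    Measurable.lameExpSymbol μ lam hf (by fun_prop)
  have h4 : Measurable fun p => ((2 * Real.pi) • (g p)) i := by
    simp only [PiLp.smul_apply]
    fun_prop
  have h5 : Measurable fun p =>
      (2 : ℂ)⁻¹ * (shiftHat Q (modFreq d M) (g p) - shiftHat Q (-modFreq d M) (g p)) := by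
    fun_prop
  have h6 := h4.fun_smul h3
  have h7 := h5.fun_smul h6
  simp only [lameDeriv_hat_eq]
  exact h7

theorem integrable_lameDeriv_hat (hμ : 0 < μ) (hlam : 0 < 2 * μ + lam)
    (hs : 0 ≤ s) (Q : 𝓢(E d, ℂ)) (i : Fin d) :
    Integrable fun w : E d => (2 * Real.pi * Complex.I * w i) •
      lameExpSymbol μ lam s ((2 * Real.pi) • w) (𝓕 (sinField M Q) w) := by
  have h (a : E d) : Integrable fun w => ‖w‖ * ‖shiftHat Q a w‖ := by
    simpa using (shiftHat Q a).integrable_pow_mul volume 1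
  refine Integrable.mono' (((h _).add (h _)).const_mul _) ?_
    (Filter.Eventually.of_forall (norm_lameDeriv_hat_le hμ hlam hs Q i))
  exact (measurable_lameDeriv_hat Q i measurable_const measurable_id).aestronglyMeasurable

theorem memLp_lameDeriv_hat (hμ : 0 < μ) (hlam : 0 < 2 * μ + lam)
    (hs : 0 ≤ s) (Q : 𝓢(E d, ℂ)) (i : Fin d) :
    MemLp (fun w : E d => (2 * Real.pi * Complex.I * w i) •
      lameExpSymbol μ lam s ((2 * Real.pi) • w) (𝓕 (sinField M Q) w)) 2 := by
  have h (a : E d) : MemLp (fun w => ‖w‖ * ‖shiftHat Q a w‖) 2 := by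
    rw [memLp_two_iff_integrable_sq]
    · exact integrable_sq_norm_mul _
    · exact (continuous_norm.mul (shiftHat Q a).continuous.norm).aestronglyMeasurable
  refine MemLp.mono (((h _).add (h _)).const_mul (3 * Real.pi)) ?_
    (Filter.Eventually.of_forall fun w =>
      (norm_lameDeriv_hat_le (M := M) hμ hlam hs Q i w).trans (le_abs_self _))
  exact (measurable_lameDeriv_hat Q i measurable_const measurable_id).aestronglyMeasurable

theorem fderiv_lameSemigroup (hμ : 0 < μ) (hlam : 0 < 2 * μ + lam)
    (hs : 0 ≤ s) (Q : 𝓢(E d, ℂ)) (x : E d) (i : Fin d) :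
    fderiv ℝ (lameSemigroup μ lam s (sinField M Q)) x (EuclideanSpace.single i 1)
      = lameDeriv μ lam (sinField M Q) i s x := by
  have hm : Measurable fun w : E d =>
      lameExpSymbol μ lam s ((2 * Real.pi) • w) (𝓕 (sinField M Q) w) := by
    simp only [fourier_sinField, lameExpSymbol_smul]
    have h1 := (shiftHat Q (modFreq d M)).continuous.measurable
    have h2 := (shiftHat Q (-modFreq d M)).continuous.measurable
    have h3 : Measurable fun w : E d =>
        lameExpSymbol μ lam s ((2 * Real.pi) • w) (toV (e₁ d)) :=
      Measurable.lameExpSymbol μ lam measurable_const (by fun_prop)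
    have h5 : Measurable fun w : E d =>
        (2 * Complex.I)⁻¹ * (shiftHat Q (modFreq d M) w - shiftHat Q (-modFreq d M) w) := by
      fun_prop
    have h6 := h5.fun_smul h3
    exact h6
  have hb (w : E d) : ‖lameExpSymbol μ lam s ((2 * Real.pi) • w) (𝓕 (sinField M Q) w)‖
      ≤ 3 / 2 * (‖shiftHat Q (modFreq d M) w‖ + ‖shiftHat Q (-modFreq d M) w‖) := by
    rw [fourier_sinField, lameExpSymbol_smul, norm_smul, norm_mul]
    have h3 : ‖(2 * Complex.I)⁻¹‖ = 1 / 2 := by simp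
    rw [h3]
    calc _ ≤ 1 / 2 * (‖shiftHat Q (modFreq d M) w‖ + ‖shiftHat Q (-modFreq d M) w‖) * 3 := by
          gcongr
          · exact norm_sub_le _ _
          · exact norm_lameExpSymbol_le hμ hlam hs _
      _ = _ := by ring
  have h (a : E d) : Integrable fun w => ‖w‖ * ‖shiftHat Q a w‖ := by
    simpa using (shiftHat Q a).integrable_pow_mul volume 1
  refine fderiv_fourierInv_apply ?_ ?_ x i
  · exact Integrable.mono' (((shiftHat Q _).integrable.norm.add
      (shiftHat Q _).integrable.norm).const_mul _) hm.aestronglyMeasurable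
      (Filter.Eventually.of_forall hb)
  · refine Integrable.mono' (((h (modFreq d M)).add (h (-modFreq d M))).const_mul (3 / 2))
      (continuous_norm.aestronglyMeasurable.mul hm.norm.aestronglyMeasurable)
      (Filter.Eventually.of_forall fun w => ?_)
    rw [norm_mul, norm_norm, norm_norm]
    calc _ ≤ ‖w‖ * (3 / 2 * (‖shiftHat Q (modFreq d M) w‖ + ‖shiftHat Q (-modFreq d M) w‖)) := by
          gcongr
          exact hb w
      _ = _ := by simp only [Pi.add_apply]; ring

theorem gradSq_lameSemigroup (hμ : 0 < μ) (hlam : 0 < 2 * μ + lam)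
    (hs : 0 ≤ s) (Q : 𝓢(E d, ℂ)) (x : E d) :
    gradSq (lameSemigroup μ lam s (sinField M Q)) x
      = ∑ i, ‖lameDeriv μ lam (sinField M Q) i s x‖ ^ 2 := by
  simp only [gradSq, fderiv_lameSemigroup hμ hlam hs, EuclideanSpace.norm_sq_eq]

theorem memLp_lameDeriv (hμ : 0 < μ) (hlam : 0 < 2 * μ + lam)
    (hs : 0 ≤ s) (Q : 𝓢(E d, ℂ)) (i : Fin d) : MemLp (lameDeriv μ lam (sinField M Q) i s) 2 :=
  (eLpNorm_fourierInv_eq (integrable_lameDeriv_hat hμ hlam hs Q i)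
    (memLp_lameDeriv_hat hμ hlam hs Q i)).1

/-- Joint measurability in time and space, needed for Fubini in the Duhamel integral. -/
theorem measurable_lameDeriv (Q : 𝓢(E d, ℂ)) (i : Fin d) :
    StronglyMeasurable fun p : ℝ × E d => lameDeriv μ lam (sinField M Q) i p.1 p.2 := by
  simp only [lameDeriv, Real.fourierInv_eq]
  refine StronglyMeasurable.integral_prod_right (f := fun (p : ℝ × E d) (v : E d) =>
    Real.fourierChar (inner ℝ v p.2) • ((2 * Real.pi * Complex.I * v i) •
      lameExpSymbol μ lam p.1 ((2 * Real.pi) • v) (𝓕 (sinField M Q) v))) ?_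
  refine Measurable.stronglyMeasurable ?_
  have h1 : Measurable fun q : (ℝ × E d) × E d => ((Real.fourierChar (inner ℝ q.2 q.1.2) : Circle) : ℂ) := by
    have : Continuous fun q : (ℝ × E d) × E d => ((Real.fourierChar (inner ℝ q.2 q.1.2) : Circle) : ℂ) :=
      continuous_subtype_val.comp (Real.continuous_fourierChar.comp (by fun_prop))
    exact this.measurable
  have h2 : Measurable fun q : (ℝ × E d) × E d => (2 * Real.pi * Complex.I * q.2 i) •
      lameExpSymbol μ lam q.1.1 ((2 * Real.pi) • q.2) (𝓕 (sinField M Q) q.2) :=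
    measurable_lameDeriv_hat Q i (by fun_prop) (by fun_prop)
  have h3 := h1.fun_smul h2
  exact h3

theorem integrable_cosField (Q : 𝓢(E d, ℂ)) : Integrable (cosField M Q) := by
  refine Integrable.smul_const ?_ _
  refine Q.integrable.bdd_mul (c := 1) (Continuous.aestronglyMeasurable (by fun_prop)) ?_
  filter_upwards with x
  rw [Complex.norm_real]
  exact Real.abs_cos_le_one _

theorem integrable_fourier_cosField (Q : 𝓢(E d, ℂ)) : Integrable (𝓕 (cosField M Q)) := by
  have : 𝓕 (cosField M Q) = fun w => ((2 : ℂ)⁻¹ *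
      (shiftHat Q (modFreq d M) w + shiftHat Q (-modFreq d M) w)) • toV (e₁ d) :=
    funext (fourier_cosField M Q)
  rw [this]
  exact (((shiftHat Q _).integrable.add (shiftHat Q _).integrable).const_mul _).smul_const _

theorem memLp_fourier_cosField (Q : 𝓢(E d, ℂ)) : MemLp (𝓕 (cosField M Q)) 2 := by
  have : 𝓕 (cosField M Q) = fun w => ((2 : ℂ)⁻¹ *
      (shiftHat Q (modFreq d M) w + shiftHat Q (-modFreq d M) w)) • toV (e₁ d) :=
    funext (fourier_cosField M Q)
  rw [this]
  have h := ((((shiftHat Q (modFreq d M)).memLp 2 volume).add ((shiftHat Q (-modFreq d M)).memLp 2 volume)).const_mul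
    (2 : ℂ)⁻¹)
  exact h.norm.of_le (((this ▸ integrable_fourier_cosField Q).1)) (Filter.Eventually.of_forall fun w => by
    rw [norm_smul, norm_toV, norm_e₁, mul_one, norm_norm]; rfl)

theorem continuous_cosField (Q : 𝓢(E d, ℂ)) : Continuous (cosField M Q) := by
  have := Q.continuous
  unfold cosField
  fun_prop

theorem fourierInv_fourier_cosField (Q : 𝓢(E d, ℂ)) : 𝓕⁻ (𝓕 (cosField M Q)) = cosField M Q :=
  (continuous_cosField Q).fourierInv_fourier_eq (integrable_cosField Q)
    (integrable_fourier_cosField Q)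

/-- At times `s ≤ M^{-2}`, the derivatives of `e^{sL} u` are close in `L²` to those of the pure
oscillation. -/
theorem integral_norm_sq_lameDeriv_sub_le (hμ : 0 < μ) (hlam : 0 < 2 * μ + lam)
    (hs : 0 ≤ s) (Q : 𝓢(E d, ℂ)) (hM : 0 < M) (hsM : s * M ^ 2 ≤ 1) (i : Fin d) :
    Integrable (fun x => ‖lameDeriv μ lam (sinField M Q) i s x
      - (M * Real.exp (-(s * (2 * μ + lam) * M ^ 2)) * e₁ d i) • cosField M Q x‖ ^ 2) ∧
    ∫ x, ‖lameDeriv μ lam (sinField M Q) i s x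
      - (M * Real.exp (-(s * (2 * μ + lam) * M ^ 2)) * e₁ d i) • cosField M Q x‖ ^ 2
      ≤ 4 * (Real.pi * (4 + 3 * (2 * μ + lam))) ^ 2 *
        ∫ w, (‖w‖ * ‖𝓕 (Q : E d → ℂ) w‖) ^ 2 := by
  set r := M * Real.exp (-(s * (2 * μ + lam) * M ^ 2)) * e₁ d i with hr
  set g := fun w : E d => (2 * Real.pi * Complex.I * w i) •
      lameExpSymbol μ lam s ((2 * Real.pi) • w) (𝓕 (sinField M Q) w) with hg
  set K := Real.pi * (4 + 3 * (2 * μ + lam)) with hK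
  have hK0 : 0 ≤ K := by positivity
  set h := fun w : E d => g w - r • 𝓕 (cosField M Q) w with hh
  have hg1 : Integrable g := integrable_lameDeriv_hat hμ hlam hs Q i
  have hh1 : Integrable h := hg1.sub ((integrable_fourier_cosField Q).smul r)
  have hh2 : MemLp h 2 := (memLp_lameDeriv_hat hμ hlam hs Q i).sub
    ((memLp_fourier_cosField Q).const_smul r)
  have e1 (x : E d) : lameDeriv μ lam (sinField M Q) i s x - r • cosField M Q x = 𝓕⁻ h x := by
    have hc : Integrable fun w => r • 𝓕 (cosField M Q) w :=
      (integrable_fourier_cosField Q).smul r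
    rw [hh, fourierInv_sub hg1 hc, fourierInv_real_smul,
      fourierInv_fourier_cosField]
    rfl
  simp only [e1]
  refine ⟨((eLpNorm_fourierInv_eq hh1 hh2).1).norm.integrable_sq, ?_⟩
  rw [integral_norm_sq_fourierInv_eq hh1 hh2]
  set q := fun w : E d => ‖w‖ * ‖𝓕 (Q : E d → ℂ) w‖ with hq
  have hq1 : Integrable fun w => q w ^ 2 := integrable_sq_norm_mul (𝓕 Q)
  set a := modFreq d M with ha
  have hb (w : E d) : ‖h w‖ ≤ K * (q (w - a) + q (w - -a)) := by
    set Y := ((2 * Real.pi) • w) i • lameExpSymbol μ lam s ((2 * Real.pi) • w) (toV (e₁ d)) with hY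
    set Z := r • toV (e₁ d) with hZ
    -- The pieces of the spectrum at a and -a are compared with the symbol at M e₁ and at -M e₁
    -- respectively. The leading value Z changes sign between the two, which turns the sine into a
    -- cosine.
    have e2 : h w = ((2 : ℂ)⁻¹ * shiftHat Q a w) • (Y - Z)
        - ((2 : ℂ)⁻¹ * shiftHat Q (-a) w) • (Y + Z) := by
      have e3 : r • ((2 : ℂ)⁻¹ * (shiftHat Q a w + shiftHat Q (-a) w)) • toV (e₁ d)
        = ((2 : ℂ)⁻¹ * (shiftHat Q a w + shiftHat Q (-a) w)) • Z := by rw [hZ, smul_comm]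
      simp only [hh, hg]
      rw [lameDeriv_hat_eq, fourier_cosField, e3, ← hY]
      module
    have h2π : (2 * Real.pi) * (M / (2 * Real.pi)) = M := by
      have := Real.pi_ne_zero
      field_simp
    have b1 : ‖Y - Z‖ ≤ 2 * K * ‖w - a‖ := by
      have := norm_smul_lameExpSymbol_sub_le hμ hlam hs hM hsM ((2 * Real.pi) • w) i
      refine this.trans (le_of_eq ?_)
      have : (2 * Real.pi) • w - M • e₁ d = (2 * Real.pi) • (w - a) := by
        rw [ha, modFreq, smul_sub, smul_smul, h2π]
      rw [this, norm_smul, Real.norm_of_nonneg (by positivity)]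
      ring
    -- The estimate at the point -ξ is reused: the exponential of the symbol is even in ξ and the
    -- factor ξ_i is odd.
    have b2 : ‖Y + Z‖ ≤ 2 * K * ‖w - -a‖ := by
      have := norm_smul_lameExpSymbol_sub_le hμ hlam hs hM hsM (-((2 * Real.pi) • w)) i
      rw [lameExpSymbol_neg, PiLp.neg_apply, neg_smul, ← hY, ← hZ, ← neg_add', norm_neg] at this
      refine this.trans (le_of_eq ?_)
      have : -((2 * Real.pi) • w) - M • e₁ d = -((2 * Real.pi) • (w - -a)) := by
        rw [ha, modFreq, smul_sub, smul_neg, smul_smul, h2π]; abel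
      rw [this, norm_neg, norm_smul, Real.norm_of_nonneg (by positivity)]
      ring
    rw [e2]
    refine (norm_sub_le _ _).trans ?_
    rw [norm_smul, norm_smul, norm_mul, norm_mul]
    have h3 : ‖(2 : ℂ)⁻¹‖ = 1 / 2 := by simp
    rw [h3]
    calc _ ≤ 1 / 2 * ‖shiftHat Q a w‖ * (2 * K * ‖w - a‖)
          + 1 / 2 * ‖shiftHat Q (-a) w‖ * (2 * K * ‖w - -a‖) := by gcongr
      _ = _ := by simp only [hq, shiftHat_apply]; ring
  have i1 (b : E d) : Integrable fun w => q (w - b) ^ 2 := hq1.comp_sub_right b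
  calc ∫ w, ‖h w‖ ^ 2 ≤ ∫ w, 2 * K ^ 2 * (q (w - a) ^ 2 + q (w - -a) ^ 2) := by
        refine integral_mono hh2.norm.integrable_sq (((i1 _).add (i1 _)).const_mul _) fun w => ?_
        calc ‖h w‖ ^ 2 ≤ (K * (q (w - a) + q (w - -a))) ^ 2 := by gcongr; exact hb w
          _ ≤ _ := by
            have := mul_nonneg (sq_nonneg K) (sq_nonneg (q (w - a) - q (w - -a)))
            nlinarith
    _ = 4 * K ^ 2 * ∫ w, q w ^ 2 := by
      rw [integral_const_mul, integral_add (i1 _) (i1 _), integral_sub_right_eq_self (fun w => q w ^ 2),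
        integral_sub_right_eq_self (fun w => q w ^ 2)]
      ring

end evolved

/-! ### The heat kernel -/

/-- The Gauss kernel at time `a`. -/
def heatKernel {d : ℕ} (a : ℝ) (z : E d) : ℝ :=
  (4 * Real.pi * a) ^ (-(d : ℝ) / 2) * Real.exp (-(‖z‖ ^ 2 / (4 * a)))

theorem heatKernel_nonneg {d : ℕ} {a : ℝ} (ha : 0 < a) (z : E d) : 0 ≤ heatKernel a z := by
  unfold heatKernel; positivity

theorem continuous_heatKernel {d : ℕ} (a : ℝ) : Continuous (heatKernel (d := d) a) := by
  unfold heatKernel; fun_prop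

theorem heatKernel_eq {d : ℕ} {a : ℝ} (ha : 0 < a) (z : E d) :
    heatKernel a z = Real.sqrt a ^ (-(d : ℤ)) * heatKernel 1 ((Real.sqrt a)⁻¹ • z) := by
  unfold heatKernel
  have h1 : Real.sqrt a ^ (-(d : ℤ)) = a ^ (-(d : ℝ) / 2) := by
    rw [← Real.rpow_intCast, Real.sqrt_eq_rpow, ← Real.rpow_mul ha.le]
    push_cast
    ring_nf
  rw [h1, Real.mul_rpow (by positivity) ha.le, norm_smul, mul_pow, norm_inv, inv_pow, Real.norm_eq_abs, sq_abs,
    Real.sq_sqrt ha.le]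
  field_simp

theorem integral_heatKernel_one {d : ℕ} : ∫ z : E d, heatKernel 1 z = 1 := by
  unfold heatKernel
  rw [integral_const_mul]
  have := GaussianFourier.integral_rexp_neg_mul_sq_norm (V := E d) (b := 1 / 4) (by norm_num)
  have e : (fun z : E d => Real.exp (-(‖z‖ ^ 2 / (4 * 1)))) = fun z => Real.exp (-(1 / 4) * ‖z‖ ^ 2) := by
    ext z; ring_nf
  rw [e, this, finrank_euclideanSpace_fin]
  have : Real.pi / (1 / 4) = 4 * Real.pi * 1 := by ring
  rw [this, ← Real.rpow_add (by positivity)]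
  ring_nf
  simp

/-- The integral of a non-integrable function is 0 by convention, and this one has been computed to
be 1. -/
theorem integrable_heatKernel_one {d : ℕ} : Integrable (heatKernel (d := d) 1) := by
  by_contra h
  have := integral_heatKernel_one (d := d)
  rw [integral_undef h] at this
  norm_num at this

/-- Half of the Gaussian exponent absorbs the factor |z|; the other half is a wider Gaussian, which
is integrable. -/
theorem integrable_heatKernel_one_mul_norm {d : ℕ} :
    Integrable fun z : E d => heatKernel 1 z * ‖z‖ := by
  have h : Integrable fun z : E d => heatKernel 1 ((Real.sqrt 2)⁻¹ • z) :=
    integrable_heatKernel_one.comp_smul (by positivity)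
  refine (h.const_mul 8).mono' ((continuous_heatKernel 1).mul continuous_norm).aestronglyMeasurable
    (Filter.Eventually.of_forall fun z => ?_)
  have h0 : 0 ≤ heatKernel 1 z * ‖z‖ := mul_nonneg (heatKernel_nonneg one_pos z) (norm_nonneg z)
  rw [Real.norm_of_nonneg h0]
  unfold heatKernel
  rw [norm_smul, mul_pow, norm_inv, inv_pow, Real.norm_eq_abs, sq_abs, Real.sq_sqrt (by norm_num)]
  have e : Real.exp (-(‖z‖ ^ 2 / (4 * 1))) =
      Real.exp (-(2⁻¹ * ‖z‖ ^ 2 / (4 * 1))) * Real.exp (-(‖z‖ ^ 2 / 8)) := by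
    rw [← Real.exp_add]; ring_nf
  have e2 : Real.exp (-(‖z‖ ^ 2 / 8)) * ‖z‖ ≤ 8 := by
    rw [Real.exp_neg, inv_mul_le_iff₀ (Real.exp_pos _)]
    have := Real.add_one_le_exp (‖z‖ ^ 2 / 8)
    nlinarith [sq_nonneg (‖z‖ - 1)]
  rw [e]
  have h2 : 0 ≤ (4 * Real.pi * 1) ^ (-(d : ℝ) / 2) * Real.exp (-(2⁻¹ * ‖z‖ ^ 2 / (4 * 1))) := by
    positivity
  nlinarith

/-- The first absolute moment of the standard heat kernel. -/
def heatMoment (d : ℕ) : ℝ := ∫ z : E d, heatKernel 1 z * ‖z‖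

theorem heatMoment_nonneg (d : ℕ) : 0 ≤ heatMoment d :=
  integral_nonneg fun z => mul_nonneg (heatKernel_nonneg one_pos z) (norm_nonneg z)

section
variable {d : ℕ} {a : ℝ}

theorem integrable_heatKernel (ha : 0 < a) : Integrable (heatKernel (d := d) a) := by
  have : heatKernel (d := d) a = fun z => Real.sqrt a ^ (-(d : ℤ)) * heatKernel 1 ((Real.sqrt a)⁻¹ • z) :=
    funext (heatKernel_eq ha)
  rw [this]
  exact (integrable_heatKernel_one.comp_smul (by positivity)).const_mul _

theorem integral_heatKernel (ha : 0 < a) : ∫ z : E d, heatKernel a z = 1 := by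
  simp only [heatKernel_eq ha]
  rw [integral_const_mul, Measure.integral_comp_inv_smul, integral_heatKernel_one,
    finrank_euclideanSpace_fin, abs_of_pos (by positivity)]
  simp [(Real.sqrt_pos.2 ha).ne']

theorem integrable_heatKernel_mul_norm (ha : 0 < a) :
    Integrable fun z : E d => heatKernel a z * ‖z‖ := by
  have h : Integrable fun z : E d => heatKernel 1 ((Real.sqrt a)⁻¹ • z) * ‖(Real.sqrt a)⁻¹ • z‖ :=
    integrable_heatKernel_one_mul_norm.comp_smul (by positivity)
  refine (h.const_mul (Real.sqrt a ^ (-(d : ℤ)) * Real.sqrt a)).congr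
    (Filter.Eventually.of_forall fun z => ?_)
  simp only
  rw [heatKernel_eq ha, norm_smul, norm_inv, Real.norm_of_nonneg (Real.sqrt_nonneg a)]
  have := (Real.sqrt_pos.2 ha).ne'
  field_simp

theorem integral_heatKernel_mul_norm (ha : 0 < a) :
    ∫ z : E d, heatKernel a z * ‖z‖ = Real.sqrt a * heatMoment d := by
  have hs := (Real.sqrt_pos.2 ha).ne'
  have e (z : E d) : heatKernel a z * ‖z‖ = (Real.sqrt a ^ (-(d : ℤ)) * Real.sqrt a) *
      (heatKernel 1 ((Real.sqrt a)⁻¹ • z) * ‖(Real.sqrt a)⁻¹ • z‖) := by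
    rw [heatKernel_eq ha, norm_smul, norm_inv, Real.norm_of_nonneg (Real.sqrt_nonneg a)]
    field_simp
  simp only [e]
  rw [integral_const_mul, Measure.integral_comp_inv_smul (volume : Measure (E d))
      (fun z => heatKernel 1 z * ‖z‖) (Real.sqrt a),
    finrank_euclideanSpace_fin, abs_of_pos (by positivity), heatMoment]
  simp only [zpow_neg, zpow_natCast, smul_eq_mul]
  field_simp

end

theorem heatSemigroup_of_pos {d : ℕ} {κ τ : ℝ} (hτ : 0 < τ) (g : E d → ℝ) (x : E d) :
    heatSemigroup κ τ g x = ∫ y, heatKernel (κ * τ) (x - y) * g y := by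
  rw [heatSemigroup, if_neg hτ.ne']
  rfl

theorem integrable_heatKernel_mul {d : ℕ} {a : ℝ} (ha : 0 < a) {g : E d → ℝ} (hg : Integrable g) :
    Integrable (fun p : E d × E d => heatKernel a (p.1 - p.2) * g p.2) (volume.prod volume) := by
  have := hg.convolution_integrand (ContinuousLinearMap.mul ℝ ℝ) (integrable_heatKernel ha)
  simpa [mul_comm] using this

section
variable {d : ℕ} {κ τ : ℝ} {g : E d → ℝ}

theorem heatSemigroup_nonneg (hκ : 0 < κ) (hτ : 0 ≤ τ) (h0 : ∀ x, 0 ≤ g x) (x : E d) :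
    0 ≤ heatSemigroup κ τ g x := by
  rcases hτ.eq_or_lt with rfl | hτ
  · simpa [heatSemigroup] using h0 x
  rw [heatSemigroup_of_pos hτ]
  exact integral_nonneg fun y => mul_nonneg (heatKernel_nonneg (by positivity) _) (h0 y)

theorem integrable_heatSemigroup (hκ : 0 < κ) (hτ : 0 ≤ τ) (hg : Integrable g) :
    Integrable (heatSemigroup κ τ g) := by
  rcases hτ.eq_or_lt with rfl | hτ
  · have : heatSemigroup κ 0 g = g := by ext; simp [heatSemigroup]
    rwa [this]
  have : heatSemigroup κ τ g = fun x => ∫ y, heatKernel (κ * τ) (x - y) * g y :=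
    funext (heatSemigroup_of_pos hτ g)
  rw [this]
  exact (integrable_heatKernel_mul (by positivity) hg).integral_prod_left

theorem integral_heatSemigroup (hκ : 0 < κ) (hτ : 0 ≤ τ) (hg : Integrable g) :
    ∫ x, heatSemigroup κ τ g x = ∫ x, g x := by
  rcases hτ.eq_or_lt with rfl | hτ
  · simp [heatSemigroup]
  simp only [heatSemigroup_of_pos hτ]
  rw [integral_integral_swap (integrable_heatKernel_mul (by positivity) hg)]
  congr 1 with y
  rw [integral_mul_const, integral_sub_right_eq_self (heatKernel (κ * τ)),
    integral_heatKernel (by positivity), one_mul]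

/-- Tested against a Lipschitz function, the heat semigroup is close to the identity. -/
theorem abs_integral_heatSemigroup_mul_sub_le (hκ : 0 < κ) (hτ : 0 ≤ τ) (hg : Integrable g)
    (h0 : ∀ x, 0 ≤ g x) {ψ : E d → ℝ} {B L : ℝ} (hc : Continuous ψ) (hB : ∀ x, |ψ x| ≤ B)
    (hL : ∀ x y, |ψ x - ψ y| ≤ L * ‖x - y‖) :
    |(∫ x, heatSemigroup κ τ g x * ψ x) - ∫ x, g x * ψ x|
      ≤ L * (Real.sqrt (κ * τ) * heatMoment d) * ∫ x, g x := by
  have hB' : ∀ᵐ x, ‖ψ x‖ ≤ B := Filter.Eventually.of_forall hB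
  rcases hτ.eq_or_lt with rfl | hτ
  · simp [heatSemigroup]
  have ha : 0 < κ * τ := by positivity
  have i1 := integrable_heatKernel_mul ha hg
  have i2 : Integrable (fun p : E d × E d => heatKernel (κ * τ) (p.1 - p.2) * g p.2 * ψ p.1)
      (volume.prod volume) :=
    i1.mul_bdd (hc.comp continuous_fst).aestronglyMeasurable
      (Filter.Eventually.of_forall fun p => hB p.1)
  -- Fubini puts the heat kernel on ψ, where the Lipschitz bound can be used; g need only be
  -- integrable.
  have e1 : ∫ x, heatSemigroup κ τ g x * ψ x
      = ∫ y, g y * ∫ x, heatKernel (κ * τ) (x - y) * ψ x := by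
    simp only [heatSemigroup_of_pos hτ, ← integral_mul_const, ← integral_const_mul]
    rw [integral_integral_swap i2]
    congr 1 with y
    congr 1 with x
    ring
  have i3 (y : E d) : Integrable fun x => heatKernel (κ * τ) (x - y) :=
    (integrable_heatKernel ha).comp_sub_right y
  have i4 (y : E d) : Integrable fun x => heatKernel (κ * τ) (x - y) * ψ x :=
    (i3 y).mul_bdd hc.aestronglyMeasurable hB'
  have i5 : Integrable fun y => g y * ∫ x, heatKernel (κ * τ) (x - y) * ψ x := by
    have := i2.integral_prod_right
    refine this.congr (Filter.Eventually.of_forall fun y => ?_)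
    simp only [← integral_const_mul]
    congr 1 with x
    ring
  have i6 : Integrable fun y => g y * ψ y := hg.mul_bdd hc.aestronglyMeasurable hB'
  rw [e1, ← integral_sub i5 i6, mul_comm (L * _), ← integral_mul_const, ← Real.norm_eq_abs]
  refine norm_integral_le_of_norm_le (hg.mul_const _) (Filter.Eventually.of_forall fun y => ?_)
  rw [← mul_sub, norm_mul, Real.norm_of_nonneg (h0 y)]
  refine mul_le_mul_of_nonneg_left ?_ (h0 y)
  -- The kernel has mass one, so the difference at y is an average of ψ x - ψ y, bounded by L times
  -- the first moment √(κτ) `heatMoment d`.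
  have e2 : ψ y = ∫ x, heatKernel (κ * τ) (x - y) * ψ y := by
    rw [integral_mul_const, integral_sub_right_eq_self (heatKernel (κ * τ)),
      integral_heatKernel ha, one_mul]
  rw [e2, ← integral_sub (i4 y) ((i3 y).mul_const _), ← integral_heatKernel_mul_norm ha,
    ← integral_const_mul]
  have i7 : Integrable fun x => heatKernel (κ * τ) (x - y) * ‖x - y‖ :=
    (integrable_heatKernel_mul_norm ha).comp_sub_right y
  rw [← integral_sub_right_eq_self (fun z => L * (heatKernel (κ * τ) z * ‖z‖)) y]
  refine norm_integral_le_of_norm_le (i7.const_mul L) (Filter.Eventually.of_forall fun x => ?_)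
  rw [← mul_sub, norm_mul, Real.norm_of_nonneg (heatKernel_nonneg ha _)]
  calc _ ≤ heatKernel (κ * τ) (x - y) * (L * ‖x - y‖) :=
        mul_le_mul_of_nonneg_left (hL x y) (heatKernel_nonneg ha _)
    _ = _ := by ring

end

/-! ### The Duhamel integral -/

section
variable {d : ℕ} {κ t B : ℝ} {G : ℝ → E d → ℝ}

theorem stronglyMeasurable_heatSemigroup (hG : StronglyMeasurable fun p : ℝ × E d => G p.1 p.2) :
    StronglyMeasurable fun p : ℝ × E d => heatSemigroup κ (t - p.1) (G p.1) p.2 := by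
  unfold heatSemigroup
  refine StronglyMeasurable.ite (measurableSet_eq_fun (by fun_prop) (by fun_prop)) hG ?_
  refine StronglyMeasurable.integral_prod_right (f := fun (p : ℝ × E d) (y : E d) =>
    (4 * Real.pi * (κ * (t - p.1))) ^ (-(d : ℝ) / 2)
    * Real.exp (-(‖p.2 - y‖ ^ 2 / (4 * (κ * (t - p.1))))) * G p.1 y) ?_
  refine Measurable.stronglyMeasurable ?_
  have h1 : Measurable fun q : (ℝ × E d) × E d => G q.1.1 q.2 :=
    hG.measurable.comp (by fun_prop : Measurable fun q : (ℝ × E d) × E d => (q.1.1, q.2))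
  exact Measurable.mul (by fun_prop) h1

/-- The heat flow preserves the mass of a nonnegative function, so B bounds the L¹ norm at every
time of the bounded interval. -/
theorem integrable_heatSemigroup_prod (hκ : 0 < κ)
    (hG : StronglyMeasurable fun p : ℝ × E d => G p.1 p.2) (h0 : ∀ s x, 0 ≤ G s x)
    (hi : ∀ s ∈ Set.Ioc 0 t, Integrable (G s)) (hB : ∀ s ∈ Set.Ioc 0 t, ∫ x, G s x ≤ B) :
    Integrable (fun p : ℝ × E d => heatSemigroup κ (t - p.1) (G p.1) p.2)
      ((volume.restrict (Set.Ioc 0 t)).prod volume) := by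
  have hm := stronglyMeasurable_heatSemigroup (κ := κ) (t := t) hG
  refine (integrable_prod_iff hm.aestronglyMeasurable).2 ⟨?_, ?_⟩
  · filter_upwards [ae_restrict_mem measurableSet_Ioc] with s hs
    exact integrable_heatSemigroup hκ (by linarith [hs.2]) (hi s hs)
  · refine Integrable.mono' (g := fun _ => B) (integrable_const _) ?_ ?_
    · exact (StronglyMeasurable.integral_prod_right (f := fun (s : ℝ) (x : E d) =>
        ‖heatSemigroup κ (t - s) (G s) x‖) hm.norm).aestronglyMeasurable
    · filter_upwards [ae_restrict_mem measurableSet_Ioc] with s hs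
      rw [Real.norm_of_nonneg (integral_nonneg fun _ => norm_nonneg _)]
      simp only [Real.norm_of_nonneg
        (heatSemigroup_nonneg hκ (by linarith [hs.2] : 0 ≤ t - s) (h0 s) _)]
      rw [integral_heatSemigroup hκ (by linarith [hs.2]) (hi s hs)]
      exact hB s hs

theorem duhamel_integral_nonneg (hκ : 0 < κ) (ht : 0 ≤ t) (h0 : ∀ s x, 0 ≤ G s x) (x : E d) :
    0 ≤ ∫ s in (0 : ℝ)..t, heatSemigroup κ (t - s) (G s) x := by
  refine intervalIntegral.integral_nonneg ht fun s hs => ?_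
  exact heatSemigroup_nonneg hκ (by linarith [hs.2]) (h0 s) x

theorem integrable_duhamel_integral (hκ : 0 < κ) (ht : 0 ≤ t)
    (hG : StronglyMeasurable fun p : ℝ × E d => G p.1 p.2) (h0 : ∀ s x, 0 ≤ G s x)
    (hi : ∀ s ∈ Set.Ioc 0 t, Integrable (G s)) (hB : ∀ s ∈ Set.Ioc 0 t, ∫ x, G s x ≤ B) :
    Integrable fun x : E d => ∫ s in (0 : ℝ)..t, heatSemigroup κ (t - s) (G s) x := by
  simp only [intervalIntegral.integral_of_le ht]
  exact (integrable_heatSemigroup_prod hκ hG h0 hi hB).integral_prod_right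

/-- A lower bound for the Duhamel integral tested against a Lipschitz function. -/
theorem le_integral_duhamel_integral_mul (hκ : 0 < κ) (ht : 0 ≤ t)
    (hG : StronglyMeasurable fun p : ℝ × E d => G p.1 p.2) (h0 : ∀ s x, 0 ≤ G s x)
    (hi : ∀ s ∈ Set.Ioc 0 t, Integrable (G s)) (hB : ∀ s ∈ Set.Ioc 0 t, ∫ x, G s x ≤ B)
    {ψ : E d → ℝ} {A L m : ℝ} (hc : Continuous ψ) (hA : ∀ x, |ψ x| ≤ A) (hL0 : 0 ≤ L)
    (hL : ∀ x y, |ψ x - ψ y| ≤ L * ‖x - y‖)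
    (hm : ∀ s ∈ Set.Ioc 0 t, m ≤ ∫ x, G s x * ψ x) :
    t * (m - L * (Real.sqrt (κ * t) * heatMoment d) * B) ≤
      ∫ x, (∫ s in (0 : ℝ)..t, heatSemigroup κ (t - s) (G s) x) * ψ x := by
  have i1 := integrable_heatSemigroup_prod hκ hG h0 hi hB
  have i2 : Integrable (fun p : ℝ × E d => heatSemigroup κ (t - p.1) (G p.1) p.2 * ψ p.2)
      ((volume.restrict (Set.Ioc 0 t)).prod volume) :=
    i1.mul_bdd (hc.comp continuous_snd).aestronglyMeasurable
      (Filter.Eventually.of_forall fun p => hA p.2)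
  have e1 : ∫ x, (∫ s in (0 : ℝ)..t, heatSemigroup κ (t - s) (G s) x) * ψ x
      = ∫ s in Set.Ioc 0 t, ∫ x, heatSemigroup κ (t - s) (G s) x * ψ x := by
    simp only [intervalIntegral.integral_of_le ht, ← integral_mul_const]
    rw [integral_integral_swap (f := fun x s => heatSemigroup κ (t - s) (G s) x * ψ x) i2.swap]
  rw [e1]
  have e2 : t * (m - L * (Real.sqrt (κ * t) * heatMoment d) * B)
      = ∫ s in Set.Ioc 0 t, (m - L * (Real.sqrt (κ * t) * heatMoment d) * B) := by
    simp [ht]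
  rw [e2]
  refine setIntegral_mono_on (integrable_const _) i2.integral_prod_left measurableSet_Ioc
    fun s hs => ?_
  have h1 := abs_integral_heatSemigroup_mul_sub_le hκ (by linarith [hs.2] : 0 ≤ t - s) (hi s hs)
    (h0 s) hc hA hL
  have h2 := hm s hs
  have hd := heatMoment_nonneg d
  have h3 : L * (Real.sqrt (κ * (t - s)) * heatMoment d) * ∫ x, G s x
      ≤ L * (Real.sqrt (κ * t) * heatMoment d) * B := by
    have : 0 ≤ ∫ x, G s x := integral_nonneg (h0 s)
    gcongr
    · linarith [hs.1]
    · exact hB s hs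
  linarith [(abs_le.1 h1).1]

end

/-! ### Scaling -/

theorem integral_smul_sub' {d : ℕ} {F : Type*} [NormedAddCommGroup F] [NormedSpace ℝ F]
    (f : E d → F) {r : ℝ} (hr : 0 < r) (a : E d) :
    ∫ x, f (r • (x - a)) = (r ^ d)⁻¹ • ∫ x, f x := by
  rw [integral_sub_right_eq_self (fun x => f (r • x)) a,
    Measure.integral_comp_smul_of_nonneg volume f r (hR := hr.le), finrank_euclideanSpace_fin]

theorem integral_smul_sub {d : ℕ} (f : E d → ℝ) {r : ℝ} (hr : 0 < r) (a : E d) :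
    ∫ x, f (r • (x - a)) = (r ^ d)⁻¹ * ∫ x, f x := integral_smul_sub' f hr a

theorem integrable_smul_sub {d : ℕ} {f : E d → ℝ} (hf : Integrable f) {r : ℝ} (hr : 0 < r)
    (a : E d) : Integrable fun x => f (r • (x - a)) :=
  (hf.comp_smul hr.ne').comp_sub_right a

/-! ### Schwartz functions -/

theorem schwartz_bound {d : ℕ} (φ : 𝓢(E d, ℝ)) : ∃ A, 0 < A ∧ (∀ x, |φ x| ≤ A) ∧
    (∀ x, ‖x‖ * |φ x| ≤ A) ∧ ∀ x y, |φ x - φ y| ≤ A * ‖x - y‖ := by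
  have p0 := apply_nonneg (SchwartzMap.seminorm ℝ 0 0) φ
  have p1 := apply_nonneg (SchwartzMap.seminorm ℝ 1 0) φ
  have p2 := apply_nonneg (SchwartzMap.seminorm ℝ 0 1) φ
  set a := SchwartzMap.seminorm ℝ 0 0 φ
  set b := SchwartzMap.seminorm ℝ 1 0 φ
  set c := SchwartzMap.seminorm ℝ 0 1 φ
  refine ⟨a + b + c + 1, by positivity, fun x => ?_, fun x => ?_, fun x y => ?_⟩
  · have := φ.norm_le_seminorm ℝ x
    rw [Real.norm_eq_abs] at this
    linarith
  · have := φ.norm_pow_mul_le_seminorm ℝ 1 x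
    rw [Real.norm_eq_abs, pow_one] at this
    linarith
  · have h (z : E d) : ‖fderiv ℝ φ z‖ ≤ c := by
      have := φ.norm_iteratedFDeriv_le_seminorm ℝ 1 z
      rwa [← norm_iteratedFDeriv_one]
    have := convex_univ.norm_image_sub_le_of_norm_fderiv_le (𝕜 := ℝ) (f := φ)
      (fun z _ => φ.differentiableAt) (fun z _ => h z) (Set.mem_univ y) (Set.mem_univ x)
    rw [Real.norm_eq_abs] at this
    refine this.trans ?_
    gcongr
    linarith

/-! ### The autocorrelation as a test function -/

/-- The autocorrelation `∫ φ (x - z) φ x dx`. -/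
def autocorr {d : ℕ} (φ : 𝓢(E d, ℝ)) (z : E d) : ℝ := ∫ x, φ (x - z) * φ x

section
variable {d : ℕ} (φ : 𝓢(E d, ℝ))

theorem integrable_autocorr (z : E d) : Integrable fun x => φ (x - z) * φ x := by
  obtain ⟨A, -, hA, -⟩ := schwartz_bound φ
  refine φ.integrable.bdd_mul (c := A) ?_ (Filter.Eventually.of_forall fun x => hA _)
  have := φ.continuous
  exact Continuous.aestronglyMeasurable (by fun_prop)

/-- Each bound passes from φ to its autocorrelation; the weighted one splits ‖z‖ ≤ ‖x - z‖ + ‖x‖ and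
gives each factor φ its own weight. The decay is needed against distant bumps, the Lipschitz bound
against the heat flow. -/
theorem autocorr_bound : ∃ A, 0 < A ∧ (∀ x, |autocorr φ x| ≤ A) ∧
    (∀ x, ‖x‖ * |autocorr φ x| ≤ A) ∧ ∀ x y, |autocorr φ x - autocorr φ y| ≤ A * ‖x - y‖ := by
  obtain ⟨A, hA0, h1, h2, h3⟩ := schwartz_bound φ
  set I := ∫ x, |φ x| with hI
  have hφ : Integrable fun x => |φ x| := φ.integrable.norm
  have hφz (z : E d) : Integrable fun x => |φ (x - z)| := hφ.comp_sub_right z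
  have hI0 : 0 ≤ I := integral_nonneg fun x => abs_nonneg _
  have hIz (z : E d) : ∫ x, |φ (x - z)| = I := integral_sub_right_eq_self (fun x => |φ x|) z
  refine ⟨2 * A * I + 1, by positivity, fun z => ?_, fun z => ?_, fun z z' => ?_⟩
  · have : ‖autocorr φ z‖ ≤ ∫ x, A * |φ x| := by
      rw [autocorr]
      refine norm_integral_le_of_norm_le (hφ.const_mul A) (Filter.Eventually.of_forall fun x => ?_)
      rw [norm_mul]
      exact mul_le_mul_of_nonneg_right (h1 _) (abs_nonneg _)
    rw [integral_const_mul, Real.norm_eq_abs] at this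
    nlinarith
  · have : ‖‖z‖ * autocorr φ z‖ ≤ ∫ x, (A * |φ x| + A * |φ (x - z)|) := by
      rw [autocorr, ← integral_const_mul]
      refine norm_integral_le_of_norm_le ((hφ.const_mul A).add ((hφz z).const_mul A))
        (Filter.Eventually.of_forall fun x => ?_)
      rw [norm_mul, norm_norm, norm_mul, Real.norm_eq_abs, Real.norm_eq_abs]
      have hz : ‖z‖ ≤ ‖x - z‖ + ‖x‖ := by
        have := norm_sub_le x (x - z)
        rw [sub_sub_cancel] at this
        linarith
      have e1 := mul_le_mul_of_nonneg_right (h2 (x - z)) (abs_nonneg (φ x))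
      have e2 := mul_le_mul_of_nonneg_right (h2 x) (abs_nonneg (φ (x - z)))
      have e3 := mul_le_mul_of_nonneg_right hz
        (mul_nonneg (abs_nonneg (φ (x - z))) (abs_nonneg (φ x)))
      nlinarith
    rw [integral_add (hφ.const_mul A) ((hφz z).const_mul A), integral_const_mul,
      integral_const_mul, hIz, norm_mul, norm_norm, Real.norm_eq_abs] at this
    linarith
  · have : ‖autocorr φ z - autocorr φ z'‖ ≤ ∫ x, (A * ‖z - z'‖) * |φ x| := by
      rw [autocorr, autocorr, ← integral_sub (integrable_autocorr φ z) (integrable_autocorr φ z')]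
      refine norm_integral_le_of_norm_le (hφ.const_mul _)
        (Filter.Eventually.of_forall fun x => ?_)
      rw [← sub_mul, norm_mul]
      refine mul_le_mul_of_nonneg_right ?_ (abs_nonneg _)
      refine (h3 _ _).trans (le_of_eq ?_)
      rw [sub_sub_sub_cancel_left, norm_sub_rev]
    rw [integral_const_mul, Real.norm_eq_abs] at this
    refine this.trans ?_
    have : 0 ≤ A * I * ‖z - z'‖ := by positivity
    nlinarith [norm_nonneg (z - z')]

theorem continuous_autocorr : Continuous (autocorr φ) := by
  obtain ⟨A, hA0, -, -, h⟩ := autocorr_bound φ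
  refine (LipschitzWith.of_dist_le_mul (K := A.toNNReal) fun x y => ?_).continuous
  rw [dist_eq_norm, dist_eq_norm, Real.coe_toNNReal _ hA0.le]
  exact h x y

theorem integral_sq_pos {φ : 𝓢(E d, ℝ)} (hφ : φ ≠ 0) : 0 < ∫ x, φ x ^ 2 := by
  have hc : Continuous fun x => φ x ^ 2 := φ.continuous.pow 2
  obtain ⟨x, hx⟩ : ∃ x, φ x ≠ 0 := by
    by_contra! h
    exact hφ (SchwartzMap.ext h)
  refine integral_pos_of_integrable_nonneg_nonzero (x := x) hc ?_ (fun x => sq_nonneg _)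
    (pow_ne_zero 2 hx)
  have := integrable_autocorr φ 0
  simpa [pow_two] using this

theorem autocorr_zero_pos {φ : 𝓢(E d, ℝ)} (hφ : φ ≠ 0) : 0 < autocorr φ 0 := by
  have := integral_sq_pos hφ
  simpa [autocorr, pow_two] using this

end

/-- The partition of unity enters only here. The lower bound uses nothing else about φ, the upper
bound only the support of its transform. -/
theorem IsLittlewoodPaley.ne_zero {d : ℕ} [NeZero d] {φ : 𝓢(E d, ℝ)} (hφ : IsLittlewoodPaley φ) :
    φ ≠ 0 := by
  rintro rfl
  have h := hφ.sum_eq_one (e₁ d) (by rw [← norm_ne_zero_iff, norm_e₁]; exact one_ne_zero)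
  have h0 : (fun j : ℤ => hat (dyadic (0 : 𝓢(E d, ℝ)) j) (e₁ d)) = fun _ => 0 := by
    ext j
    simp [hat, dyadic, Real.fourier_eq]
  rw [h0] at h
  exact zero_ne_one (hasSum_zero.unique h)

/-! ### Lower bound for a Littlewood-Paley block by duality -/

section
variable {d : ℕ} (φ : 𝓢(E d, ℝ))

theorem integrable_dyadic (k : ℤ) : Integrable (dyadic φ k) :=
  ((φ.integrable (μ := volume)).comp_smul (zpow_ne_zero k two_ne_zero)).const_mul _

theorem continuous_dyadic (k : ℤ) : Continuous (dyadic φ k) := by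
  have := φ.continuous
  unfold dyadic
  fun_prop

theorem integrable_block_integrand (k : ℤ) {Θ : E d → ℝ} (hΘ : Integrable Θ) :
    Integrable (fun p : E d × E d => dyadic φ k (p.1 - p.2) * Θ p.2) (volume.prod volume) := by
  have := hΘ.convolution_integrand (ContinuousLinearMap.mul ℝ ℝ) (integrable_dyadic φ k)
  simpa [mul_comm] using this

/-- With z = 2^k (x - x₀) the product of the two copies of φ becomes φ(z - 2^k(y - x₀)) φ(z).
Testing a block with φ itself makes the dual function an autocorrelation, positive at 0 whatever the
sign pattern of φ. -/
theorem integral_block_mul (k : ℤ) (x₀ : E d) {Θ : E d → ℝ} (hΘ : Integrable Θ) :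
    ∫ x, block φ k Θ x * φ ((2 : ℝ) ^ k • (x - x₀))
      = ∫ y, Θ y * autocorr φ ((2 : ℝ) ^ k • (y - x₀)) := by
  obtain ⟨A, -, hA, -⟩ := schwartz_bound φ
  have hr : (0 : ℝ) < 2 ^ k := by positivity
  have i1 := integrable_block_integrand φ k hΘ
  have hc : Continuous fun p : E d × E d => φ ((2 : ℝ) ^ k • (p.1 - x₀)) := by
    have := φ.continuous
    fun_prop
  have i2 : Integrable (fun p : E d × E d => dyadic φ k (p.1 - p.2) * Θ p.2
      * φ ((2 : ℝ) ^ k • (p.1 - x₀))) (volume.prod volume) :=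
    i1.mul_bdd hc.aestronglyMeasurable (Filter.Eventually.of_forall fun p => hA _)
  simp only [block, smul_eq_mul, ← integral_mul_const]
  rw [integral_integral_swap i2]
  congr 1 with y
  have e (x : E d) : dyadic φ k (x - y) * Θ y * φ ((2 : ℝ) ^ k • (x - x₀))
      = Θ y * (2 : ℝ) ^ ((d : ℤ) * k) * (fun z => φ (z - (2 : ℝ) ^ k • (y - x₀)) * φ z)
        ((2 : ℝ) ^ k • (x - x₀)) := by
    simp only [dyadic]
    rw [← smul_sub, sub_sub_sub_cancel_right]
    ring
  simp only [e]
  rw [integral_const_mul, integral_smul_sub (fun z => φ (z - (2 : ℝ) ^ k • (y - x₀)) * φ z) hr x₀,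
    autocorr, mul_comm (d : ℤ) k, zpow_mul, zpow_natCast]
  field_simp

end

/-- Hölder with exponents d and q = d/(d-1). The test function φ(2^k(x - x₀)) has L^q norm
proportional to 2^(-kd/q) = 2^(-(d-1)k), and dividing 2^(-k) by this leaves 2^((d-2)k). -/
theorem exists_block_lower_bound {d : ℕ} (hd : 2 ≤ d) {φ : 𝓢(E d, ℝ)} (hφ : φ ≠ 0) :
    ∃ c : ℝ, 0 < c ∧ ∀ (k : ℤ) (x₀ : E d) (Θ : E d → ℝ), Integrable Θ →
      ENNReal.ofReal (c * (2 : ℝ) ^ (((d : ℤ) - 2) * k) *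
        ∫ y, Θ y * autocorr φ ((2 : ℝ) ^ k • (y - x₀)))
      ≤ ENNReal.ofReal ((2 : ℝ) ^ (-1 * (k : ℝ))) * eLpNorm (block φ k Θ) d volume := by
  have hd1 : (1 : ℝ) < d := by exact_mod_cast hd
  set q := Real.conjExponent d with hq
  have hpq : Real.HolderConjugate d q := Real.HolderConjugate.conjExponent hd1
  have hpq' := hpq.ennrealOfReal
  rw [ENNReal.ofReal_natCast] at hpq'
  have hq0 : 0 < q := hpq.symm.pos
  set Q := ENNReal.ofReal q with hQ
  have hQ0 : Q ≠ 0 := by simpa [hQ] using hq0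
  have hQt : Q ≠ ⊤ := ENNReal.ofReal_ne_top
  have hQr : Q.toReal = q := ENNReal.toReal_ofReal hq0.le
  set K := ∫ x, ‖φ x‖ ^ q with hK
  have hKi : Integrable fun x => ‖φ x‖ ^ q := by
    have := (φ.memLp Q volume).integrable_norm_rpow hQ0 hQt
    rwa [hQr] at this
  have hK0 : 0 < K := by
    obtain ⟨x, hx⟩ : ∃ x, φ x ≠ 0 := by
      by_contra! h
      exact hφ (SchwartzMap.ext h)
    refine integral_pos_of_integrable_nonneg_nonzero (x := x)
      (φ.continuous.norm.rpow_const fun _ => Or.inr hq0.le) hKi (fun x => by positivity) ?_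
    exact (Real.rpow_pos_of_pos (norm_pos_iff.2 hx) q).ne'
  refine ⟨(K ^ q⁻¹)⁻¹, by positivity, fun k x₀ Θ hΘ => ?_⟩
  have hr : (0 : ℝ) < 2 ^ k := by positivity
  set g := fun x : E d => φ ((2 : ℝ) ^ k • (x - x₀)) with hg
  have hgc : Continuous g := by
    have := φ.continuous
    fun_prop
  have hgn : eLpNorm g Q volume = ENNReal.ofReal ((2 : ℝ) ^ (-((d : ℤ) - 1) * k) * K ^ q⁻¹) := by
    have hgm : MemLp g Q volume := by
      rw [← integrable_norm_rpow_iff hgc.aestronglyMeasurable hQ0 hQt, hQr]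
      exact integrable_smul_sub hKi hr x₀
    rw [hgm.eLpNorm_eq_integral_rpow_norm hQ0 hQt, hQr,
      integral_smul_sub (fun x => ‖φ x‖ ^ q) hr x₀,
      Real.mul_rpow (by positivity) hK0.le]
    congr 2
    rw [← zpow_natCast, ← zpow_mul, ← zpow_neg, ← Real.rpow_intCast, ← Real.rpow_mul (by norm_num),
      ← Real.rpow_intCast]
    congr 1
    have : (d : ℝ) * q⁻¹ = d - 1 := by rw [← div_eq_mul_inv]; exact hpq.div_conj_eq_sub_one
    push_cast
    linear_combination -(k : ℝ) * this
  have hbm : AEStronglyMeasurable (block φ k Θ) volume :=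
    (integrable_block_integrand φ k hΘ).integral_prod_left.1
  have h1 : ENNReal.ofReal (∫ y, Θ y * autocorr φ ((2 : ℝ) ^ k • (y - x₀)))
      ≤ eLpNorm (block φ k Θ) d volume * eLpNorm g Q volume := by
    rw [← integral_block_mul φ k x₀ hΘ]
    calc _ ≤ ENNReal.ofReal ‖∫ x, (block φ k Θ • g) x‖ :=
          ENNReal.ofReal_le_ofReal (le_abs_self _)
      _ ≤ ∫⁻ x, ‖(block φ k Θ • g) x‖ₑ := by
        rw [ofReal_norm]
        exact enorm_integral_le_lintegral_enorm _
      _ = eLpNorm (block φ k Θ • g) 1 volume := eLpNorm_one_eq_lintegral_enorm.symm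
      _ ≤ _ := eLpNorm_smul_le_mul_eLpNorm hgc.aestronglyMeasurable hbm
  rw [hgn] at h1
  have h2 := mul_le_mul_right h1 (ENNReal.ofReal ((K ^ q⁻¹)⁻¹ * (2 : ℝ) ^ (((d : ℤ) - 2) * k)))
  rw [← ENNReal.ofReal_mul (by positivity)] at h2
  refine h2.trans (le_of_eq ?_)
  rw [mul_comm (eLpNorm _ _ _), ← mul_assoc, ← ENNReal.ofReal_mul (by positivity)]
  congr 2
  have e : (2 : ℝ) ^ (((d : ℤ) - 2) * k) * (2 : ℝ) ^ (-((d : ℤ) - 1) * k) = (2 : ℝ) ^ (-1 * (k : ℝ)) := by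
    rw [← zpow_add₀ two_ne_zero, ← Real.rpow_intCast]
    congr 1
    push_cast
    ring
  rw [← e]
  field_simp

/-! ### The bumps of the initial data -/

/-- The centre of the `j`-th bump. -/
def center (d : ℕ) [NeZero d] (N : ℕ) (j : ℤ) : E d := (2 : ℝ) ^ (|j| + 2 * (N : ℤ)) • e₁ d

/-- The `j`-th bump. -/
def bump {d : ℕ} [NeZero d] (φ : E d → ℝ) (N : ℕ) (j : ℤ) (x : E d) : ℝ :=
  (2 : ℝ) ^ j * φ ((2 : ℝ) ^ j • (x - center d N j))

/-- The sum of the bumps with `-n ≤ j ≤ 0`. -/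
def amp {d : ℕ} [NeZero d] (φ : E d → ℝ) (N n : ℕ) (x : E d) : ℝ :=
  ∑ j ∈ Finset.Icc (-(n : ℤ)) 0, bump φ N j x

/-- The square of the `L²` scaling factor of the `j`-th bump. -/
def bumpMass (d : ℕ) (j : ℤ) : ℝ := (2 : ℝ) ^ ((2 - (d : ℤ)) * j)

theorem bumpMass_pos (d : ℕ) (j : ℤ) : 0 < bumpMass d j := by unfold bumpMass; positivity

theorem bumpMass_eq (d : ℕ) (j : ℤ) : bumpMass d j = ((2 : ℝ) ^ j) ^ 2 * (((2 : ℝ) ^ j) ^ d)⁻¹ := by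
  unfold bumpMass
  rw [sub_mul, zpow_sub₀ two_ne_zero, div_eq_mul_inv, mul_comm (2 : ℤ), mul_comm (d : ℤ), zpow_mul,
    zpow_mul, zpow_natCast]
  rfl

theorem bumpMass_le {d : ℕ} (hd : 2 ≤ d) {i j : ℤ} (h : i ≤ j) : bumpMass d j ≤ bumpMass d i := by
  unfold bumpMass
  refine zpow_le_zpow_right₀ one_le_two ?_
  have : (2 : ℤ) ≤ d := by exact_mod_cast hd
  nlinarith

section
variable {d : ℕ} [NeZero d] (φ : 𝓢(E d, ℝ)) (N n : ℕ)

theorem continuous_bump (j : ℤ) : Continuous (bump φ N j) := by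
  have := φ.continuous
  unfold bump
  fun_prop

theorem continuous_amp : Continuous (amp φ N n) :=
  continuous_finsetSum _ fun j _ => continuous_bump φ N j

/-- Dilation by `r ≠ 0` as a continuous linear equivalence. -/
def dilation (d : ℕ) {r : ℝ} (hr : r ≠ 0) : E d ≃L[ℝ] E d :=
  ContinuousLinearEquiv.smulLeft (Units.mk0 r hr)

omit [NeZero d] in
theorem dilation_apply {r : ℝ} (hr : r ≠ 0) (x : E d) : dilation d hr x = r • x := rfl

/-- The bump as a complex Schwartz function. -/
def bumpS (j : ℤ) : 𝓢(E d, ℂ) :=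
  ((2 : ℝ) ^ j) • compSubConstCLM ℝ (center d N j) (compCLMOfContinuousLinearEquiv ℝ
    (dilation d (zpow_ne_zero j two_ne_zero)) (postcompCLM (𝕜 := ℝ) Complex.ofRealCLM φ))

theorem bumpS_apply (j : ℤ) (x : E d) : bumpS φ N j x = (bump φ N j x : ℂ) := by
  simp [bumpS, bump, dilation_apply]

/-- The sum of the bumps, times `a`, as a complex Schwartz function. -/
def ampS (a : ℝ) : 𝓢(E d, ℂ) := a • ∑ j ∈ Finset.Icc (-(n : ℤ)) 0, bumpS φ N j

theorem ampS_apply (a : ℝ) (x : E d) : ampS φ N n a x = ((a * amp φ N n x : ℝ) : ℂ) := by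
  simp [ampS, amp, bumpS_apply]

theorem card_Icc_neg : (Finset.Icc (-(n : ℤ)) 0).card = n + 1 := by
  rw [Int.card_Icc]; omega

/-- Cauchy-Schwarz in place of orthogonality: the loss of n + 1 is harmless, since these bounds
enter only in errors that carry a factor 2^(-N). -/
theorem sq_amp_le (x : E d) :
    amp φ N n x ^ 2 ≤ (n + 1) * ∑ j ∈ Finset.Icc (-(n : ℤ)) 0, bump φ N j x ^ 2 := by
  have := sq_sum_le_card_mul_sum_sq (s := Finset.Icc (-(n : ℤ)) 0) (f := fun j => bump φ N j x)
  rw [card_Icc_neg] at this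
  exact_mod_cast this

theorem integral_sq_bump_mul (j : ℤ) (h : E d → ℝ) :
    ∫ x, bump φ N j x ^ 2 * h ((2 : ℝ) ^ j • (x - center d N j))
      = bumpMass d j * ∫ y, φ y ^ 2 * h y := by
  have e (x : E d) : bump φ N j x ^ 2 * h ((2 : ℝ) ^ j • (x - center d N j))
      = ((2 : ℝ) ^ j) ^ 2 * (fun y => φ y ^ 2 * h y) ((2 : ℝ) ^ j • (x - center d N j)) := by
    simp only [bump]; ring
  simp only [e]
  rw [integral_const_mul, integral_smul_sub (fun y => φ y ^ 2 * h y) (by positivity), bumpMass_eq]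
  ring

theorem integrable_sq_bump_mul (j : ℤ) {h : E d → ℝ} (hh : Integrable fun y => φ y ^ 2 * h y) :
    Integrable fun x => bump φ N j x ^ 2 * h ((2 : ℝ) ^ j • (x - center d N j)) := by
  refine ((integrable_smul_sub hh (zpow_pos two_pos j) (center d N j)).const_mul
    (((2 : ℝ) ^ j) ^ 2)).congr (Filter.Eventually.of_forall fun x => ?_)
  simp only [bump]; ring

omit [NeZero d] in
theorem integrable_sq_schwartz : Integrable fun y => φ y ^ 2 := by
  have := integrable_autocorr φ 0
  simpa [pow_two] using this

omit [NeZero d] in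
theorem integrable_sq_mul_norm_schwartz : Integrable fun y => φ y ^ 2 * ‖y‖ := by
  obtain ⟨A, -, hA, hA2, -⟩ := schwartz_bound φ
  have := φ.continuous
  refine (φ.integrable (μ := volume).norm.const_mul A).mono'
    (Continuous.aestronglyMeasurable (by fun_prop)) (Filter.Eventually.of_forall fun y => ?_)
  rw [Real.norm_of_nonneg (by positivity), ← sq_abs, Real.norm_eq_abs]
  nlinarith [hA2 y, abs_nonneg (φ y)]

theorem integrable_sq_bump (j : ℤ) : Integrable fun x => bump φ N j x ^ 2 := by
  have := integrable_sq_bump_mul φ N j (h := fun _ => 1) (by simpa using integrable_sq_schwartz φ)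
  simpa using this

theorem integral_sq_bump (j : ℤ) :
    ∫ x, bump φ N j x ^ 2 = bumpMass d j * ∫ y, φ y ^ 2 := by
  simpa using integral_sq_bump_mul φ N j (fun _ => 1)

theorem integrable_sq_amp : Integrable fun x => amp φ N n x ^ 2 := by
  refine ((integrable_finsetSum (Finset.Icc (-(n : ℤ)) 0)
    fun j _ => integrable_sq_bump φ N j).const_mul ((n : ℝ) + 1)).mono'
    ((continuous_amp φ N n).pow 2).aestronglyMeasurable (Filter.Eventually.of_forall fun x => ?_)
  rw [Real.norm_of_nonneg (sq_nonneg _)]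
  exact sq_amp_le φ N n x

omit [NeZero d] in
theorem sum_bumpMass_le (hd : 2 ≤ d) :
    ∑ j ∈ Finset.Icc (-(n : ℤ)) 0, bumpMass d j ≤ (n + 1) * bumpMass d (-n) := by
  have := Finset.sum_le_card_nsmul (Finset.Icc (-(n : ℤ)) 0) (bumpMass d) (bumpMass d (-n))
    fun j hj => bumpMass_le hd (Finset.mem_Icc.1 hj).1
  rw [card_Icc_neg, nsmul_eq_mul] at this
  exact_mod_cast this

theorem integral_sq_amp_le (hd : 2 ≤ d) :
    ∫ x, amp φ N n x ^ 2 ≤ (n + 1) ^ 2 * bumpMass d (-n) * ∫ y, φ y ^ 2 := by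
  calc _ ≤ ∫ x, ((n : ℝ) + 1) * ∑ j ∈ Finset.Icc (-(n : ℤ)) 0, bump φ N j x ^ 2 :=
        integral_mono (integrable_sq_amp φ N n) ((integrable_finsetSum _
          fun j _ => integrable_sq_bump φ N j).const_mul _) (sq_amp_le φ N n)
    _ = (n + 1) * ((∑ j ∈ Finset.Icc (-(n : ℤ)) 0, bumpMass d j) * ∫ y, φ y ^ 2) := by
      rw [integral_const_mul, integral_finsetSum _ fun j _ => integrable_sq_bump φ N j,
        Finset.sum_mul]
      simp only [integral_sq_bump]
    _ ≤ (n + 1) * (((n + 1) * bumpMass d (-n)) * ∫ y, φ y ^ 2) := by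
      have hK : 0 ≤ ∫ y, φ y ^ 2 := integral_nonneg fun _ => sq_nonneg _
      gcongr
      exact sum_bumpMass_le n hd
    _ = _ := by ring

/-- The complexification of `φ`. -/
def cplx : 𝓢(E d, ℂ) := postcompCLM (𝕜 := ℝ) Complex.ofRealCLM φ

omit [NeZero d] in
theorem cplx_apply (x : E d) : cplx φ x = (φ x : ℂ) := rfl

theorem fourier_bumpS (j : ℤ) (w : E d) :
    𝓕 (bumpS φ N j : E d → ℂ) w = (2 : ℝ) ^ j • (((2 : ℝ) ^ j) ^ d)⁻¹ •
      (Complex.exp ((↑(-2 * Real.pi * inner ℝ (center d N j) w) * Complex.I)) *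
        𝓕 (cplx φ : E d → ℂ) (((2 : ℝ) ^ j)⁻¹ • w)) := by
  have hr : (0 : ℝ) < 2 ^ j := by positivity
  rw [Real.fourier_eq', Real.fourier_eq', ← integral_const_mul,
    ← integral_smul_sub' _ hr (center d N j), ← integral_smul]
  congr 1 with x
  simp only [bumpS_apply, bump, smul_eq_mul, cplx_apply, Complex.real_smul]
  have e : Complex.exp (↑(-2 * Real.pi * inner ℝ x w) * Complex.I)
      = Complex.exp (↑(-2 * Real.pi * inner ℝ (center d N j) w) * Complex.I) *
        Complex.exp (↑(-2 * Real.pi * inner ℝ ((2 : ℝ) ^ j • (x - center d N j))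
          (((2 : ℝ) ^ j)⁻¹ • w)) * Complex.I) := by
    rw [← Complex.exp_add, ← add_mul, ← Complex.ofReal_add, inner_smul_left, inner_smul_right,
      inner_sub_left, conj_trivial, mul_inv_cancel_left₀ hr.ne']
    ring_nf
  rw [e, Complex.ofReal_mul ((2 : ℝ) ^ j)]
  ring

theorem norm_fourier_bumpS (j : ℤ) (w : E d) :
    ‖𝓕 (bumpS φ N j : E d → ℂ) w‖ = (2 : ℝ) ^ j * (((2 : ℝ) ^ j) ^ d)⁻¹ *
      ‖𝓕 (cplx φ : E d → ℂ) (((2 : ℝ) ^ j)⁻¹ • w)‖ := by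
  have hr : (0 : ℝ) < 2 ^ j := by positivity
  rw [fourier_bumpS, norm_smul, norm_smul, norm_mul, Complex.norm_exp_ofReal_mul_I, one_mul,
    Real.norm_of_nonneg hr.le, Real.norm_of_nonneg (by positivity), mul_assoc]

theorem integral_norm_mul_fourier_bumpS (j : ℤ) :
    Integrable (fun w => (‖w‖ * ‖𝓕 (bumpS φ N j : E d → ℂ) w‖) ^ 2) ∧
    ∫ w, (‖w‖ * ‖𝓕 (bumpS φ N j : E d → ℂ) w‖) ^ 2 = ((2 : ℝ) ^ j) ^ 2 * bumpMass d j *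
      ∫ w, (‖w‖ * ‖𝓕 (cplx φ : E d → ℂ) w‖) ^ 2 := by
  have hr : (0 : ℝ) < 2 ^ j := by positivity
  refine ⟨integrable_sq_norm_mul (𝓕 (bumpS φ N j)), ?_⟩
  have e (w : E d) : (‖w‖ * ‖𝓕 (bumpS φ N j : E d → ℂ) w‖) ^ 2
      = (((2 : ℝ) ^ j) ^ 2 * (((2 : ℝ) ^ j) ^ d)⁻¹) ^ 2 *
        (fun v => (‖v‖ * ‖𝓕 (cplx φ : E d → ℂ) v‖) ^ 2) (((2 : ℝ) ^ j)⁻¹ • (w - 0)) := by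
    rw [norm_fourier_bumpS, sub_zero]
    simp only [norm_smul, norm_inv, Real.norm_of_nonneg hr.le]
    field_simp
  simp only [e]
  rw [integral_const_mul, integral_smul_sub (fun v => (‖v‖ * ‖𝓕 (cplx φ : E d → ℂ) v‖) ^ 2)
    (inv_pos.2 hr), bumpMass_eq, inv_pow, inv_inv]
  field_simp

theorem fourier_ampS (a : ℝ) (w : E d) : 𝓕 (ampS φ N n a : E d → ℂ) w
    = a • ∑ j ∈ Finset.Icc (-(n : ℤ)) 0, 𝓕 (bumpS φ N j : E d → ℂ) w := by
  have : 𝓕 (ampS φ N n a) = a • ∑ j ∈ Finset.Icc (-(n : ℤ)) 0, 𝓕 (bumpS φ N j) := by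
    rw [ampS, FourierTransform.fourier_smul, FourierTransform.fourier_sum]
  have h : (𝓕 (ampS φ N n a)) w = a • ∑ j ∈ Finset.Icc (-(n : ℤ)) 0, (𝓕 (bumpS φ N j)) w := by
    rw [this]
    simp
  exact h

/-- This is the L² norm of the gradient of the envelope. Differentiating a bump costs 2^j ≤ 1, so
the bound has the same form as the one for the envelope itself. -/
theorem integral_norm_mul_fourier_ampS_le (hd : 2 ≤ d) (a : ℝ) :
    ∫ w, (‖w‖ * ‖𝓕 (ampS φ N n a : E d → ℂ) w‖) ^ 2 ≤ a ^ 2 * ((n + 1) ^ 2 * bumpMass d (-n) *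
      ∫ w, (‖w‖ * ‖𝓕 (cplx φ : E d → ℂ) w‖) ^ 2) := by
  set K := ∫ w, (‖w‖ * ‖𝓕 (cplx φ : E d → ℂ) w‖) ^ 2 with hK
  have hK0 : 0 ≤ K := integral_nonneg fun _ => sq_nonneg _
  have hb (w : E d) : (‖w‖ * ‖𝓕 (ampS φ N n a : E d → ℂ) w‖) ^ 2
      ≤ a ^ 2 * ((n + 1) * ∑ j ∈ Finset.Icc (-(n : ℤ)) 0,
        (‖w‖ * ‖𝓕 (bumpS φ N j : E d → ℂ) w‖) ^ 2) := by
    rw [fourier_ampS, norm_smul]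
    have h1 := norm_sum_le (Finset.Icc (-(n : ℤ)) 0) fun j => 𝓕 (bumpS φ N j : E d → ℂ) w
    have h2 := sq_sum_le_card_mul_sum_sq (s := Finset.Icc (-(n : ℤ)) 0)
      (f := fun j => ‖w‖ * ‖𝓕 (bumpS φ N j : E d → ℂ) w‖)
    rw [card_Icc_neg, ← Finset.mul_sum] at h2
    push_cast at h2
    calc _ = a ^ 2 * (‖w‖ * ‖∑ j ∈ Finset.Icc (-(n : ℤ)) 0, 𝓕 (bumpS φ N j : E d → ℂ) w‖) ^ 2 := by
          rw [← sq_abs a, Real.norm_eq_abs]; ring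
      _ ≤ a ^ 2 * (‖w‖ * ∑ j ∈ Finset.Icc (-(n : ℤ)) 0, ‖𝓕 (bumpS φ N j : E d → ℂ) w‖) ^ 2 := by
        gcongr
      _ ≤ _ := by gcongr
  have hi := fun j (_ : j ∈ Finset.Icc (-(n : ℤ)) 0) => (integral_norm_mul_fourier_bumpS φ N j).1
  calc _ ≤ ∫ w, a ^ 2 * ((n + 1) * ∑ j ∈ Finset.Icc (-(n : ℤ)) 0,
        (‖w‖ * ‖𝓕 (bumpS φ N j : E d → ℂ) w‖) ^ 2) :=
        integral_mono (integrable_sq_norm_mul (𝓕 (ampS φ N n a)))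
          (((integrable_finsetSum _ hi).const_mul _).const_mul _) hb
    _ = a ^ 2 * ((n + 1) * ∑ j ∈ Finset.Icc (-(n : ℤ)) 0, ((2 : ℝ) ^ j) ^ 2 * bumpMass d j * K) := by
      rw [integral_const_mul, integral_const_mul, integral_finsetSum _ hi]
      simp only [(integral_norm_mul_fourier_bumpS φ N _).2, hK]
    _ ≤ a ^ 2 * ((n + 1) * ∑ j ∈ Finset.Icc (-(n : ℤ)) 0, 1 * bumpMass d j * K) := by
      gcongr with j hj
      · exact (bumpMass_pos d j).le
      · exact pow_le_one₀ (by positivity) (zpow_le_one_of_nonpos₀ one_le_two (Finset.mem_Icc.1 hj).2)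
    _ = a ^ 2 * ((n + 1) * ((∑ j ∈ Finset.Icc (-(n : ℤ)) 0, bumpMass d j) * K)) := by
      simp only [one_mul, Finset.sum_mul]
    _ ≤ a ^ 2 * ((n + 1) * (((n + 1) * bumpMass d (-n)) * K)) := by
      gcongr
      exact sum_bumpMass_le n hd
    _ = _ := by ring

end

/-! ### The oscillating bumps tested against the autocorrelation -/

section
variable {d : ℕ} [NeZero d]

/-- The centres lie on one ray at the distances 2^(2N) 2^(-j). For distinct indices one distance is
at least twice the other, so their difference is at least half of the larger. -/
theorem norm_center_sub_le {i j : ℤ} (N : ℕ) (hi : i ≤ 0) (hj : j ≤ 0) (hij : i ≠ j) :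
    (2 : ℝ) ^ (2 * (N : ℤ)) * max ((2 : ℝ) ^ (-i)) ((2 : ℝ) ^ (-j)) / 2
      ≤ ‖center d N i - center d N j‖ := by
  wlog h : i < j generalizing i j
  · rw [max_comm, norm_sub_rev]
    exact this hj hi hij.symm (by omega)
  have h1 : (2 : ℝ) ^ (-j) ≤ (2 : ℝ) ^ (-i) := zpow_le_zpow_right₀ one_le_two (by omega)
  have h2 : (2 : ℝ) ^ (-j) ≤ (2 : ℝ) ^ (-i) / 2 := by
    rw [div_eq_mul_inv, ← zpow_sub_one₀ two_ne_zero]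
    exact zpow_le_zpow_right₀ one_le_two (by omega)
  rw [max_eq_left h1, center, center, ← sub_smul, norm_smul, norm_e₁, mul_one, abs_of_nonpos hi,
    abs_of_nonpos hj, zpow_add₀ two_ne_zero, zpow_add₀ two_ne_zero, ← sub_mul]
  refine le_trans ?_ (le_abs_self _)
  have : (0 : ℝ) < 2 ^ (2 * (N : ℤ)) := by positivity
  nlinarith

/-- Away from its own centre, the test function is small at the other bumps. -/
theorem abs_test_le {ψ : E d → ℝ} {A : ℝ} (hA : 0 < A) (h1 : ∀ x, |ψ x| ≤ A)
    (h2 : ∀ x, ‖x‖ * |ψ x| ≤ A) {i j : ℤ} (N m : ℕ) (hi : i ≤ 0) (hj : j ≤ 0) (hij : i ≠ j)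
    (x : E d) :
    |ψ ((2 : ℝ) ^ (j - m) • (x - center d N j))|
      ≤ 2 * A * 2 ^ m * ((2 : ℝ) ^ (2 * N))⁻¹ * (1 + ‖(2 : ℝ) ^ i • (x - center d N i)‖) := by
  set p := |ψ ((2 : ℝ) ^ (j - m) • (x - center d N j))| with hp
  have hp0 : 0 ≤ p := abs_nonneg _
  set D := ‖center d N i - center d N j‖ with hD
  set μ := max ((2 : ℝ) ^ (-i)) ((2 : ℝ) ^ (-j)) with hμ
  have hμ0 : 0 < μ := lt_max_of_lt_left (by positivity)
  have hDμ : (2 : ℝ) ^ (2 * N) * μ / 2 ≤ D := by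
    have := norm_center_sub_le (d := d) N hi hj hij
    exact_mod_cast this
  set a := ‖x - center d N j‖ with ha
  set b := ‖x - center d N i‖ with hb
  -- Every x is far from c_j, where the test function decays, or far from c_i, where the weight on
  -- the right is large.
  have hab : D ≤ a + b := by
    have := norm_sub_le (x - center d N j) (x - center d N i)
    rw [sub_sub_sub_cancel_left] at this
    exact this
  have ha2 : a * p ≤ A * 2 ^ m * μ := by
    have := h2 ((2 : ℝ) ^ (j - m) • (x - center d N j))
    rw [norm_smul, ← ha, ← hp, Real.norm_of_nonneg (by positivity), zpow_sub₀ two_ne_zero,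
      zpow_natCast] at this
    have hj' : (2 : ℝ) ^ (-j) ≤ μ := le_max_right _ _
    have e : a * p = 2 ^ m * (2 : ℝ) ^ (-j) * (2 ^ j / 2 ^ m * a * p) := by
      rw [zpow_neg]
      field_simp
    rw [e]
    calc _ ≤ 2 ^ m * μ * A := by gcongr
      _ = _ := by ring
  have hb2 : b ≤ μ * ‖(2 : ℝ) ^ i • (x - center d N i)‖ := by
    rw [norm_smul, ← hb, Real.norm_of_nonneg (by positivity)]
    have hi' : (2 : ℝ) ^ (-i) ≤ μ := le_max_left _ _
    calc b = (2 : ℝ) ^ (-i) * (2 ^ i * b) := by rw [zpow_neg]; field_simp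
      _ ≤ _ := by gcongr
  set y := ‖(2 : ℝ) ^ i • (x - center d N i)‖ with hy
  have hm : (1 : ℝ) ≤ 2 ^ m := one_le_pow₀ one_le_two
  have hbp : b * p ≤ A * 2 ^ m * μ * y := by
    calc b * p ≤ (μ * y) * A := mul_le_mul hb2 (h1 _) hp0 (by positivity)
      _ = A * 1 * μ * y := by ring
      _ ≤ _ := by gcongr
  have h3 : (2 : ℝ) ^ (2 * N) * μ / 2 * p ≤ A * 2 ^ m * μ * (1 + y) := by
    calc _ ≤ (a + b) * p := by gcongr; exact hDμ.trans hab
      _ ≤ _ := by linarith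
  have h4 : (2 : ℝ) ^ (2 * N) * p ≤ 2 * A * 2 ^ m * (1 + y) := by
    have : μ * ((2 : ℝ) ^ (2 * N) * p) ≤ μ * (2 * A * 2 ^ m * (1 + y)) := by linarith
    exact le_of_mul_le_mul_left this hμ0
  calc p = ((2 : ℝ) ^ (2 * N))⁻¹ * ((2 : ℝ) ^ (2 * N) * p) := by field_simp
    _ ≤ ((2 : ℝ) ^ (2 * N))⁻¹ * (2 * A * 2 ^ m * (1 + y)) := by gcongr
    _ = _ := by ring

/-- Riemann-Lebesgue, with an arbitrary phase. -/
theorem exists_abs_integral_cos_mul_le {h : E d → ℝ} (hh : Integrable h) {ε : ℝ} (hε : 0 < ε) :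
    ∃ T : ℝ, ∀ t ≥ T, ∀ θ : ℝ, |∫ y, Real.cos (t * y 0 + θ) * h y| ≤ ε := by
  have hRL := tendsto_integral_exp_inner_smul_cocompact (V := E d) (fun y => (h y : ℂ))
  have hw : Filter.Tendsto (fun t : ℝ => modFreq d t) Filter.atTop (Filter.cocompact (E d)) := by
    rw [← Metric.cobounded_eq_cocompact, ← tendsto_norm_atTop_iff_cobounded]
    have e (t : ℝ) : ‖modFreq d t‖ = |t| / (2 * Real.pi) := by
      rw [modFreq, norm_smul, norm_e₁, mul_one, Real.norm_eq_abs, abs_div,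
        abs_of_pos (by positivity : 0 < 2 * Real.pi)]
    simp only [e]
    exact Filter.tendsto_abs_atTop_atTop.atTop_div_const (by positivity)
  have hev := (tendsto_zero_iff_norm_tendsto_zero.1 (hRL.comp hw)).eventually (gt_mem_nhds hε)
  obtain ⟨T, hT⟩ := Filter.eventually_atTop.1 hev
  refine ⟨T, fun t ht θ => ?_⟩
  have hI := hT t ht
  simp only [Function.comp_apply] at hI
  have hi : Integrable fun y : E d => Real.fourierChar (-inner ℝ y (modFreq d t)) • (h y : ℂ) :=
    (Real.fourierIntegral_convergent_iff (f := fun y => (h y : ℂ)) (modFreq d t)).2 hh.ofReal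
  -- The phase becomes a unimodular factor in front of the Fourier integral, so T does not depend on
  -- it.
  have e (y : E d) : Real.cos (t * y 0 + θ) * h y = (Complex.exp (-(θ * Complex.I)) *
      Real.fourierChar (-inner ℝ y (modFreq d t)) • (h y : ℂ)).re := by
    rw [Circle.smul_def, Real.fourierChar_apply, smul_eq_mul, ← mul_assoc, ← Complex.exp_add,
      Complex.re_mul_ofReal]
    congr 1
    have : -((θ : ℂ) * Complex.I) + ((2 * Real.pi * -inner ℝ y (modFreq d t) : ℝ) : ℂ) * Complex.I
        = ((-(t * y 0 + θ) : ℝ) : ℂ) * Complex.I := by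
      rw [modFreq, inner_smul_right, inner_e₁]
      push_cast
      have := Real.pi_ne_zero
      field_simp
      ring
    rw [this, Complex.exp_ofReal_mul_I_re, Real.cos_neg]
  simp only [e]
  have e2 : ∫ y, (Complex.exp (-(θ * Complex.I)) *
      Real.fourierChar (-inner ℝ y (modFreq d t)) • (h y : ℂ)).re
      = (∫ y, Complex.exp (-(θ * Complex.I)) *
        Real.fourierChar (-inner ℝ y (modFreq d t)) • (h y : ℂ)).re := by
    exact integral_re (hi.const_mul _)
  rw [e2, integral_const_mul]
  refine (Complex.abs_re_le_norm _).trans ?_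
  rw [norm_mul]
  have : ‖Complex.exp (-(θ * Complex.I))‖ = 1 := by
    rw [← neg_mul, ← Complex.ofReal_neg, Complex.norm_exp_ofReal_mul_I]
  rw [this, one_mul]
  exact hI.le

omit [NeZero d] in
/-- A dilation of the autocorrelation that correlates positively with `φ²`. -/
theorem exists_integral_sq_mul_autocorr_pos {φ : 𝓢(E d, ℝ)} (hφ : φ ≠ 0) :
    ∃ m : ℕ, 0 < ∫ y, φ y ^ 2 * autocorr φ ((2 : ℝ) ^ (-(m : ℤ)) • y) := by
  obtain ⟨A, hA, h1, -⟩ := autocorr_bound φ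
  have hc := continuous_autocorr φ
  have hφc := φ.continuous
  have h2 : Filter.Tendsto (fun m : ℕ => (2 : ℝ) ^ (-(m : ℤ))) Filter.atTop (nhds 0) := by
    have := tendsto_pow_atTop_nhds_zero_of_lt_one (r := (1 / 2 : ℝ)) (by norm_num) (by norm_num)
    refine this.congr fun m => ?_
    rw [zpow_neg, zpow_natCast, one_div, inv_pow]
  -- As m grows, the stretched autocorrelation tends to the constant `autocorr φ 0`, which is
  -- positive.
  have h3 : Filter.Tendsto (fun m : ℕ => ∫ y, φ y ^ 2 * autocorr φ ((2 : ℝ) ^ (-(m : ℤ)) • y))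
      Filter.atTop (nhds (∫ y, φ y ^ 2 * autocorr φ 0)) := by
    refine tendsto_integral_of_dominated_convergence (fun y => φ y ^ 2 * A)
      (fun m => Continuous.aestronglyMeasurable (by fun_prop))
      ((integrable_sq_schwartz φ).mul_const A) (fun m => Filter.Eventually.of_forall fun y => ?_)
      (Filter.Eventually.of_forall fun y => ?_)
    · rw [norm_mul, Real.norm_of_nonneg (sq_nonneg _)]
      exact mul_le_mul_of_nonneg_left (h1 _) (sq_nonneg _)
    · refine Filter.Tendsto.const_mul _ ?_
      have := (hc.tendsto 0).comp (f := fun m : ℕ => (2 : ℝ) ^ (-(m : ℤ)) • y)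
        (x := Filter.atTop) (by simpa using h2.smul_const y)
      exact this
  have h4 : 0 < ∫ y, φ y ^ 2 * autocorr φ 0 := by
    rw [integral_mul_const]
    exact mul_pos (integral_sq_pos hφ) (autocorr_zero_pos hφ)
  exact (h3.eventually (lt_mem_nhds h4)).exists

/-- The contribution of a single bump. -/
theorem exists_integral_cos_sq_bump_lower_bound (φ : 𝓢(E d, ℝ)) {h : E d → ℝ}
    (hh : Integrable fun y => φ y ^ 2 * h y) (h0 : 0 < ∫ y, φ y ^ 2 * h y) :
    ∃ N₀ : ℕ, ∀ N ≥ N₀, ∀ j : ℤ, j ≤ 0 →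
      bumpMass d j * ((∫ y, φ y ^ 2 * h y) / 4) ≤
      ∫ x, Real.cos (2 ^ N * x 0) ^ 2 * (bump φ N j x ^ 2 * h ((2 : ℝ) ^ j • (x - center d N j))) := by
  set c₀ := ∫ y, φ y ^ 2 * h y with hc₀
  -- With c₀ the integral without the cosine, cos² contributes c₀/2 and half of an oscillating
  -- integral of size at most c₀/2, hence at least c₀/4.
  obtain ⟨T, hT⟩ := exists_abs_integral_cos_mul_le hh (half_pos h0)
  obtain ⟨N₀, hN₀⟩ := pow_unbounded_of_one_lt T (one_lt_two)
  refine ⟨N₀, fun N hN j hj => ?_⟩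
  have hr : (0 : ℝ) < 2 ^ j := by positivity
  -- The frequency 2·2^N seen at the scale of the bump. As j ≤ 0 it is at least 2^N, so one
  -- threshold serves all j; the centre only affects the phase.
  set t : ℝ := 2 * 2 ^ N * ((2 : ℝ) ^ j)⁻¹ with ht
  set θ : ℝ := 2 * 2 ^ N * center d N j 0 with hθ
  have htT : T ≤ t := by
    have e1 : (2 : ℝ) ^ N₀ ≤ 2 ^ N := pow_le_pow_right₀ one_le_two hN
    have e2 : (1 : ℝ) ≤ ((2 : ℝ) ^ j)⁻¹ :=
      (one_le_inv₀ hr).2 (zpow_le_one_of_nonpos₀ one_le_two hj)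
    have e3 : (0 : ℝ) < 2 ^ N := by positivity
    nlinarith
  have e (x : E d) : Real.cos (2 ^ N * x 0) ^ 2 * (bump φ N j x ^ 2 *
      h ((2 : ℝ) ^ j • (x - center d N j)))
      = ((2 : ℝ) ^ j) ^ 2 * (fun y => (1 / 2 + Real.cos (t * y 0 + θ) / 2) * (φ y ^ 2 * h y))
        ((2 : ℝ) ^ j • (x - center d N j)) := by
    have : t * ((2 : ℝ) ^ j • (x - center d N j)) 0 + θ = 2 * (2 ^ N * x 0) := by
      simp only [PiLp.smul_apply, PiLp.sub_apply, smul_eq_mul, ht, hθ]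
      field_simp
      ring
    simp only [bump]
    rw [this, Real.cos_sq]
    ring
  simp only [e]
  rw [integral_const_mul, integral_smul_sub (fun y => (1 / 2 + Real.cos (t * y 0 + θ) / 2)
    * (φ y ^ 2 * h y)) hr, bumpMass_eq, ← mul_assoc]
  refine mul_le_mul_of_nonneg_left ?_ (by positivity)
  have hi : Integrable fun y => Real.cos (t * y 0 + θ) * (φ y ^ 2 * h y) := by
    refine hh.bdd_mul (c := 1) (Continuous.aestronglyMeasurable (by fun_prop))
      (Filter.Eventually.of_forall fun y => Real.abs_cos_le_one _)
  have e2 : ∫ y, (1 / 2 + Real.cos (t * y 0 + θ) / 2) * (φ y ^ 2 * h y)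
      = 1 / 2 * c₀ + 1 / 2 * ∫ y, Real.cos (t * y 0 + θ) * (φ y ^ 2 * h y) := by
    rw [hc₀, ← integral_const_mul, ← integral_const_mul, ← integral_add (hh.const_mul _)
      (hi.const_mul _)]
    congr 1 with y
    ring
  rw [e2]
  have := (abs_le.1 (hT t htT θ)).1
  linarith

/-- The sum of the bumps, modulated and squared, tested against the autocorrelation at the `j`-th
bump. -/
theorem exists_integral_cos_sq_amp_lower_bound (hd : 2 ≤ d) {φ : 𝓢(E d, ℝ)} (hφ : φ ≠ 0) :
    ∃ (m N₀ : ℕ) (c C : ℝ), 0 < c ∧ 0 < C ∧ ∀ N ≥ N₀, ∀ n ≤ N, ∀ j : ℤ, -(n : ℤ) ≤ j → j ≤ 0 →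
      c * bumpMass d j - C * ((n + 1) ^ 2 * bumpMass d (-n)) * ((2 : ℝ) ^ N)⁻¹ ≤
      ∫ x, Real.cos (2 ^ N * x 0) ^ 2 * amp φ N n x ^ 2 *
        autocorr φ ((2 : ℝ) ^ (j - m) • (x - center d N j)) := by
  obtain ⟨m, hm⟩ := exists_integral_sq_mul_autocorr_pos hφ
  obtain ⟨A, hA, h1, h2, -⟩ := autocorr_bound φ
  have hψc := continuous_autocorr φ
  have hφc := φ.continuous
  set h := fun y => autocorr φ ((2 : ℝ) ^ (-(m : ℤ)) • y) with hh
  have hhc : Continuous h := by fun_prop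
  have hi : Integrable fun y => φ y ^ 2 * h y :=
    (integrable_sq_schwartz φ).mul_bdd hhc.aestronglyMeasurable
      (Filter.Eventually.of_forall fun y => h1 _)
  obtain ⟨N₀, hN₀⟩ := exists_integral_cos_sq_bump_lower_bound φ hi hm
  set S := ∫ y, φ y ^ 2 with hS
  have hS0 : 0 ≤ S := integral_nonneg fun _ => sq_nonneg _
  set S₁ := ∫ y, φ y ^ 2 * (1 + ‖y‖) with hS₁
  have hS₁0 : 0 ≤ S₁ := integral_nonneg fun _ => by positivity
  have hi1 : Integrable fun y => φ y ^ 2 * (1 + ‖y‖) := by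
    refine ((integrable_sq_schwartz φ).add (integrable_sq_mul_norm_schwartz φ)).congr
      (Filter.Eventually.of_forall fun y => ?_)
    simp only [Pi.add_apply]; ring
  refine ⟨m, N₀, (∫ y, φ y ^ 2 * h y) / 4, A * S + 4 * A * 2 ^ m * S₁ + 1, by positivity,
    by positivity, fun N hN n hn j hj1 hj2 => ?_⟩
  set ψ := fun x => autocorr φ ((2 : ℝ) ^ (j - m) • (x - center d N j)) with hψ
  have hψcont : Continuous ψ := by fun_prop
  have hψA (x) : |ψ x| ≤ A := h1 _
  have hψh (x) : ψ x = h ((2 : ℝ) ^ j • (x - center d N j)) := by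
    simp only [hψ, hh]
    rw [smul_smul, ← zpow_add₀ two_ne_zero, neg_add_eq_sub]
  set r := fun x => ∑ i ∈ (Finset.Icc (-(n : ℤ)) 0).erase j, bump φ N i x with hr
  have hjm : j ∈ Finset.Icc (-(n : ℤ)) 0 := Finset.mem_Icc.2 ⟨hj1, hj2⟩
  have hP (x) : amp φ N n x = bump φ N j x + r x := (Finset.add_sum_erase _ _ hjm).symm
  set M : ℝ := 2 ^ N with hM
  have hM1 : 1 ≤ M := one_le_pow₀ one_le_two
  have hM0 : 0 < M := by positivity
  -- The smallness of the test function at the other bumps. Its factor M⁻² pays for the factor M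
  -- spent on the cross terms and still leaves M⁻¹.
  set κ := 2 * A * 2 ^ m * (M ^ 2)⁻¹ with hκ
  have hM2 : (2 : ℝ) ^ (2 * N) = M ^ 2 := by rw [hM, ← pow_mul, mul_comm]
  -- the other bumps
  set q := fun x => ∑ i ∈ (Finset.Icc (-(n : ℤ)) 0).erase j, bump φ N i x ^ 2 *
    (1 + ‖(2 : ℝ) ^ i • (x - center d N i)‖) with hq
  have hqi : Integrable q := integrable_finsetSum _ fun i _ => integrable_sq_bump_mul φ N i hi1
  have hrq (x) : r x ^ 2 * |ψ x| ≤ (n + 1) * κ * q x := by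
    have hs := sq_sum_le_card_mul_sum_sq (s := (Finset.Icc (-(n : ℤ)) 0).erase j)
      (f := fun i => bump φ N i x)
    have hcard : ((((Finset.Icc (-(n : ℤ)) 0).erase j).card : ℕ) : ℝ) ≤ n + 1 := by
      have := Finset.card_erase_le (s := Finset.Icc (-(n : ℤ)) 0) (a := j)
      rw [card_Icc_neg] at this
      exact_mod_cast this
    calc r x ^ 2 * |ψ x| ≤ ((n + 1) * ∑ i ∈ (Finset.Icc (-(n : ℤ)) 0).erase j, bump φ N i x ^ 2)
          * |ψ x| := by
          gcongr
          refine hs.trans ?_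
          gcongr
      _ = (n + 1) * ∑ i ∈ (Finset.Icc (-(n : ℤ)) 0).erase j, bump φ N i x ^ 2 * |ψ x| := by
        rw [mul_assoc, Finset.sum_mul]
      _ ≤ (n + 1) * ∑ i ∈ (Finset.Icc (-(n : ℤ)) 0).erase j, bump φ N i x ^ 2 *
          (κ * (1 + ‖(2 : ℝ) ^ i • (x - center d N i)‖)) := by
        gcongr with i hi'
        have hi2 := Finset.mem_erase.1 hi'
        have := abs_test_le hA h1 h2 N m (Finset.mem_Icc.1 hi2.2).2 hj2 hi2.1 x
        rw [hM2] at this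
        exact this
      _ = _ := by
        simp only [hq, Finset.mul_sum]
        refine Finset.sum_congr rfl fun i _ => ?_
        ring
  have hqI : ∫ x, q x ≤ (n + 1) * bumpMass d (-n) * S₁ := by
    calc ∫ x, q x = ∑ i ∈ (Finset.Icc (-(n : ℤ)) 0).erase j, bumpMass d i * S₁ := by
          rw [hq, integral_finsetSum _ fun i _ => integrable_sq_bump_mul φ N i hi1]
          exact Finset.sum_congr rfl fun i _ =>
            integral_sq_bump_mul φ N i (fun y => 1 + ‖y‖)
      _ ≤ ∑ i ∈ Finset.Icc (-(n : ℤ)) 0, bumpMass d i * S₁ :=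
        Finset.sum_le_sum_of_subset_of_nonneg (Finset.erase_subset _ _) fun i _ _ =>
          mul_nonneg (bumpMass_pos d i).le hS₁0
      _ ≤ _ := by
        rw [← Finset.sum_mul]
        gcongr
        exact sum_bumpMass_le n hd
  have hb := hN₀ N hN j hj2
  simp only [← hψh] at hb
  -- pointwise comparison
  have hpt (x) : Real.cos (M * x 0) ^ 2 * (bump φ N j x ^ 2 * ψ x)
      - (M⁻¹ * A * bump φ N j x ^ 2 + 2 * M * ((n + 1) * κ * q x))
      ≤ Real.cos (M * x 0) ^ 2 * amp φ N n x ^ 2 * ψ x := by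
    set b := bump φ N j x with hbdef
    -- The cross term is split with weights M⁻¹ and M: the bump at j must keep a small coefficient,
    -- while the other bumps can afford a large one.
    have hx1 : |2 * b * r x + r x ^ 2| ≤ M⁻¹ * b ^ 2 + 2 * M * r x ^ 2 := by
      have hMi : M⁻¹ * M = 1 := inv_mul_cancel₀ hM0.ne'
      have hMi0 : 0 < M⁻¹ := by positivity
      have k1 : 0 ≤ M⁻¹ * (b - M * r x) ^ 2 := by positivity
      have k2 : 0 ≤ M⁻¹ * (b + M * r x) ^ 2 := by positivity
      have k3 : M⁻¹ * (b - M * r x) ^ 2 = M⁻¹ * b ^ 2 - 2 * b * r x + M * r x ^ 2 := by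
        field_simp; ring
      have k4 : M⁻¹ * (b + M * r x) ^ 2 = M⁻¹ * b ^ 2 + 2 * b * r x + M * r x ^ 2 := by
        field_simp; ring
      have k5 : r x ^ 2 ≤ M * r x ^ 2 := le_mul_of_one_le_left (sq_nonneg _) hM1
      have k6 : 0 ≤ r x ^ 2 := sq_nonneg _
      rw [abs_le]
      constructor <;> linarith
    have hx2 : |Real.cos (M * x 0) ^ 2 * (2 * b * r x + r x ^ 2) * ψ x|
        ≤ M⁻¹ * A * b ^ 2 + 2 * M * ((n + 1) * κ * q x) := by
      have hcos : |Real.cos (M * x 0) ^ 2| ≤ 1 := by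
        rw [abs_of_nonneg (sq_nonneg _)]
        exact Real.cos_sq_le_one _
      rw [abs_mul, abs_mul]
      calc _ ≤ 1 * (M⁻¹ * b ^ 2 + 2 * M * r x ^ 2) * |ψ x| := by gcongr
        _ = M⁻¹ * b ^ 2 * |ψ x| + 2 * M * (r x ^ 2 * |ψ x|) := by ring
        _ ≤ M⁻¹ * b ^ 2 * A + 2 * M * ((n + 1) * κ * q x) :=
          add_le_add (mul_le_mul_of_nonneg_left (hψA x) (by positivity))
            (mul_le_mul_of_nonneg_left (hrq x) (by positivity))
        _ = _ := by ring
    have hx3 : Real.cos (M * x 0) ^ 2 * amp φ N n x ^ 2 * ψ x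
        = Real.cos (M * x 0) ^ 2 * (b ^ 2 * ψ x)
          + Real.cos (M * x 0) ^ 2 * (2 * b * r x + r x ^ 2) * ψ x := by
      rw [hP x]; ring
    linarith [(abs_le.1 hx2).1]
  have hbc := continuous_bump φ N j
  have hac := continuous_amp φ N n
  have hcosb (x : E d) : ‖Real.cos (M * x 0) ^ 2‖ ≤ 1 := by
    rw [Real.norm_of_nonneg (sq_nonneg _)]
    exact Real.cos_sq_le_one _
  have j1 : Integrable fun x => Real.cos (M * x 0) ^ 2 * (bump φ N j x ^ 2 * ψ x) :=
    ((integrable_sq_bump φ N j).mul_bdd hψcont.aestronglyMeasurable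
      (Filter.Eventually.of_forall hψA)).bdd_mul (c := 1)
      (Continuous.aestronglyMeasurable (by fun_prop)) (Filter.Eventually.of_forall hcosb)
  have j2 : Integrable fun x => M⁻¹ * A * bump φ N j x ^ 2 + 2 * M * ((n + 1) * κ * q x) :=
    ((integrable_sq_bump φ N j).const_mul _).add ((hqi.const_mul _).const_mul _)
  have j3 : Integrable fun x => Real.cos (M * x 0) ^ 2 * amp φ N n x ^ 2 * ψ x :=
    ((integrable_sq_amp φ N n).bdd_mul (c := 1) (Continuous.aestronglyMeasurable (by fun_prop))
      (Filter.Eventually.of_forall hcosb)).mul_bdd hψcont.aestronglyMeasurable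
      (Filter.Eventually.of_forall hψA)
  have hint := integral_mono (j1.sub j2) j3 hpt
  simp only [Pi.sub_apply] at hint
  rw [integral_sub j1 j2, integral_add ((integrable_sq_bump φ N j).const_mul _)
    ((hqi.const_mul _).const_mul _), integral_const_mul, integral_const_mul, integral_const_mul,
    integral_sq_bump] at hint
  have hB0 := bumpMass_pos d (-n)
  have hn0 : (0 : ℝ) ≤ n := n.cast_nonneg
  have f1 : M⁻¹ * A * (bumpMass d j * S) ≤ A * S * ((n + 1) ^ 2 * bumpMass d (-n)) * M⁻¹ := by
    have hb1 := bumpMass_le hd hj1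
    have : bumpMass d j ≤ (n + 1) ^ 2 * bumpMass d (-n) := by
      have : (1 : ℝ) ≤ (n + 1) ^ 2 := by nlinarith
      nlinarith
    calc _ = A * S * bumpMass d j * M⁻¹ := by ring
      _ ≤ _ := by gcongr
  have f2 : 2 * M * ((n + 1) * κ * ∫ x, q x)
      ≤ 4 * A * 2 ^ m * S₁ * ((n + 1) ^ 2 * bumpMass d (-n)) * M⁻¹ := by
    calc _ ≤ 2 * M * ((n + 1) * κ * ((n + 1) * bumpMass d (-n) * S₁)) := by gcongr
      _ = _ := by
        rw [hκ]
        field_simp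
        ring
  have f3 : 0 ≤ (n + 1) ^ 2 * bumpMass d (-n) * M⁻¹ := by positivity
  linarith

end

/-! ### The Duhamel term of the initial data -/

theorem toV_smul {d : ℕ} (r : ℝ) (x : E d) : toV (r • x) = (r : ℂ) • toV x := by
  ext i
  simp [toV]

theorem ceil_neg_eq {r : ℝ} (hr : 0 ≤ r) : ⌈-r⌉ = -(⌊r⌋₊ : ℤ) := by
  rw [Int.ceil_neg, Int.natCast_floor_eq_floor hr]

/-- The amplitude is 2^(-(d-1)j) 2^(dj) = 2^j, and ⌈-δN⌉ = -⌊δN⌋. From here on δ enters only through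
the number of bumps. -/
theorem initialVelocity_eq {d : ℕ} [NeZero d] (φ : 𝓢(E d, ℝ)) (R : ℝ) {δ : ℝ} (hδ : 0 ≤ δ) (N : ℕ) :
    initialVelocity φ R δ N = sinField ((2 : ℝ) ^ N)
      (ampS φ N ⌊δ * N⌋₊ (R * (N : ℝ) ^ (-(1 / (d : ℝ))))) := by
  ext1 x
  have h : profile φ R δ N x = Real.sin (2 ^ N * x 0) *
      (R * (N : ℝ) ^ (-(1 / (d : ℝ))) * amp φ N ⌊δ * N⌋₊ x) := by
    rw [profile, ceil_neg_eq (by positivity), ← Finset.sum_mul, amp]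
    have e (j : ℤ) : (2 : ℝ) ^ (-(((d : ℤ) - 1) * j))
        * dyadic φ j (x - (2 : ℝ) ^ (|j| + 2 * (N : ℤ)) • e₁ d) = bump φ N j x := by
      rw [dyadic, bump, center, ← mul_assoc, ← zpow_add₀ two_ne_zero]
      congr 2
      ring
    simp only [e]
    ring
  rw [initialVelocity, sinField, toV_smul, ampS_apply, h]
  push_cast
  rfl

/-- Young's inequality with a free weight θ, chosen later to balance a large main term against a
small error. -/
theorem abs_norm_sq_sub_le {F : Type*} [SeminormedAddCommGroup F] (v w : F) {θ : ℝ} (hθ : 0 < θ) :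
    |‖v‖ ^ 2 - ‖w‖ ^ 2| ≤ θ * ‖w‖ ^ 2 + (1 + θ⁻¹) * ‖v - w‖ ^ 2 := by
  have h1 := norm_sub_norm_le v w
  have h2 := norm_sub_norm_le w v
  rw [norm_sub_rev] at h2
  have h3 := norm_nonneg v
  have h4 := norm_nonneg w
  have h5 := norm_nonneg (v - w)
  set e := ‖v - w‖
  have h6 : 2 * ‖w‖ * e ≤ θ * ‖w‖ ^ 2 + θ⁻¹ * e ^ 2 := by
    have : 0 ≤ θ⁻¹ * (θ * ‖w‖ - e) ^ 2 := by positivity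
    have k : θ⁻¹ * (θ * ‖w‖ - e) ^ 2 = θ * ‖w‖ ^ 2 - 2 * ‖w‖ * e + θ⁻¹ * e ^ 2 := by
      field_simp; ring
    linarith
  rw [abs_le]
  constructor <;> nlinarith

section
variable {d : ℕ} [NeZero d] {μ lam : ℝ}

theorem sum_sq_e₁ : ∑ i, e₁ d i ^ 2 = 1 := by
  rw [← EuclideanSpace.real_norm_sq_eq, norm_e₁, one_pow]

theorem norm_sq_smul_cosField (φ : 𝓢(E d, ℝ)) (N n : ℕ) (a M r : ℝ) (x : E d) :
    ‖r • cosField M (ampS φ N n a) x‖ ^ 2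
      = r ^ 2 * (a ^ 2 * (Real.cos (M * x 0) ^ 2 * amp φ N n x ^ 2)) := by
  rw [cosField, ampS_apply, norm_smul, norm_smul, norm_mul, norm_toV, norm_e₁, Complex.norm_real,
    Complex.norm_real, mul_one, mul_pow, mul_pow, Real.norm_eq_abs, Real.norm_eq_abs,
    Real.norm_eq_abs, sq_abs, sq_abs, sq_abs]
  ring

/-- The squared gradient of the evolved data is close to that of the pure oscillation. -/
theorem exists_sum_norm_sq_lameDeriv_bounds (hd : 2 ≤ d) (hμ : 0 < μ) (hlam : 0 < 2 * μ + lam)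
    (φ : 𝓢(E d, ℝ)) :
    ∃ K : ℝ, 0 < K ∧ ∀ (N n : ℕ) (a s : ℝ), 0 ≤ s → s * ((2 : ℝ) ^ N) ^ 2 ≤ 1 →
      Integrable (fun x => ∑ i, ‖lameDeriv μ lam (sinField ((2 : ℝ) ^ N) (ampS φ N n a)) i s x‖ ^ 2) ∧
      ∫ x, ∑ i, ‖lameDeriv μ lam (sinField ((2 : ℝ) ^ N) (ampS φ N n a)) i s x‖ ^ 2
        ≤ K * (((2 : ℝ) ^ N) ^ 2 * a ^ 2 * ((n + 1) ^ 2 * bumpMass d (-n))) ∧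
      ∀ (ψ : E d → ℝ) (A : ℝ), Continuous ψ → (∀ x, |ψ x| ≤ A) →
        ((2 : ℝ) ^ N) ^ 2 * a ^ 2 *
            (Real.exp (-(s * (2 * μ + lam) * ((2 : ℝ) ^ N) ^ 2)) ^ 2 *
              ∫ x, Real.cos (2 ^ N * x 0) ^ 2 * amp φ N n x ^ 2 * ψ x)
          - A * K * ((2 : ℝ) ^ N * a ^ 2 * ((n + 1) ^ 2 * bumpMass d (-n)))
        ≤ ∫ x, (∑ i, ‖lameDeriv μ lam (sinField ((2 : ℝ) ^ N) (ampS φ N n a)) i s x‖ ^ 2) * ψ x := by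
  set S := ∫ x, φ x ^ 2
  set W := ∫ w, (‖w‖ * ‖𝓕 (cplx φ) w‖) ^ 2
  have hS : 0 ≤ S := integral_nonneg fun x => sq_nonneg _
  have hW : 0 ≤ W := integral_nonneg fun x => sq_nonneg _
  set κ := 4 * (Real.pi * (4 + 3 * (2 * μ + lam))) ^ 2 with hκ
  have hκ0 : 0 ≤ κ := by positivity
  refine ⟨2 * S + 2 * (d * (κ * W)) + 1, by positivity, fun N n a s hs hsM => ?_⟩
  set M : ℝ := (2 : ℝ) ^ N with hMdef
  have hM : 0 < M := by positivity
  have hM1 : 1 ≤ M := one_le_pow₀ one_le_two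
  set U := ((n : ℝ) + 1) ^ 2 * bumpMass d (-n)
  have hU : 0 ≤ U := mul_nonneg (by positivity) (bumpMass_pos d _).le
  set Q := ampS φ N n a
  set e := Real.exp (-(s * (2 * μ + lam) * M ^ 2))
  have he0 : 0 < e := Real.exp_pos _
  have he1 : e ≤ 1 := Real.exp_le_one_iff.2 (by have : 0 ≤ s * (2 * μ + lam) * M ^ 2 := by positivity
                                                linarith)
  set F : Fin d → E d → V d := fun i => lameDeriv μ lam (sinField M Q) i s with hF
  set F0 : Fin d → E d → V d := fun i x => (M * e * e₁ d i) • cosField M Q x with hF0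
  have hD (i) := integral_norm_sq_lameDeriv_sub_le hμ hlam hs Q hM hsM i
  have hDi : Integrable fun x => ∑ i, ‖F i x - F0 i x‖ ^ 2 := integrable_finsetSum _ fun i _ => (hD i).1
  have hDb : ∫ x, ∑ i, ‖F i x - F0 i x‖ ^ 2 ≤ d * (κ * W) * (a ^ 2 * U) := by
    rw [integral_finsetSum _ fun i _ => (hD i).1]
    have hQ : ∫ w, (‖w‖ * ‖𝓕 (Q : E d → ℂ) w‖) ^ 2 ≤ a ^ 2 * (U * W) :=
      integral_norm_mul_fourier_ampS_le φ N n hd a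
    calc _ ≤ ∑ i : Fin d, κ * (a ^ 2 * (U * W)) :=
          Finset.sum_le_sum fun i _ => (hD i).2.trans (mul_le_mul_of_nonneg_left hQ hκ0)
      _ = _ := by
        rw [Finset.sum_const, Finset.card_univ, Fintype.card_fin, nsmul_eq_mul]; ring
  set H : E d → ℝ := fun x => M ^ 2 * a ^ 2 * (e ^ 2 * (Real.cos (M * x 0) ^ 2 * amp φ N n x ^ 2)) with hH
  have hHsum (x) : ∑ i, ‖F0 i x‖ ^ 2 = H x := by
    simp only [hF0, Q, norm_sq_smul_cosField]
    rw [← Finset.sum_mul]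
    simp only [mul_pow]
    rw [← Finset.mul_sum, sum_sq_e₁]
    simp only [hH]
    ring
  have hamp := continuous_amp φ N n
  have hcos (x : E d) : Real.cos (M * x 0) ^ 2 ≤ 1 := Real.cos_sq_le_one _
  have hcP : Integrable fun x : E d => Real.cos (M * x 0) ^ 2 * amp φ N n x ^ 2 := by
    refine (integrable_sq_amp φ N n).bdd_mul (c := 1)
      (Continuous.aestronglyMeasurable (by fun_prop)) (Filter.Eventually.of_forall fun x => ?_)
    rw [Real.norm_of_nonneg (sq_nonneg _)]
    exact hcos x
  have hHi : Integrable H := (hcP.const_mul _).const_mul _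
  have hHb : ∫ x, H x ≤ M ^ 2 * a ^ 2 * (U * S) := by
    simp only [hH]
    rw [integral_const_mul]
    refine mul_le_mul_of_nonneg_left ?_ (by positivity)
    refine (integral_mono (hcP.const_mul _) (integrable_sq_amp φ N n) fun x => ?_).trans
      (integral_sq_amp_le φ N n hd)
    have h2 : e ^ 2 * Real.cos (M * x 0) ^ 2 ≤ 1 * 1 :=
      mul_le_mul (pow_le_one₀ he0.le he1) (hcos x) (sq_nonneg _) zero_le_one
    have h3 := mul_le_mul_of_nonneg_right h2 (sq_nonneg (amp φ N n x))
    simp only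
    linarith
  have hpt (x) {θ : ℝ} (hθ : 0 < θ) : |∑ i, ‖F i x‖ ^ 2 - H x|
      ≤ θ * H x + (1 + θ⁻¹) * ∑ i, ‖F i x - F0 i x‖ ^ 2 := by
    rw [← hHsum, ← Finset.sum_sub_distrib, Finset.mul_sum, Finset.mul_sum, ← Finset.sum_add_distrib]
    exact (Finset.abs_sum_le_sum_abs _ _).trans
      (Finset.sum_le_sum fun i _ => abs_norm_sq_sub_le _ _ hθ)
  have hGi : Integrable fun x => ∑ i, ‖F i x‖ ^ 2 := by
    refine integrable_finsetSum _ fun i _ => ?_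
    exact (memLp_lameDeriv hμ hlam hs Q i).integrable_norm_pow two_ne_zero
  refine ⟨hGi, ?_, fun ψ A hψ hA => ?_⟩
  · calc ∫ x, ∑ i, ‖F i x‖ ^ 2 ≤ ∫ x, (2 * H x + 2 * ∑ i, ‖F i x - F0 i x‖ ^ 2) := by
          refine integral_mono hGi ((hHi.const_mul _).add (hDi.const_mul _)) fun x => ?_
          have := (abs_le.1 (hpt x one_pos)).2
          simp only
          norm_num at this
          linarith
      _ = 2 * (∫ x, H x) + 2 * ∫ x, ∑ i, ‖F i x - F0 i x‖ ^ 2 := by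
          rw [integral_add (hHi.const_mul _) (hDi.const_mul _), integral_const_mul (2 : ℝ) H,
            integral_const_mul (2 : ℝ) fun x => ∑ i, ‖F i x - F0 i x‖ ^ 2]
      _ ≤ 2 * (M ^ 2 * a ^ 2 * (U * S)) + 2 * (d * (κ * W) * (a ^ 2 * U)) := by linarith
      _ ≤ _ := by
        have k1 : d * (κ * W) * (a ^ 2 * U) ≤ M ^ 2 * (d * (κ * W) * (a ^ 2 * U)) :=
          le_mul_of_one_le_left (by positivity) (one_le_pow₀ hM1)
        have k2 : 0 ≤ M ^ 2 * a ^ 2 * U := by positivity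
        linarith
  · have hA0 : 0 ≤ A := (abs_nonneg _).trans (hA 0)
    have hAe : ∀ᵐ x, ‖ψ x‖ ≤ A := Filter.Eventually.of_forall hA
    have e1 : ∫ x, H x * ψ x = M ^ 2 * a ^ 2 *
        (e ^ 2 * ∫ x, Real.cos (M * x 0) ^ 2 * amp φ N n x ^ 2 * ψ x) := by
      rw [← integral_const_mul, ← integral_const_mul]
      congr 1 with x
      simp only [hH]
      ring
    have iR : Integrable fun x => A * (M⁻¹ * H x + (1 + M) * ∑ i, ‖F i x - F0 i x‖ ^ 2) :=
      ((hHi.const_mul _).add (hDi.const_mul _)).const_mul _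
    have iH : Integrable fun x => H x * ψ x := hHi.mul_bdd hψ.aestronglyMeasurable hAe
    have iG : Integrable fun x => (∑ i, ‖F i x‖ ^ 2) * ψ x := hGi.mul_bdd hψ.aestronglyMeasurable hAe
    have e2 : (∫ x, H x * ψ x) - A * (M⁻¹ * (∫ x, H x) + (1 + M) * ∫ x, ∑ i, ‖F i x - F0 i x‖ ^ 2)
        ≤ ∫ x, (∑ i, ‖F i x‖ ^ 2) * ψ x := by
      rw [← integral_const_mul, ← integral_const_mul,
        ← integral_add (hHi.const_mul _) (hDi.const_mul _), ← integral_const_mul, ← integral_sub iH iR]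
      refine integral_mono (iH.sub iR) iG fun x => ?_
      -- With θ = M⁻¹ both errors are of order M: M⁻¹ times the main term M², and 1 + M times the
      -- bounded L² error.
      have h1 := hpt x (inv_pos.2 hM)
      rw [inv_inv] at h1
      have h2 : |(∑ i, ‖F i x‖ ^ 2 - H x) * ψ x| ≤
          (M⁻¹ * H x + (1 + M) * ∑ i, ‖F i x - F0 i x‖ ^ 2) * A := by
        rw [abs_mul]
        exact mul_le_mul h1 (hA x) (abs_nonneg _) ((abs_nonneg _).trans h1)
      have := (abs_le.1 h2).1
      simp only
      linarith
    rw [← e1]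
    refine le_trans (sub_le_sub_left ?_ _) e2
    rw [mul_assoc A]
    refine mul_le_mul_of_nonneg_left ?_ hA0
    have k1 : M⁻¹ * (∫ x, H x) ≤ M * a ^ 2 * (U * S) := by
      refine (mul_le_mul_of_nonneg_left hHb (by positivity)).trans (le_of_eq ?_)
      field_simp
    have k2 : (1 + M) * (∫ x, ∑ i, ‖F i x - F0 i x‖ ^ 2) ≤ (2 * M) * (d * (κ * W) * (a ^ 2 * U)) := by
      refine mul_le_mul (by linarith) hDb (integral_nonneg fun x => ?_) (by positivity)
      exact Finset.sum_nonneg fun i _ => sq_nonneg _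
    have k3 : 0 ≤ M * a ^ 2 * U := by positivity
    have k4 : 0 ≤ M * a ^ 2 * U * S := by positivity
    linarith

end

theorem eventually_sq_mul_pow_le {d : ℕ} (hd : 0 < d) {ε : ℝ} (hε : 0 < ε) :
    ∃ N₀ : ℕ, ∀ N : ℕ, N₀ ≤ N → ((N : ℝ) + 1) ^ 2 * (2 : ℝ) ^ (-(2 * (N : ℝ) / d)) ≤ ε := by
  have hd' : (0 : ℝ) < d := by exact_mod_cast hd
  set r : ℝ := (2 : ℝ) ^ (-(2 / (d : ℝ))) with hr
  have hr0 : 0 < r := by positivity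
  have hr1 : r < 1 := Real.rpow_lt_one_of_one_lt_of_neg one_lt_two (by
    have : 0 < 2 / (d : ℝ) := by positivity
    linarith)
  have h := tendsto_pow_const_mul_const_pow_of_abs_lt_one 2 (r := r) (by rwa [abs_of_pos hr0])
  have h2 := (h.const_mul 4).eventually_lt_const (u := ε) (by simpa using hε)
  obtain ⟨N₀, hN₀⟩ := Filter.eventually_atTop.1 h2
  refine ⟨max N₀ 1, fun N hN => le_trans ?_ (hN₀ N (le_of_max_le_left hN)).le⟩
  have hN1 : (1 : ℝ) ≤ N := by exact_mod_cast le_of_max_le_right hN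
  have e : (2 : ℝ) ^ (-(2 * (N : ℝ) / d)) = r ^ N := by
    rw [hr, ← Real.rpow_natCast, ← Real.rpow_mul two_pos.le]
    congr 1
    ring
  rw [e, ← mul_assoc]
  exact mul_le_mul_of_nonneg_right (by nlinarith) (by positivity)

/-- This decides which j are usable. The quotient of the masses at -n and at j is 2^((d-2)(j+n)),
and d(j+n) ≤ N makes it at most 2^(N - 2N/d). After multiplication by 2^(-N) a decay of 2^(-2N/d)
remains. -/
theorem bumpMass_mul_le {d : ℕ} (hd : 2 ≤ d) {N n : ℕ} (hn : n ≤ N) {j : ℤ} (hj : (d : ℤ) * (j + n) ≤ N) :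
    ((n : ℝ) + 1) ^ 2 * bumpMass d (-n) * ((2 : ℝ) ^ N)⁻¹
      ≤ ((N : ℝ) + 1) ^ 2 * (2 : ℝ) ^ (-(2 * (N : ℝ) / d)) * bumpMass d j := by
  have h1 : bumpMass d (-n) * ((2 : ℝ) ^ N)⁻¹ ≤ (2 : ℝ) ^ (-(2 * (N : ℝ) / d)) * bumpMass d j := by
    unfold bumpMass
    rw [← zpow_natCast, ← zpow_neg, ← zpow_add₀ two_ne_zero, ← Real.rpow_intCast, ← Real.rpow_intCast,
      ← Real.rpow_add two_pos]
    refine Real.rpow_le_rpow_of_exponent_le one_le_two ?_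
    push_cast
    have hd' : (2 : ℝ) ≤ d := by exact_mod_cast hd
    have hj' : (d : ℝ) * (j + n) ≤ N := by exact_mod_cast hj
    have h2 : (j + n : ℝ) ≤ N / d := by
      rw [le_div_iff₀ (by linarith)]; linarith
    have h3 : ((d : ℝ) - 2) * (j + n) ≤ (d - 2) * (N / d) :=
      mul_le_mul_of_nonneg_left h2 (by linarith)
    have h4 : ((d : ℝ) - 2) * (N / d) = N - 2 * N / d := by field_simp
    linarith
  have h2 : ((n : ℝ) + 1) ^ 2 ≤ ((N : ℝ) + 1) ^ 2 := by gcongr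
  calc _ = ((n : ℝ) + 1) ^ 2 * (bumpMass d (-n) * ((2 : ℝ) ^ N)⁻¹) := by ring
    _ ≤ ((N : ℝ) + 1) ^ 2 * ((2 : ℝ) ^ (-(2 * (N : ℝ) / d)) * bumpMass d j) :=
      mul_le_mul h2 h1 (mul_nonneg (bumpMass_pos d _).le (by positivity)) (by positivity)
    _ = _ := by ring

section
variable {d : ℕ} [NeZero d]

theorem duhamel_eq {μ lam κ t : ℝ} (hμ : 0 < μ) (hlam : 0 < 2 * μ + lam) (ht : 0 ≤ t) (M : ℝ)
    (Q : 𝓢(E d, ℂ)) (x : E d) :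
    duhamel μ lam κ t (sinField M Q) x = ∫ s in (0 : ℝ)..t,
      heatSemigroup κ (t - s) (fun y => ∑ i, ‖lameDeriv μ lam (sinField M Q) i s y‖ ^ 2) x := by
  unfold duhamel
  refine intervalIntegral.integral_congr fun s hs => ?_
  rw [Set.uIcc_of_le ht] at hs
  have : gradSq (lameSemigroup μ lam s (sinField M Q))
      = fun y => ∑ i, ‖lameDeriv μ lam (sinField M Q) i s y‖ ^ 2 :=
    funext fun y => gradSq_lameSemigroup hμ hlam hs.1 Q y
  simp only [this]

/-- The Duhamel term of the data is integrable, nonnegative and substantial near the low-frequency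
bumps. -/
theorem exists_integral_duhamel_lower_bound (hd : 2 ≤ d) {φ : 𝓢(E d, ℝ)} (hφ : φ ≠ 0)
    {μ lam κ : ℝ} (hμ : 0 < μ) (hlam : 0 < 2 * μ + lam) (hκ : 0 < κ) :
    ∃ (m N₀ : ℕ) (c : ℝ), 0 < c ∧ ∀ (ε₀ : ℝ), 0 < ε₀ → ε₀ ≤ 1 →
      ∀ (N n : ℕ) (a : ℝ), N₀ ≤ N → n ≤ N →
        Integrable (duhamel μ lam κ (ε₀ * (2 : ℝ) ^ (-(2 * (N : ℝ))))
          (sinField ((2 : ℝ) ^ N) (ampS φ N n a))) ∧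
        (∀ x, 0 ≤ duhamel μ lam κ (ε₀ * (2 : ℝ) ^ (-(2 * (N : ℝ))))
          (sinField ((2 : ℝ) ^ N) (ampS φ N n a)) x) ∧
        ∀ j : ℤ, -(n : ℤ) ≤ j → j ≤ 0 → (d : ℤ) * (j + n) ≤ N →
          c * ε₀ * a ^ 2 * bumpMass d j ≤
            ∫ y, duhamel μ lam κ (ε₀ * (2 : ℝ) ^ (-(2 * (N : ℝ))))
              (sinField ((2 : ℝ) ^ N) (ampS φ N n a)) y
              * autocorr φ ((2 : ℝ) ^ (j - m) • (y - center d N j)) := by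
  obtain ⟨m, N₁, c₁, C₁, hc₁, hC₁, h₁⟩ := exists_integral_cos_sq_amp_lower_bound hd hφ
  obtain ⟨K, hK, h₂⟩ := exists_sum_norm_sq_lameDeriv_bounds hd hμ hlam φ
  obtain ⟨A, hA, hA1, -, hA3⟩ := autocorr_bound φ
  have hhm := heatMoment_nonneg d
  -- The three errors: oscillation and distant bumps, deviation from the pure oscillation, and heat
  -- diffusion.
  set C := C₁ + A * K + A * (Real.sqrt κ * heatMoment d) * K with hC
  have hC0 : 0 < C := by positivity
  set c₂ := Real.exp (-(2 * μ + lam)) ^ 2 * c₁ with hc₂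
  have hc₂0 : 0 < c₂ := by positivity
  -- Beyond this threshold the errors take at most half of the main term c₂ times the mass of the
  -- j-th bump.
  obtain ⟨N₂, hN₂⟩ := eventually_sq_mul_pow_le (d := d) (by omega) (ε := c₂ / (2 * C)) (by positivity)
  refine ⟨m, max N₁ N₂, c₂ / 2, by positivity, fun ε₀ hε₀ hε₁ N n a hN hn => ?_⟩
  set t := ε₀ * (2 : ℝ) ^ (-(2 * (N : ℝ))) with ht
  set M : ℝ := (2 : ℝ) ^ N with hMdef
  have hM : 0 < M := by positivity
  have htM : t = ε₀ * (M ^ 2)⁻¹ := by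
    rw [ht, Real.rpow_neg two_pos.le, hMdef, ← pow_mul, ← Real.rpow_natCast]
    push_cast
    rw [mul_comm (N : ℝ)]
  have ht0 : 0 ≤ t := by positivity
  have htM1 : t * M ^ 2 = ε₀ := by rw [htM]; field_simp
  set Q := ampS φ N n a with hQ
  set G : ℝ → E d → ℝ := fun s y => ∑ i, ‖lameDeriv μ lam (sinField M Q) i s y‖ ^ 2 with hGdef
  have hΘ : duhamel μ lam κ t (sinField M Q) =
      fun x => ∫ s in (0 : ℝ)..t, heatSemigroup κ (t - s) (G s) x :=
    funext fun x => duhamel_eq hμ hlam ht0 M Q x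
  have hG : StronglyMeasurable fun p : ℝ × E d => G p.1 p.2 :=
    Finset.stronglyMeasurable_fun_sum _ fun i _ => (measurable_lameDeriv Q i).norm.pow 2
  have hG0 (s x) : 0 ≤ G s x := Finset.sum_nonneg fun i _ => sq_nonneg _
  have hsM {s : ℝ} (hs : s ∈ Set.Ioc 0 t) : s * M ^ 2 ≤ 1 :=
    (mul_le_mul_of_nonneg_right hs.2 (by positivity)).trans (htM1.trans_le hε₁)
  set U := ((n : ℝ) + 1) ^ 2 * bumpMass d (-n) with hU
  have hU0 : 0 ≤ U := mul_nonneg (by positivity) (bumpMass_pos d _).le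
  have hi (s) (hs : s ∈ Set.Ioc 0 t) : Integrable (G s) := (h₂ N n a s hs.1.le (hsM hs)).1
  have hB (s) (hs : s ∈ Set.Ioc 0 t) : ∫ x, G s x ≤ K * (M ^ 2 * a ^ 2 * U) :=
    (h₂ N n a s hs.1.le (hsM hs)).2.1
  rw [hΘ]
  refine ⟨integrable_duhamel_integral hκ ht0 hG hG0 hi hB,
    duhamel_integral_nonneg hκ ht0 hG0, fun j hj1 hj2 hj3 => ?_⟩
  set ψ : E d → ℝ := fun y => autocorr φ ((2 : ℝ) ^ (j - m) • (y - center d N j)) with hψ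
  have hψc : Continuous ψ := (continuous_autocorr φ).comp (by fun_prop)
  have h2k : (2 : ℝ) ^ (j - m) ≤ 1 := zpow_le_one_of_nonpos₀ one_le_two (by omega)
  have hψL (x y) : |ψ x - ψ y| ≤ A * ‖x - y‖ := by
    refine (hA3 _ _).trans (mul_le_mul_of_nonneg_left ?_ hA.le)
    rw [← smul_sub, sub_sub_sub_cancel_right, norm_smul, Real.norm_of_nonneg (by positivity)]
    exact mul_le_of_le_one_left (norm_nonneg _) h2k
  set b := bumpMass d j with hb
  have hb0 : 0 < b := bumpMass_pos d j
  have hX := h₁ N (le_of_max_le_left hN) n hn j hj1 hj2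
  have hm (s) (hs : s ∈ Set.Ioc 0 t) :
      M ^ 2 * a ^ 2 * (c₂ * b - (C₁ + A * K) * (U * M⁻¹)) ≤ ∫ x, G s x * ψ x := by
    refine le_trans ?_ ((h₂ N n a s hs.1.le (hsM hs)).2.2 ψ A hψc fun x => hA1 _)
    set e := Real.exp (-(s * (2 * μ + lam) * M ^ 2)) with he
    have he1 : e ≤ 1 := Real.exp_le_one_iff.2 (by
      have : 0 ≤ s * (2 * μ + lam) * M ^ 2 := by
        have := hs.1
        positivity
      linarith)
    -- On the whole time interval sM² ≤ 1, so the damping is bounded below independently of N.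
    have he2 : Real.exp (-(2 * μ + lam)) ≤ e := Real.exp_le_exp.2 (by
      have := mul_le_mul_of_nonneg_right (hsM hs) hlam.le
      linarith)
    have he3 : Real.exp (-(2 * μ + lam)) ^ 2 ≤ e ^ 2 := pow_le_pow_left₀ (Real.exp_pos _).le he2 2
    have he4 : e ^ 2 ≤ 1 := pow_le_one₀ (Real.exp_pos _).le he1
    set X := ∫ x, Real.cos (M * x 0) ^ 2 * amp φ N n x ^ 2 * ψ x with hXdef
    have k1 : e ^ 2 * (c₁ * b - C₁ * U * M⁻¹) ≤ e ^ 2 * X :=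
      mul_le_mul_of_nonneg_left hX (sq_nonneg _)
    have k2 : c₂ * b ≤ e ^ 2 * (c₁ * b) := by
      rw [hc₂, mul_assoc]
      exact mul_le_mul_of_nonneg_right he3 (by positivity)
    have k3 : e ^ 2 * (C₁ * U * M⁻¹) ≤ C₁ * U * M⁻¹ := mul_le_of_le_one_left (by positivity) he4
    have k4 : c₂ * b - C₁ * U * M⁻¹ ≤ e ^ 2 * X := by linarith
    have k5 := mul_le_mul_of_nonneg_left k4 (by positivity : 0 ≤ M ^ 2 * a ^ 2)
    have k6 : A * K * (M * a ^ 2 * U) = M ^ 2 * a ^ 2 * (A * K * (U * M⁻¹)) := by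
      field_simp
    rw [k6]
    linarith
  refine le_trans ?_ (le_integral_duhamel_integral_mul hκ ht0 hG hG0 hi hB hψc (fun x => hA1 _) hA.le
    hψL hm)
  -- The diffusion length up to time t is at most √κ/M, so the Lipschitz error also gains the factor
  -- 1/M.
  have hsq : Real.sqrt (κ * t) ≤ Real.sqrt κ * M⁻¹ := by
    rw [Real.sqrt_mul hκ.le]
    refine mul_le_mul_of_nonneg_left ?_ (Real.sqrt_nonneg _)
    rw [Real.sqrt_le_left (by positivity), htM, inv_pow]
    exact mul_le_of_le_one_left (by positivity) hε₁
  have hL : A * (Real.sqrt (κ * t) * heatMoment d) * (K * (M ^ 2 * a ^ 2 * U))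
      ≤ M ^ 2 * a ^ 2 * (A * (Real.sqrt κ * heatMoment d) * K * (U * M⁻¹)) := by
    calc _ ≤ A * (Real.sqrt κ * M⁻¹ * heatMoment d) * (K * (M ^ 2 * a ^ 2 * U)) := by gcongr
      _ = _ := by ring
  have hUM : C * (U * M⁻¹) ≤ c₂ / 2 * b := by
    have k1 := bumpMass_mul_le hd hn hj3
    have k2 := mul_le_mul_of_nonneg_right (hN₂ N (le_of_max_le_right hN)) hb0.le
    calc C * (U * M⁻¹) ≤ C * (c₂ / (2 * C) * b) := mul_le_mul_of_nonneg_left (k1.trans k2) hC0.le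
      _ = _ := by field_simp
  calc c₂ / 2 * ε₀ * a ^ 2 * b = t * (M ^ 2 * a ^ 2 * (c₂ * b - c₂ / 2 * b)) := by
        rw [htM]; field_simp; ring
    _ ≤ _ := by
      refine mul_le_mul_of_nonneg_left ?_ ht0
      have k1 := mul_le_mul_of_nonneg_left hUM (by positivity : 0 ≤ M ^ 2 * a ^ 2)
      rw [hC] at k1
      linarith

end

/-! ### The lower bound for the Besov norm of the Duhamel term -/

theorem besovNorm_one {d : ℕ} {F : Type*} [NormedAddCommGroup F] [NormedSpace ℝ F]
    (φ : E d → ℝ) (s : ℝ) (p : ℝ≥0∞) (f : E d → F) :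
    besovNorm φ s p 1 f =
      ∑' j : ℤ, ENNReal.ofReal ((2 : ℝ) ^ (s * j)) * eLpNorm (block φ j f) p volume := by
  simp [besovNorm]

theorem tendsto_integral_mul_autocorr {d : ℕ} (φ : 𝓢(E d, ℝ)) {Θ : E d → ℝ} (hΘ : Integrable Θ) :
    Filter.Tendsto (fun i : ℕ => ∫ y, Θ y * autocorr φ ((2 : ℝ) ^ (-(i : ℤ)) • (y - 0)))
      Filter.atTop (nhds (∫ y, Θ y * autocorr φ 0)) := by
  obtain ⟨A, hA, hA1, -⟩ := autocorr_bound φ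
  have hc := continuous_autocorr φ
  refine tendsto_integral_of_dominated_convergence (fun y => ‖Θ y‖ * A) (fun i => ?_)
    (hΘ.norm.mul_const A) (fun i => Filter.Eventually.of_forall fun y => ?_)
    (Filter.Eventually.of_forall fun y => ?_)
  · exact hΘ.1.mul (Continuous.aestronglyMeasurable (by fun_prop))
  · rw [norm_mul]
    exact mul_le_mul_of_nonneg_left (hA1 _) (norm_nonneg _)
  · refine Filter.Tendsto.const_mul _ ((hc.tendsto 0).comp ?_)
    have h : Filter.Tendsto (fun i : ℕ => ((2 : ℝ)⁻¹) ^ i) Filter.atTop (nhds 0) :=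
      tendsto_pow_atTop_nhds_zero_of_lt_one (by norm_num) (by norm_num)
    simpa using h.smul_const (y - 0)

/-- In the plane, the low frequencies of a nonnegative function have infinite norm. -/
theorem besovNorm_eq_top {φ : 𝓢(E 2, ℝ)} (hφ : φ ≠ 0) {Θ : E 2 → ℝ} (hΘ : Integrable Θ)
    (hpos : 0 < ∫ y, Θ y) : besovNorm φ (-1) 2 1 Θ = ⊤ := by
  obtain ⟨c, hc, h⟩ := exists_block_lower_bound le_rfl hφ
  set L := ∫ y, Θ y * autocorr φ 0 with hL
  have hL0 : 0 < L := by
    rw [hL, integral_mul_const]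
    exact mul_pos hpos (autocorr_zero_pos hφ)
  obtain ⟨K, hK⟩ := Filter.eventually_atTop.1
    ((tendsto_integral_mul_autocorr φ hΘ).eventually_const_lt (half_lt_self hL0))
  rw [besovNorm_one, eq_top_iff]
  have hinj : Function.Injective fun i : ℕ => -((K + i : ℕ) : ℤ) := fun a b hab => by
    simp only at hab
    omega
  refine le_trans ?_ (ENNReal.tsum_comp_le_tsum_of_injective hinj _)
  have h0 : ENNReal.ofReal (c * (L / 2)) ≠ 0 := by
    rw [Ne, ENNReal.ofReal_eq_zero, not_le]
    positivity
  rw [← ENNReal.tsum_const_eq_top_of_ne_zero (α := ℕ) h0]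
  refine ENNReal.tsum_le_tsum fun i => ?_
  refine le_trans (ENNReal.ofReal_le_ofReal ?_) (h (-((K + i : ℕ) : ℤ)) 0 Θ hΘ)
  have := hK (K + i) (by omega)
  -- For d = 2 the weight 2^((d-2)k) is 1, so every sufficiently low block contributes at least the
  -- same positive amount.
  simp only [Nat.cast_ofNat, sub_self, zero_mul, zpow_zero, mul_one]
  exact mul_le_mul_of_nonneg_left this.le hc.le

/-- The scale invariance behind the linear growth in the number of bumps: the right side does not
depend on j. -/
theorem zpow_mul_bumpMass (d : ℕ) (j m : ℤ) :
    (2 : ℝ) ^ (((d : ℤ) - 2) * (j - m)) * bumpMass d j = (2 : ℝ) ^ (-(((d : ℤ) - 2) * m)) := by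
  unfold bumpMass
  rw [← zpow_add₀ two_ne_zero]
  congr 1
  ring

section
variable {d : ℕ} [NeZero d]

/-- Each admissible bump charges its own block j - m by the same amount c a², so the norm is at
least c a² times their number; the plane is covered by an infinite norm. -/
theorem exists_besovNorm_duhamel_lower_bound_of_le (hd : 2 ≤ d) {φ : 𝓢(E d, ℝ)} (hφ : φ ≠ 0)
    {μ lam κ : ℝ} (hμ : 0 < μ) (hlam : 0 < 2 * μ + lam) (hκ : 0 < κ) {ε₀ : ℝ} (hε₀ : 0 < ε₀)
    (hε₁ : ε₀ ≤ 1) :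
    ∃ (N₀ : ℕ) (c : ℝ), 0 < c ∧ ∀ (δ R : ℝ) (N : ℕ), 0 < δ → δ < 1 → 0 < R → 1 ≤ N → N₀ ≤ N →
      ENNReal.ofReal (c * δ * R ^ 2 * (N : ℝ) ^ (1 / (d : ℝ)))
        ≤ besovNorm φ (-1) d 1 (duhamel μ lam κ (ε₀ * (2 : ℝ) ^ (-(2 * (N : ℝ))))
            (initialVelocity φ R δ N)) := by
  obtain ⟨c₁, hc₁, h₁⟩ := exists_block_lower_bound hd hφ
  obtain ⟨m, N₀, c₂, hc₂, h₂⟩ := exists_integral_duhamel_lower_bound hd hφ hμ hlam hκ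
  have hd0 : (0 : ℝ) < d := by
    have : 0 < d := by omega
    exact_mod_cast this
  set c := c₁ * (2 : ℝ) ^ (-(((d : ℤ) - 2) * m)) * (c₂ * ε₀) with hc
  have hc0 : 0 < c := by positivity
  refine ⟨N₀, c / d, by positivity, fun δ R N hδ hδ1 hR hN1 hN => ?_⟩
  have hNpos : (0 : ℝ) < N := by exact_mod_cast hN1
  rw [initialVelocity_eq φ R hδ.le N]
  set n := ⌊δ * N⌋₊ with hn
  have hnN : n ≤ N := by
    have : δ * N ≤ N := mul_le_of_le_one_left hNpos.le hδ1.le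
    exact Nat.floor_le_of_le this
  set a := R * (N : ℝ) ^ (-(1 / (d : ℝ))) with ha
  have ha0 : 0 < a := by positivity
  obtain ⟨hΘi, hΘ0, hΘ⟩ := h₂ ε₀ hε₀ hε₁ N n a hN hnN
  set Θ := duhamel μ lam κ (ε₀ * (2 : ℝ) ^ (-(2 * (N : ℝ))))
    (sinField ((2 : ℝ) ^ N) (ampS φ N n a)) with hΘdef
  rcases hd.eq_or_lt with rfl | hd3
  · have hpos : 0 < ∫ y, Θ y := by
      refine lt_of_le_of_ne (integral_nonneg hΘ0) fun h => ?_
      have hz := (integral_eq_zero_iff_of_nonneg hΘ0 hΘi).1 h.symm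
      -- If the integral vanished, so would Θ almost everywhere, contrary to its positive pairing at
      -- j = -n, an index that is always admissible.
      have h3 := hΘ (-n) le_rfl (by omega) (by simp)
      rw [integral_eq_zero_of_ae (by filter_upwards [hz] with y hy; rw [hy]; simp)] at h3
      have := bumpMass_pos 2 (-(n : ℤ))
      have h4 : 0 < c₂ * ε₀ * a ^ 2 * bumpMass 2 (-(n : ℤ)) := by positivity
      linarith
    have := besovNorm_eq_top hφ hΘi hpos
    simp only [Nat.cast_ofNat]
    rw [this]
    exact le_top
  -- The indices from -n to -n + p satisfy both j ≤ 0 and d(j+n) ≤ N.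
  · set p := min n (N / d) with hp
    rw [besovNorm_one]
    set T : ℤ → ℝ≥0∞ := fun j => ENNReal.ofReal ((2 : ℝ) ^ (-1 * (j : ℝ))) *
      eLpNorm (block φ j Θ) d volume with hT
    have hterm (j : ℤ) (hj : j ∈ Finset.Icc (-(n : ℤ)) (-(n : ℤ) + p)) :
        ENNReal.ofReal (c * a ^ 2) ≤ T (j - m) := by
      rw [Finset.mem_Icc] at hj
      have hp1 : p ≤ n := min_le_left _ _
      have hp2 : d * p ≤ N := (Nat.mul_le_mul_left d (min_le_right _ _)).trans (Nat.mul_div_le N d)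
      have hj3 : (d : ℤ) * (j + n) ≤ N := by
        have : (d : ℤ) * (j + n) ≤ d * p := mul_le_mul_of_nonneg_left (by linarith) (by positivity)
        exact this.trans (by exact_mod_cast hp2)
      have h3 := hΘ j hj.1 (by omega) hj3
      have h4 := h₁ (j - m) (center d N j) Θ hΘi
      refine le_trans (ENNReal.ofReal_le_ofReal ?_) h4
      refine le_trans (le_of_eq ?_) (mul_le_mul_of_nonneg_left h3 (by positivity))
      rw [hc, ← zpow_mul_bumpMass d j m]
      ring
    have hsum : ∑ j ∈ Finset.Icc (-(n : ℤ)) (-(n : ℤ) + p), ENNReal.ofReal (c * a ^ 2) ≤ ∑' j, T j := by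
      refine (Finset.sum_le_sum hterm).trans ?_
      refine (ENNReal.sum_le_tsum _).trans ?_
      exact ENNReal.tsum_comp_le_tsum_of_injective (fun a b h => by simpa using h) T
    refine le_trans ?_ hsum
    rw [Finset.sum_const, nsmul_eq_mul, ← ENNReal.ofReal_natCast,
      ← ENNReal.ofReal_mul (Nat.cast_nonneg _)]
    refine ENNReal.ofReal_le_ofReal ?_
    have hcard : ((Finset.Icc (-(n : ℤ)) (-(n : ℤ) + p)).card : ℝ) = p + 1 := by
      rw [Int.card_Icc]
      have h (q : ℕ) : (-(n : ℤ) + q + 1 - -(n : ℤ)).toNat = q + 1 := by omega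
      rw [h p]
      push_cast
      rfl
    rw [hcard]
    -- The + 1 from counting both endpoints compensates the rounding in ⌊δN⌋ and in N / d, so the
    -- count holds even when δN < 1.
    have hcount : δ * N / d ≤ (p : ℝ) + 1 := by
      rcases min_choice n (N / d) with h | h
      · rw [hp, h]
        have h1 : δ * N < n + 1 := Nat.lt_floor_add_one _
        have h2 : δ * N / d ≤ δ * N := div_le_self (by positivity) (by
          have : 1 ≤ d := by omega
          exact_mod_cast this)
        linarith
      · rw [hp, h]
        have h1 : (N : ℝ) / d < (N / d : ℕ) + 1 := by
          rw [← Nat.floor_div_eq_div (K := ℝ)]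
          exact Nat.lt_floor_add_one _
        have h2 : δ * N / d ≤ N / d := by
          gcongr
          exact mul_le_of_le_one_left hNpos.le hδ1.le
        linarith
    -- Here d ≥ 3 is used, in the form 1 - 2/d ≥ 1/d.
    have hpow : (N : ℝ) ^ (1 / (d : ℝ)) ≤ N * ((N : ℝ) ^ (-(1 / (d : ℝ)))) ^ 2 := by
      rw [← Real.rpow_natCast, ← Real.rpow_mul hNpos.le]
      nth_rewrite 2 [← Real.rpow_one (N : ℝ)]
      rw [← Real.rpow_add hNpos]
      refine Real.rpow_le_rpow_of_exponent_le (by exact_mod_cast hN1) ?_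
      have : (3 : ℝ) ≤ d := by exact_mod_cast hd3
      have h3 : 1 / (d : ℝ) ≤ 1 / 3 := one_div_le_one_div_of_le (by norm_num) this
      push_cast
      linarith
    calc c / d * δ * R ^ 2 * (N : ℝ) ^ (1 / (d : ℝ))
        ≤ c / d * δ * R ^ 2 * (N * ((N : ℝ) ^ (-(1 / (d : ℝ)))) ^ 2) := by gcongr
      _ = δ * N / d * (c * a ^ 2) := by rw [ha]; ring
      _ ≤ _ := mul_le_mul_of_nonneg_right hcount (by positivity)

/-- The lower bound; the subtracted term only matters for small `N`. -/
theorem exists_besovNorm_duhamel_lower_bound (hd : 2 ≤ d) {φ : 𝓢(E d, ℝ)} (hφ : φ ≠ 0)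
    {μ lam κ : ℝ} (hμ : 0 < μ) (hlam : 0 < 2 * μ + lam) (hκ : 0 < κ) {ε₀ : ℝ} (hε₀ : 0 < ε₀)
    (hε₁ : ε₀ ≤ 1) :
    ∃ c : ℝ, 0 < c ∧ c < 1 ∧ ∀ (δ R : ℝ) (N : ℕ) (x : ℝ), 0 < δ → δ < 1 → 0 < R → 1 ≤ N →
      -(N : ℝ) ≤ x →
      ENNReal.ofReal (c * δ * R ^ 2 * (N : ℝ) ^ (1 / (d : ℝ))
          - (R * (N : ℝ) ^ (-(1 / (d : ℝ)))) ^ 2 * (2 : ℝ) ^ x)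
        ≤ besovNorm φ (-1) d 1 (duhamel μ lam κ (ε₀ * (2 : ℝ) ^ (-(2 * (N : ℝ))))
            (initialVelocity φ R δ N)) := by
  obtain ⟨N₀, c₁, hc₁, h₁⟩ :=
    exists_besovNorm_duhamel_lower_bound_of_le hd hφ hμ hlam hκ hε₀ hε₁
  -- D dominates N² 2^N for all N < N₀. As x ≥ -N, a constant c ≤ D⁻¹ then makes the left side
  -- nonpositive for these N.
  set D : ℝ := ((N₀ : ℝ) + 2) ^ 2 * 2 ^ N₀ with hD
  have hD0 : 1 < D := by
    have h1 : (1 : ℝ) ≤ 2 ^ N₀ := one_le_pow₀ one_le_two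
    have h2 : (0 : ℝ) ≤ N₀ := Nat.cast_nonneg _
    rw [hD]
    nlinarith
  refine ⟨min c₁ D⁻¹, by positivity, (min_le_right _ _).trans_lt (inv_lt_one_of_one_lt₀ hD0),
    fun δ R N x hδ hδ1 hR hN1 hx => ?_⟩
  have hNpos : (0 : ℝ) < N := by exact_mod_cast hN1
  have hN1' : (1 : ℝ) ≤ N := by exact_mod_cast hN1
  have hsub : 0 ≤ (R * (N : ℝ) ^ (-(1 / (d : ℝ)))) ^ 2 * (2 : ℝ) ^ x := by positivity
  rcases le_or_gt N₀ N with hN | hN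
  · refine le_trans (ENNReal.ofReal_le_ofReal ?_) (h₁ δ R N hδ hδ1 hR hN1 hN)
    have : min c₁ D⁻¹ * δ * R ^ 2 * (N : ℝ) ^ (1 / (d : ℝ))
        ≤ c₁ * δ * R ^ 2 * (N : ℝ) ^ (1 / (d : ℝ)) := by
      gcongr
      exact min_le_left _ _
    linarith
  · rw [ENNReal.ofReal_of_nonpos]
    · exact bot_le
    have hd1 : 1 / (d : ℝ) ≤ 1 / 2 := by
      have : (2 : ℝ) ≤ d := by exact_mod_cast hd
      exact one_div_le_one_div_of_le two_pos this
    have k1 : (N : ℝ) ^ (1 / (d : ℝ)) ≤ N := by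
      calc (N : ℝ) ^ (1 / (d : ℝ)) ≤ (N : ℝ) ^ (1 : ℝ) :=
            Real.rpow_le_rpow_of_exponent_le hN1' (by linarith)
        _ = N := Real.rpow_one _
    have k2 : (N : ℝ)⁻¹ ≤ ((N : ℝ) ^ (-(1 / (d : ℝ)))) ^ 2 := by
      rw [← Real.rpow_natCast, ← Real.rpow_mul hNpos.le, ← Real.rpow_neg_one]
      refine Real.rpow_le_rpow_of_exponent_le hN1' ?_
      push_cast
      linarith
    have k3 : ((2 : ℝ) ^ N)⁻¹ ≤ (2 : ℝ) ^ x := by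
      rw [← Real.rpow_natCast, ← Real.rpow_neg two_pos.le]
      exact Real.rpow_le_rpow_of_exponent_le one_le_two hx
    have k4 : D⁻¹ * N ≤ (N : ℝ)⁻¹ * ((2 : ℝ) ^ N)⁻¹ := by
      have hND : (N : ℝ) ^ 2 * 2 ^ N ≤ D := by
        rw [hD]
        have : (N : ℝ) ≤ N₀ := by exact_mod_cast hN.le
        have h2 : (2 : ℝ) ^ N ≤ 2 ^ N₀ := pow_le_pow_right₀ one_le_two hN.le
        gcongr
        linarith
      rw [inv_mul_le_iff₀ (by linarith)]
      have e : (N : ℝ) = (N : ℝ) ^ 2 * 2 ^ N * ((N : ℝ)⁻¹ * ((2 : ℝ) ^ N)⁻¹) := by field_simp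
      calc (N : ℝ) = (N : ℝ) ^ 2 * 2 ^ N * ((N : ℝ)⁻¹ * ((2 : ℝ) ^ N)⁻¹) := e
        _ ≤ _ := mul_le_mul_of_nonneg_right hND (by positivity)
    have k5 : min c₁ D⁻¹ * δ * R ^ 2 * (N : ℝ) ^ (1 / (d : ℝ)) ≤ R ^ 2 * (D⁻¹ * N) := by
      calc _ ≤ D⁻¹ * 1 * R ^ 2 * N := by
            gcongr
            exact min_le_right _ _
        _ = _ := by ring
    have k6 : R ^ 2 * ((N : ℝ)⁻¹ * ((2 : ℝ) ^ N)⁻¹)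
        ≤ (R * (N : ℝ) ^ (-(1 / (d : ℝ)))) ^ 2 * (2 : ℝ) ^ x := by
      rw [mul_pow, mul_assoc]
      gcongr
    have k7 := mul_le_mul_of_nonneg_left k4 (sq_nonneg R)
    linarith

end

/-! ### Fourier supports -/

section
variable {d : ℕ}

theorem IsLittlewoodPaley.fourier_cplx_ne_zero {φ : 𝓢(E d, ℝ)} (hφ : IsLittlewoodPaley φ) {v : E d}
    (hv : 𝓕 (cplx φ : E d → ℂ) v ≠ 0) : 2⁻¹ ≤ 2 * Real.pi * ‖v‖ ∧ 2 * Real.pi * ‖v‖ ≤ 2 := by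
  have h2 : 0 < 2 * Real.pi := by positivity
  have h : (2 * Real.pi) • v ∈ tsupport (hat φ) := by
    refine subset_tsupport _ ?_
    rw [Function.mem_support, hat, inv_smul_smul₀ h2.ne']
    exact hv
  have := hφ.support h
  rwa [Set.mem_ofPred_eq, norm_smul, Real.norm_of_nonneg h2.le] at this

theorem fourier_dyadic (φ : 𝓢(E d, ℝ)) (k : ℤ) (w : E d) :
    𝓕 (fun x => (dyadic φ k x : ℂ)) w = 𝓕 (cplx φ : E d → ℂ) (((2 : ℝ) ^ k)⁻¹ • w) := by
  have hr : (0 : ℝ) < 2 ^ k := by positivity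
  have h := integral_smul_sub' (fun v => Complex.exp (↑(-2 * Real.pi *
    inner ℝ v (((2 : ℝ) ^ k)⁻¹ • w)) * Complex.I) • cplx φ v) hr (0 : E d)
  rw [eq_inv_smul_iff₀ (pow_pos hr d).ne'] at h
  rw [Real.fourier_eq', Real.fourier_eq', ← h, ← integral_smul]
  congr 1 with x
  simp only [sub_zero, smul_eq_mul, cplx_apply, Complex.real_smul, inner_smul_left, inner_smul_right,
    conj_trivial, dyadic]
  rw [mul_comm (d : ℤ), zpow_mul, zpow_natCast, inv_mul_cancel_left₀ hr.ne']
  push_cast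
  ring

theorem IsLittlewoodPaley.fourier_dyadic_ne_zero {φ : 𝓢(E d, ℝ)} (hφ : IsLittlewoodPaley φ) {k : ℤ}
    {w : E d} (hw : 𝓕 (fun x => (dyadic φ k x : ℂ)) w ≠ 0) :
    (2 : ℝ) ^ (k - 1) ≤ 2 * Real.pi * ‖w‖ ∧ 2 * Real.pi * ‖w‖ ≤ (2 : ℝ) ^ (k + 1) := by
  have hr : (0 : ℝ) < 2 ^ k := by positivity
  rw [fourier_dyadic] at hw
  have h := hφ.fourier_cplx_ne_zero hw
  rw [norm_smul, norm_inv, Real.norm_of_nonneg hr.le] at h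
  have e : 2 * Real.pi * ‖w‖ = 2 ^ k * (2 * Real.pi * (((2 : ℝ) ^ k)⁻¹ * ‖w‖)) := by field_simp
  rw [zpow_sub_one₀ two_ne_zero, zpow_add_one₀ two_ne_zero, e]
  exact ⟨mul_le_mul_of_nonneg_left h.1 hr.le, mul_le_mul_of_nonneg_left h.2 hr.le⟩

variable [NeZero d]

theorem IsLittlewoodPaley.fourier_ampS_ne_zero {φ : 𝓢(E d, ℝ)} (hφ : IsLittlewoodPaley φ) {N n : ℕ}
    {a : ℝ} {v : E d} (hv : 𝓕 (ampS φ N n a : E d → ℂ) v ≠ 0) : 2 * Real.pi * ‖v‖ ≤ 2 := by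
  rw [fourier_ampS] at hv
  obtain ⟨j, hj, hj0⟩ := Finset.exists_ne_zero_of_sum_ne_zero (right_ne_zero_of_smul hv)
  rw [Finset.mem_Icc] at hj
  have hr : (0 : ℝ) < 2 ^ j := by positivity
  rw [← norm_ne_zero_iff, norm_fourier_bumpS] at hj0
  have h := (hφ.fourier_cplx_ne_zero (norm_ne_zero_iff.1 (right_ne_zero_of_mul hj0))).2
  rw [norm_smul, norm_inv, Real.norm_of_nonneg hr.le] at h
  have h1 : (2 : ℝ) ^ j ≤ 1 := zpow_le_one_of_nonpos₀ one_le_two hj.2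
  have e : 2 * Real.pi * ‖v‖ = 2 ^ j * (2 * Real.pi * (((2 : ℝ) ^ j)⁻¹ * ‖v‖)) := by field_simp
  rw [e]
  nlinarith

theorem norm_modFreq {M : ℝ} (hM : 0 ≤ M) : 2 * Real.pi * ‖modFreq d M‖ = M := by
  rw [modFreq, norm_smul, norm_e₁, Real.norm_of_nonneg (by positivity)]
  field_simp

theorem IsLittlewoodPaley.fourier_sinField_ne_zero {φ : 𝓢(E d, ℝ)} (hφ : IsLittlewoodPaley φ)
    {N n : ℕ} {a M : ℝ} (hM : 0 ≤ M) {w : E d} (hw : 𝓕 (sinField M (ampS φ N n a)) w ≠ 0) :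
    M - 2 ≤ 2 * Real.pi * ‖w‖ ∧ 2 * Real.pi * ‖w‖ ≤ M + 2 := by
  have key (b : E d) (hb : 2 * Real.pi * ‖b‖ = M)
      (h : 𝓕 (ampS φ N n a : E d → ℂ) (w - b) ≠ 0) :
      M - 2 ≤ 2 * Real.pi * ‖w‖ ∧ 2 * Real.pi * ‖w‖ ≤ M + 2 := by
    have h1 := hφ.fourier_ampS_ne_zero h
    have h2 := norm_sub_norm_le w b
    have h3 := norm_sub_norm_le b w
    rw [norm_sub_rev] at h3
    have := Real.pi_pos
    constructor <;> nlinarith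
  rw [fourier_sinField] at hw
  by_cases h1 : shiftHat (ampS φ N n a) (modFreq d M) w = 0
  · by_cases h2 : shiftHat (ampS φ N n a) (-modFreq d M) w = 0
    · simp [h1, h2] at hw
    · exact key _ (by rw [norm_neg, norm_modFreq hM]) h2
  · exact key _ (norm_modFreq hM) h1

theorem norm_sinField_le (M : ℝ) (Q : 𝓢(E d, ℂ)) (x : E d) : ‖sinField M Q x‖ ≤ ‖Q x‖ := by
  rw [sinField, norm_smul, norm_toV, norm_e₁, mul_one, norm_mul, Complex.norm_real]
  exact mul_le_of_le_one_left (norm_nonneg _) (Real.abs_sin_le_one _)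

theorem continuous_sinField (M : ℝ) (Q : 𝓢(E d, ℂ)) : Continuous (sinField M Q) := by
  have := Q.continuous
  unfold sinField
  fun_prop

theorem integrable_sinField (M : ℝ) (Q : 𝓢(E d, ℂ)) : Integrable (sinField M Q) :=
  Q.integrable.mono (continuous_sinField M Q).aestronglyMeasurable
    (Filter.Eventually.of_forall (norm_sinField_le M Q))

/-- The transform of the convolution is the product, hence zero. The block is continuous and
integrable, so Fourier inversion gives vanishing at every point. -/
theorem block_sinField_eq_zero (φ : 𝓢(E d, ℝ)) (k : ℤ) (M : ℝ) (Q : 𝓢(E d, ℂ))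
    (h : ∀ w, 𝓕 (fun x => (dyadic φ k x : ℂ)) w = 0 ∨ 𝓕 (sinField M Q) w = 0) :
    block φ k (sinField M Q) = 0 := by
  set f : E d → ℂ := fun x => (dyadic φ k x : ℂ) with hf
  have hfi : Integrable f := (integrable_dyadic φ k).ofReal
  have hui := integrable_sinField M Q
  have e : block φ k (sinField M Q)
      = convolution f (sinField M Q) (ContinuousLinearMap.lsmul ℂ ℂ) volume := by
    ext1 x
    rw [convolution_lsmul_swap, block]
    simp only [hf, Complex.coe_smul]
  have h0 : 𝓕 (block φ k (sinField M Q)) = 0 := by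
    ext1 w
    rw [e, Real.fourier_smul_convolution_eq hfi hui]
    rcases h w with h | h <;> simp [h]
  have hbdd : BddAbove (Set.range fun x => ‖sinField M Q x‖) := by
    refine ⟨SchwartzMap.seminorm ℝ 0 0 Q, ?_⟩
    rintro _ ⟨x, rfl⟩
    exact (norm_sinField_le M Q x).trans (Q.norm_le_seminorm ℝ x)
  have hc : Continuous (block φ k (sinField M Q)) := by
    rw [e]
    exact hbdd.continuous_convolution_right_of_integrable _ hfi (continuous_sinField M Q)
  have hi : Integrable (block φ k (sinField M Q)) := by
    rw [e]
    exact hfi.integrable_convolution _ hui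
  rw [← hc.fourierInv_fourier_eq hi (by rw [h0]; exact integrable_zero _ _ _), h0]
  ext1 x
  simp [Real.fourierInv_eq]

/-- The frequencies of the data are close to `2^N`. -/
theorem block_sinField_eq_zero_of_lt {φ : 𝓢(E d, ℝ)} (hφ : IsLittlewoodPaley φ) {N n : ℕ} {a : ℝ}
    {k : ℤ} (hN : 1 ≤ N) (h : (N : ℤ) + 2 < k) :
    block φ k (sinField ((2 : ℝ) ^ N) (ampS φ N n a)) = 0 := by
  refine block_sinField_eq_zero _ _ _ _ fun w => or_iff_not_imp_left.2 fun h1 => ?_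
  by_contra h2
  have h3 := (hφ.fourier_dyadic_ne_zero h1).1
  have h4 := (hφ.fourier_sinField_ne_zero (by positivity) h2).2
  have h5 : (2 : ℝ) ^ ((N : ℤ) + 2) ≤ 2 ^ (k - 1) := zpow_le_zpow_right₀ one_le_two (by omega)
  rw [zpow_add₀ two_ne_zero, zpow_natCast] at h5
  have h6 : (2 : ℝ) ^ 1 ≤ 2 ^ N := pow_le_pow_right₀ one_le_two hN
  norm_num at h5 h6
  linarith

/-- The block lives below 2^N/4 and the data above 2^N - 2. These ranges are disjoint for N ≥ 2 but
not for N = 1. -/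
theorem block_sinField_eq_zero_of_gt {φ : 𝓢(E d, ℝ)} (hφ : IsLittlewoodPaley φ) {N n : ℕ} {a : ℝ}
    {k : ℤ} (hN : 2 ≤ N) (h : k < (N : ℤ) - 2) :
    block φ k (sinField ((2 : ℝ) ^ N) (ampS φ N n a)) = 0 := by
  refine block_sinField_eq_zero _ _ _ _ fun w => or_iff_not_imp_left.2 fun h1 => ?_
  by_contra h2
  have h3 := (hφ.fourier_dyadic_ne_zero h1).2
  have h4 := (hφ.fourier_sinField_ne_zero (by positivity) h2).1
  have h5 : (2 : ℝ) ^ (k + 1) ≤ 2 ^ ((N : ℤ) - 2) := zpow_le_zpow_right₀ one_le_two (by omega)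
  rw [zpow_sub₀ two_ne_zero, zpow_natCast] at h5
  have h6 : (2 : ℝ) ^ 2 ≤ 2 ^ N := pow_le_pow_right₀ one_le_two hN
  norm_num at h5 h6
  linarith

end

/-! ### Young's inequality in `L³` -/

section
variable {d : ℕ}

/-- Split p = p^(2/3) p^(1/3), apply Hölder with weights 2/3 and 1/3, and integrate in x by Tonelli.
-/
theorem lintegral_lconvolution_pow_three_le {p q : E d → ℝ≥0∞} (hp : Measurable p)
    (hq : Measurable q) :
    ∫⁻ x, (∫⁻ y, p (x - y) * q y) ^ 3 ≤ (∫⁻ x, p x) ^ 3 * ∫⁻ x, q x ^ 3 := by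
  have hsub (x : E d) : ∫⁻ y, p (x - y) = ∫⁻ y, p y := lintegral_sub_left_eq_self p x
  have h1 (x : E d) : (∫⁻ y, p (x - y) * q y) ^ 3
      ≤ (∫⁻ y, p y) ^ 2 * ∫⁻ y, p (x - y) * q y ^ 3 := by
    have hpx : Measurable fun y => p (x - y) := hp.comp (by fun_prop)
    have h := ENNReal.lintegral_mul_norm_pow_le (μ := volume) hpx.aemeasurable
      (hpx.mul (hq.pow_const 3)).aemeasurable (p := 2 / 3) (q := 1 / 3) (by norm_num) (by norm_num)
      (by norm_num)
    have e (y : E d) : p (x - y) ^ (2 / 3 : ℝ) * (p (x - y) * q y ^ 3) ^ (1 / 3 : ℝ)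
        = p (x - y) * q y := by
      rw [ENNReal.mul_rpow_of_nonneg _ _ (by norm_num), ← mul_assoc,
        ← ENNReal.rpow_add_of_nonneg _ _ (by norm_num) (by norm_num), ← ENNReal.rpow_natCast,
        ← ENNReal.rpow_mul]
      norm_num
    simp only [Pi.mul_apply, e, hsub] at h
    refine (pow_le_pow_left' h 3).trans (le_of_eq ?_)
    rw [mul_pow, ← ENNReal.rpow_natCast, ← ENNReal.rpow_natCast, ← ENNReal.rpow_mul,
      ← ENNReal.rpow_mul]
    norm_num
  have hm : Measurable fun z : E d × E d => p (z.1 - z.2) * q z.2 ^ 3 :=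
    (hp.comp (by fun_prop : Measurable fun z : E d × E d => z.1 - z.2)).mul
      ((hq.comp measurable_snd).pow_const 3)
  calc _ ≤ ∫⁻ x, (∫⁻ y, p y) ^ 2 * ∫⁻ y, p (x - y) * q y ^ 3 := lintegral_mono h1
    _ = (∫⁻ y, p y) ^ 2 * ∫⁻ x, ∫⁻ y, p (x - y) * q y ^ 3 :=
      lintegral_const_mul _ hm.lintegral_prod_right'
    _ = (∫⁻ y, p y) ^ 2 * ∫⁻ y, ∫⁻ x, p (x - y) * q y ^ 3 := by
      rw [lintegral_lintegral_swap hm.aemeasurable]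
    _ = (∫⁻ y, p y) ^ 2 * ∫⁻ y, (∫⁻ x, p x) * q y ^ 3 := by
      congr 2 with y
      have hpy : Measurable fun x => p (x - y) := hp.comp (by fun_prop)
      rw [lintegral_mul_const _ hpy, lintegral_sub_right_eq_self p y]
    _ = _ := by
      rw [lintegral_const_mul _ (hq.pow_const 3)]
      ring

theorem eLpNorm_three {F : Type*} [NormedAddCommGroup F] (f : E d → F) :
    eLpNorm f 3 volume = (∫⁻ x, ‖f x‖ₑ ^ 3) ^ (1 / 3 : ℝ) := by
  rw [eLpNorm_eq_lintegral_rpow_enorm_toReal (by norm_num) (by norm_num)]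
  simp only [ENNReal.toReal_ofNat, ENNReal.rpow_ofNat]

variable {F : Type*} [NormedAddCommGroup F] [NormedSpace ℝ F] {φ : 𝓢(E d, ℝ)} {f : E d → F}

theorem enorm_block_le (k : ℤ) (x : E d) :
    ‖block φ k f x‖ₑ ≤ ∫⁻ y, ‖dyadic φ k (x - y)‖ₑ * ‖f y‖ₑ := by
  refine (enorm_integral_le_lintegral_enorm _).trans (le_of_eq ?_)
  simp only [enorm_smul]

theorem eLpNorm_block_le (k : ℤ) (hf : Continuous f) :
    eLpNorm (block φ k f) 3 volume ≤ eLpNorm (dyadic φ k) 1 volume * eLpNorm f 3 volume := by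
  have h := lintegral_lconvolution_pow_three_le (continuous_dyadic φ k).enorm.measurable
    hf.enorm.measurable
  have h2 : ∫⁻ x, ‖block φ k f x‖ₑ ^ 3 ≤ _ :=
    (lintegral_mono fun x => pow_le_pow_left' (enorm_block_le k x) 3).trans h
  rw [eLpNorm_three, eLpNorm_three, eLpNorm_one_eq_lintegral_enorm]
  refine (ENNReal.rpow_le_rpow h2 (by norm_num)).trans (le_of_eq ?_)
  rw [ENNReal.mul_rpow_of_nonneg _ _ (by norm_num), ← ENNReal.rpow_natCast, ← ENNReal.rpow_mul]
  norm_num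

/-- The roles are exchanged: the cube falls on the dilated φ, whose L³ norm decays as k → -∞. This
makes the low blocks summable when N = 1. -/
theorem eLpNorm_block_le' (k : ℤ) (hf : Continuous f) :
    eLpNorm (block φ k f) 3 volume ≤ eLpNorm (dyadic φ k) 3 volume * eLpNorm f 1 volume := by
  have h := lintegral_lconvolution_pow_three_le hf.enorm.measurable
    (continuous_dyadic φ k).enorm.measurable
  have e (x : E d) : ‖block φ k f x‖ₑ ≤ ∫⁻ y, ‖f (x - y)‖ₑ * ‖dyadic φ k y‖ₑ := by
    refine (enorm_block_le k x).trans (le_of_eq ?_)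
    rw [← lintegral_sub_left_eq_self _ x]
    simp only [sub_sub_cancel, mul_comm]
  have h2 : ∫⁻ x, ‖block φ k f x‖ₑ ^ 3 ≤ _ :=
    (lintegral_mono fun x => pow_le_pow_left' (e x) 3).trans h
  rw [eLpNorm_three, eLpNorm_three, eLpNorm_one_eq_lintegral_enorm]
  refine (ENNReal.rpow_le_rpow h2 (by norm_num)).trans (le_of_eq ?_)
  rw [ENNReal.mul_rpow_of_nonneg _ _ (by norm_num), ← ENNReal.rpow_natCast, ← ENNReal.rpow_mul,
    mul_comm]
  norm_num

end

/-! ### The upper bound for the data in dimension three -/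

theorem abs_sum_pow_three_le {ι : Type*} (s : Finset ι) (f : ι → ℝ) :
    |∑ i ∈ s, f i| ^ 3 ≤ (s.card : ℝ) ^ 2 * ∑ i ∈ s, |f i| ^ 3 := by
  rcases s.eq_empty_or_nonempty with rfl | hs
  · simp
  have h1 := Finset.abs_sum_le_sum_abs f s
  have h2 := pow_sum_div_card_le_sum_pow (s := s) (f := fun i => |f i|)
    (fun i _ => abs_nonneg _) 2
  have hc : (0 : ℝ) < s.card := by exact_mod_cast hs.card_pos
  rw [div_le_iff₀ (by positivity), mul_comm] at h2
  exact (pow_le_pow_left₀ (abs_nonneg _) h1 3).trans h2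

theorem abs_add_pow_three_le (a b : ℝ) : |a + b| ^ 3 ≤ 4 * (|a| ^ 3 + |b| ^ 3) := by
  have h := pow_le_pow_left₀ (abs_nonneg _) (abs_add_le a b) 3
  have ha := abs_nonneg a
  have hb := abs_nonneg b
  have : 0 ≤ 3 * ((|a| + |b|) * (|a| - |b|) ^ 2) := by positivity
  nlinarith

section
variable {d : ℕ} [NeZero d]

/-- The bumps live in disjoint balls, up to rapidly decreasing tails. -/
theorem abs_amp_pow_three_le (φ : 𝓢(E d, ℝ)) {N n : ℕ} (hn : n ≤ N) (x : E d) :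
    |amp φ N n x| ^ 3 ≤ 4 * ∑ j ∈ Finset.Icc (-(n : ℤ)) 0,
      |bump φ N j x| ^ 3 * (1 + 16 * ‖(2 : ℝ) ^ j • (x - center d N j)‖ ^ 2) := by
  classical
  set J := Finset.Icc (-(n : ℤ)) 0 with hJ
  -- A quarter of 2^(2N) widths, half of the guaranteed separation, so x is near at most one centre.
  set near : ℤ → Prop := fun j => ‖x - center d N j‖ < (2 : ℝ) ^ (2 * (N : ℤ)) * 2 ^ (-j) / 4
  have hcard : (J.filter near).card ≤ 1 := by
    rw [Finset.card_le_one]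
    intro i hi j hj
    simp only [Finset.mem_filter, hJ, Finset.mem_Icc] at hi hj
    by_contra hij
    have h1 := norm_center_sub_le (d := d) N hi.1.2 hj.1.2 hij
    have h2 : ‖center d N i - center d N j‖ ≤ ‖x - center d N i‖ + ‖x - center d N j‖ := by
      rw [← norm_neg (x - center d N i)]
      refine le_trans (le_of_eq ?_) (norm_add_le _ _)
      congr 1
      abel
    have h3 : (2 : ℝ) ^ (2 * (N : ℤ)) * 2 ^ (-i) ≤ 2 ^ (2 * (N : ℤ)) * max (2 ^ (-i)) (2 ^ (-j)) := by
      gcongr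
      exact le_max_left _ _
    have h4 : (2 : ℝ) ^ (2 * (N : ℤ)) * 2 ^ (-j) ≤ 2 ^ (2 * (N : ℤ)) * max (2 ^ (-i)) (2 ^ (-j)) := by
      gcongr
      exact le_max_right _ _
    have h5 := hi.2
    have h6 := hj.2
    simp only [near] at h5 h6
    linarith
  have hnear : |∑ j ∈ J.filter near, bump φ N j x| ^ 3
      ≤ ∑ j ∈ J.filter near, |bump φ N j x| ^ 3 := by
    refine (abs_sum_pow_three_le _ _).trans (mul_le_of_le_one_left
      (Finset.sum_nonneg fun j _ => by positivity) (pow_le_one₀ (by positivity) ?_))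
    exact_mod_cast hcard
  -- A far bump is seen at rescaled distance at least 2^(2N)/4. This exceeds a quarter of the number
  -- of terms, so the squared distance pays for the square of that number.
  have hfar : |∑ j ∈ J.filter (¬ near ·), bump φ N j x| ^ 3 ≤ ∑ j ∈ J.filter (¬ near ·),
      |bump φ N j x| ^ 3 * (16 * ‖(2 : ℝ) ^ j • (x - center d N j)‖ ^ 2) := by
    refine (abs_sum_pow_three_le _ _).trans ?_
    rw [Finset.mul_sum]
    refine Finset.sum_le_sum fun j hj => ?_
    rw [mul_comm]
    refine mul_le_mul_of_nonneg_left ?_ (by positivity)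
    have h1 : ((J.filter (¬ near ·)).card : ℝ) ≤ 2 ^ (2 * N) := by
      have h2 : (J.filter (¬ near ·)).card ≤ N + 1 := by
        refine (Finset.card_filter_le _ _).trans ?_
        rw [hJ, card_Icc_neg]
        omega
      have h3 : N + 1 ≤ 2 ^ (2 * N) :=
        (Nat.lt_two_pow_self (n := N)).trans_le (Nat.pow_le_pow_right two_pos (by omega))
      exact_mod_cast h2.trans h3
    have h2 : (2 : ℝ) ^ (2 * N) ≤ 4 * ‖(2 : ℝ) ^ j • (x - center d N j)‖ := by
      have h3 := (Finset.mem_filter.1 hj).2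
      simp only [near, not_lt] at h3
      have hr : (0 : ℝ) < 2 ^ j := by positivity
      have h4 := mul_le_mul_of_nonneg_left h3 hr.le
      have e : (2 : ℝ) ^ j * (2 ^ (2 * (N : ℤ)) * 2 ^ (-j) / 4) = 2 ^ (2 * (N : ℤ)) / 4 := by
        rw [zpow_neg]
        field_simp
      rw [e] at h4
      rw [norm_smul, Real.norm_of_nonneg hr.le]
      have e2 : (2 : ℝ) ^ (2 * (N : ℤ)) = 2 ^ (2 * N) := by norm_cast
      rw [e2] at h4
      linarith
    calc _ ≤ (4 * ‖(2 : ℝ) ^ j • (x - center d N j)‖) ^ 2 :=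
          pow_le_pow_left₀ (by positivity) (h1.trans h2) 2
      _ = _ := by ring
  have hsplit : amp φ N n x = ∑ j ∈ J.filter near, bump φ N j x
      + ∑ j ∈ J.filter (¬ near ·), bump φ N j x := by
    rw [Finset.sum_filter_add_sum_filter_not]
    rfl
  rw [hsplit]
  refine (abs_add_pow_three_le _ _).trans (mul_le_mul_of_nonneg_left ?_ (by norm_num))
  rw [← Finset.sum_filter_add_sum_filter_not J near fun j => |bump φ N j x| ^ 3 * _]
  refine add_le_add (hnear.trans (Finset.sum_le_sum fun j _ => ?_))
    (hfar.trans (Finset.sum_le_sum fun j _ => ?_))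
  · exact le_mul_of_one_le_right (by positivity) (le_add_of_nonneg_right (by positivity))
  · exact mul_le_mul_of_nonneg_left (by linarith) (by positivity)

end

theorem integrable_abs_pow_three_mul {d : ℕ} (φ : 𝓢(E d, ℝ)) :
    Integrable fun y => |φ y| ^ 3 * (1 + 16 * ‖y‖ ^ 2) := by
  obtain ⟨A, hA0, hA, -⟩ := schwartz_bound φ
  have h0 := φ.integrable_pow_mul volume 0
  have h2 := φ.integrable_pow_mul volume 2
  have hc : Continuous fun y => |φ y| ^ 2 := (continuous_abs.comp φ.continuous).pow 2
  refine ((h0.add (h2.const_mul 16)).bdd_mul (c := A ^ 2) hc.aestronglyMeasurable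
    (Filter.Eventually.of_forall fun y => ?_)).congr (Filter.Eventually.of_forall fun y => ?_)
  · rw [Real.norm_of_nonneg (by positivity)]
    exact pow_le_pow_left₀ (abs_nonneg _) (hA y) 2
  · simp only [Pi.add_apply, Real.norm_eq_abs]
    ring

/-- In dimension three the amplitude 2^j and the width 2^(-j) cancel in L³, so each of the n + 1
bumps contributes the same integral. -/
theorem integral_abs_amp_pow_three_le (φ : 𝓢(E 3, ℝ)) {N n : ℕ} (hn : n ≤ N) :
    Integrable (fun x => |amp φ N n x| ^ 3) ∧
    ∫ x, |amp φ N n x| ^ 3 ≤ (n + 1) * (4 * ∫ y, |φ y| ^ 3 * (1 + 16 * ‖y‖ ^ 2)) := by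
  have hr (j : ℤ) : (0 : ℝ) < 2 ^ j := by positivity
  set g : E 3 → ℝ := fun y => |φ y| ^ 3 * (1 + 16 * ‖y‖ ^ 2) with hg
  have hgi : Integrable g := integrable_abs_pow_three_mul φ
  have e (j : ℤ) : (fun x => |bump φ N j x| ^ 3 * (1 + 16 * ‖(2 : ℝ) ^ j • (x - center 3 N j)‖ ^ 2))
      = fun x => ((2 : ℝ) ^ j) ^ 3 * g ((2 : ℝ) ^ j • (x - center 3 N j)) := by
    ext1 x
    simp only [bump, hg, abs_mul, abs_of_pos (hr j)]
    ring
  have hi (j : ℤ) : Integrable fun x => |bump φ N j x| ^ 3 *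
      (1 + 16 * ‖(2 : ℝ) ^ j • (x - center 3 N j)‖ ^ 2) := by
    rw [e]
    exact (integrable_smul_sub hgi (hr j) _).const_mul _
  have hI (j : ℤ) : ∫ x, |bump φ N j x| ^ 3 *
      (1 + 16 * ‖(2 : ℝ) ^ j • (x - center 3 N j)‖ ^ 2) = ∫ y, g y := by
    rw [e, integral_const_mul, integral_smul_sub g (hr j), mul_inv_cancel_left₀]
    exact (pow_pos (hr j) 3).ne'
  have hs : Integrable fun x => 4 * ∑ j ∈ Finset.Icc (-(n : ℤ)) 0,
      |bump φ N j x| ^ 3 * (1 + 16 * ‖(2 : ℝ) ^ j • (x - center 3 N j)‖ ^ 2) :=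
    (integrable_finsetSum _ fun j _ => hi j).const_mul _
  have hai : Integrable fun x => |amp φ N n x| ^ 3 := by
    refine hs.mono' (Continuous.aestronglyMeasurable ?_) (Filter.Eventually.of_forall fun x => ?_)
    · exact (continuous_abs.comp (continuous_amp φ N n)).pow 3
    · rw [Real.norm_of_nonneg (by positivity)]
      exact abs_amp_pow_three_le φ hn x
  refine ⟨hai, (integral_mono hai hs fun x => abs_amp_pow_three_le φ hn x).trans (le_of_eq ?_)⟩
  rw [integral_const_mul, integral_finsetSum _ fun j _ => hi j]
  simp only [hI]
  rw [Finset.sum_const, card_Icc_neg, nsmul_eq_mul]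
  push_cast
  ring

theorem eLpNorm_three_eq_ofReal {d : ℕ} {f : E d → ℝ} (hf : Integrable fun x => |f x| ^ 3) :
    eLpNorm f 3 volume = ENNReal.ofReal ((∫ x, |f x| ^ 3) ^ (1 / 3 : ℝ)) := by
  rw [eLpNorm_three, ← ENNReal.ofReal_rpow_of_nonneg (integral_nonneg fun x => by positivity)
    (by norm_num), ofReal_integral_eq_lintegral_ofReal hf (Filter.Eventually.of_forall fun x => by
      simp only [Pi.zero_apply]; positivity)]
  congr 2 with x
  rw [← Real.norm_eq_abs, ENNReal.ofReal_pow (norm_nonneg _), ofReal_norm]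

theorem eLpNorm_one_eq_ofReal {d : ℕ} {f : E d → ℝ} (hf : Integrable f) :
    eLpNorm f 1 volume = ENNReal.ofReal (∫ x, |f x|) := by
  rw [eLpNorm_one_eq_lintegral_enorm, ← ofReal_integral_norm_eq_lintegral_enorm hf]
  rfl

theorem eLpNorm_dyadic_one {d : ℕ} (φ : 𝓢(E d, ℝ)) (k : ℤ) :
    eLpNorm (dyadic φ k) 1 volume = ENNReal.ofReal (∫ x, |φ x|) := by
  have hr : (0 : ℝ) < 2 ^ k := by positivity
  rw [eLpNorm_one_eq_ofReal (integrable_dyadic φ k)]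
  congr 1
  have e (x : E d) : |dyadic φ k x| = ((2 : ℝ) ^ k) ^ d * (fun y => |φ y|) ((2 : ℝ) ^ k • (x - 0)) := by
    rw [dyadic, abs_mul, sub_zero, abs_of_pos (by positivity), mul_comm (d : ℤ), zpow_mul, zpow_natCast]
  simp only [e]
  rw [integral_const_mul, integral_smul_sub (fun y => |φ y|) hr, mul_inv_cancel_left₀]
  exact (pow_pos hr d).ne'

theorem integrable_abs_pow_three {d : ℕ} (φ : 𝓢(E d, ℝ)) : Integrable fun y => |φ y| ^ 3 := by
  refine (integrable_abs_pow_three_mul φ).mono' (Continuous.aestronglyMeasurable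
    ((continuous_abs.comp φ.continuous).pow 3)) (Filter.Eventually.of_forall fun y => ?_)
  rw [Real.norm_of_nonneg (by positivity)]
  exact le_mul_of_one_le_right (by positivity) (le_add_of_nonneg_right (by positivity))

theorem eLpNorm_dyadic_three (φ : 𝓢(E 3, ℝ)) (k : ℤ) :
    eLpNorm (dyadic φ k) 3 volume
      = ENNReal.ofReal ((2 : ℝ) ^ (2 * k) * (∫ x, |φ x| ^ 3) ^ (1 / 3 : ℝ)) := by
  have hr : (0 : ℝ) < 2 ^ k := by positivity
  have e : (fun x => |dyadic φ k x| ^ 3)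
      = fun x => ((2 : ℝ) ^ k) ^ 9 * (fun y => |φ y| ^ 3) ((2 : ℝ) ^ k • (x - 0)) := by
    ext1 x
    rw [dyadic, abs_mul, sub_zero, abs_of_pos (by positivity), mul_comm ((3 : ℕ) : ℤ), zpow_mul,
      zpow_natCast]
    ring
  have hi : Integrable fun x => |dyadic φ k x| ^ 3 := by
    rw [e]
    exact (integrable_smul_sub (integrable_abs_pow_three φ) hr 0).const_mul _
  rw [eLpNorm_three_eq_ofReal hi, e, integral_const_mul, integral_smul_sub (fun y => |φ y| ^ 3) hr]
  congr 1
  have e2 : ((2 : ℝ) ^ k) ^ 9 * ((((2 : ℝ) ^ k) ^ 3)⁻¹ * ∫ x, |φ x| ^ 3)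
      = ((2 : ℝ) ^ (2 * k)) ^ (3 : ℝ) * ∫ x, |φ x| ^ 3 := by
    rw [mul_comm 2 k, zpow_mul, Real.rpow_ofNat]
    norm_cast
    field_simp
  rw [e2, Real.mul_rpow (by positivity) (integral_nonneg fun x => by positivity),
    ← Real.rpow_mul (by positivity)]
  norm_num

/-- The upper bound for the norm of the data. For `N = 1` its frequencies reach down to `0`. -/
theorem exists_besovNorm_sinField_le {φ : 𝓢(E 3, ℝ)} (hφ : IsLittlewoodPaley φ) :
    ∃ C : ℝ, 0 ≤ C ∧ ∀ (N n : ℕ) (a : ℝ), 0 ≤ a → 1 ≤ N → n ≤ N → (N = 1 → n = 0) →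
      besovNorm φ 0 3 1 (sinField ((2 : ℝ) ^ N) (ampS φ N n a))
        ≤ ENNReal.ofReal (C * (a * ((n : ℝ) + 1) ^ (1 / 3 : ℝ))) := by
  set I₁ := ∫ x, |φ x| with hI₁
  set I₃ := (∫ x, |φ x| ^ 3) ^ (1 / 3 : ℝ) with hI₃
  set I₄ := (4 * ∫ y, |φ y| ^ 3 * (1 + 16 * ‖y‖ ^ 2)) ^ (1 / 3 : ℝ) with hI₄
  have h₁ : 0 ≤ I₁ := integral_nonneg fun x => abs_nonneg _
  have h₃ : 0 ≤ I₃ := Real.rpow_nonneg (integral_nonneg fun x => by positivity) _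
  have h₄' : 0 ≤ 4 * ∫ y, |φ y| ^ 3 * (1 + 16 * ‖y‖ ^ 2) :=
    mul_nonneg (by norm_num) (integral_nonneg fun x => by positivity)
  have h₄ : 0 ≤ I₄ := Real.rpow_nonneg h₄' _
  set G : ℝ := ∑' i : ℕ, 64 * (4⁻¹ : ℝ) ^ i with hG
  have hGs : Summable fun i : ℕ => 64 * (4⁻¹ : ℝ) ^ i :=
    (summable_geometric_of_lt_one (by norm_num) (by norm_num)).mul_left _
  have hG0 : 0 ≤ G := tsum_nonneg fun i => by positivity
  -- The first summand serves N ≥ 2, with five active blocks; the second serves N = 1, with G the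
  -- sum of 2^(2k) over k ≤ 3.
  refine ⟨5 * (I₁ * I₄) + G * (I₃ * I₁), by positivity, fun N n a ha hN hn hN1 => ?_⟩
  set u := sinField ((2 : ℝ) ^ N) (ampS φ N n a) with hu
  have huc : Continuous u := continuous_sinField _ _
  have hun (x) : ‖u x‖ ≤ ‖a • amp φ N n x‖ := by
    refine (norm_sinField_le _ _ x).trans (le_of_eq ?_)
    rw [ampS_apply, Complex.norm_real, smul_eq_mul]
  have hu3 : eLpNorm u 3 volume ≤ ENNReal.ofReal (a * (I₄ * ((n : ℝ) + 1) ^ (1 / 3 : ℝ))) := by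
    refine (eLpNorm_mono hun).trans ?_
    obtain ⟨hi, hI⟩ := integral_abs_amp_pow_three_le φ hn
    rw [show (fun x => a • amp φ N n x) = a • amp φ N n from rfl, eLpNorm_const_smul,
      eLpNorm_three_eq_ofReal hi, Real.enorm_of_nonneg ha, ← ENNReal.ofReal_mul ha]
    refine ENNReal.ofReal_le_ofReal (mul_le_mul_of_nonneg_left ?_ ha)
    rw [hI₄, ← Real.mul_rpow h₄' (by positivity), mul_comm _ ((n : ℝ) + 1)]
    exact Real.rpow_le_rpow (integral_nonneg fun x => by positivity) hI (by norm_num)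
  rw [besovNorm_one]
  simp only [zero_mul, Real.rpow_zero, ENNReal.ofReal_one, one_mul]
  have hn1 : (1 : ℝ) ≤ ((n : ℝ) + 1) ^ (1 / 3 : ℝ) :=
    Real.one_le_rpow (by linarith [(Nat.cast_nonneg n : (0 : ℝ) ≤ n)]) (by norm_num)
  rcases hN.eq_or_lt with rfl | hN2
  · have hn0 := hN1 rfl
    subst hn0
    have hu1 : eLpNorm u 1 volume ≤ ENNReal.ofReal (a * I₁) := by
      refine (eLpNorm_mono hun).trans ?_
      have e : amp φ 1 0 = fun x => φ (x - center 3 1 0) := by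
        ext1 x
        simp [amp, bump]
      have hi : Integrable (amp φ 1 0) := by
        rw [e]
        exact φ.integrable.comp_sub_right _
      rw [show (fun x => a • amp φ 1 0 x) = a • amp φ 1 0 from rfl, eLpNorm_const_smul,
        eLpNorm_one_eq_ofReal hi, Real.enorm_of_nonneg ha, ← ENNReal.ofReal_mul ha, e,
        integral_sub_right_eq_self fun x => |φ x|]
    have hinj : Function.Injective fun i : ℕ => (3 : ℤ) - i := fun i j h => by
      simp only at h
      omega
    have hsupp : Function.support (fun k => eLpNorm (block φ k u) 3 volume)
        ⊆ Set.range fun i : ℕ => (3 : ℤ) - i := by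
      intro k hk
      by_contra h
      have hk3 : 3 < k := by
        by_contra h'
        exact h ⟨(3 - k).toNat, by simp only; omega⟩
      exact hk (by
        simp only
        rw [block_sinField_eq_zero_of_lt hφ le_rfl (by push_cast; omega)]
        exact eLpNorm_zero)
    rw [← hinj.tsum_eq hsupp]
    have hterm (i : ℕ) : eLpNorm (block φ ((3 : ℤ) - i) u) 3 volume
        ≤ ENNReal.ofReal (64 * (4⁻¹ : ℝ) ^ i) * ENNReal.ofReal (I₃ * (a * I₁)) := by
      refine (eLpNorm_block_le' _ huc).trans ?_
      rw [eLpNorm_dyadic_three]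
      refine (mul_le_mul_right hu1 _).trans (le_of_eq ?_)
      rw [← ENNReal.ofReal_mul (by positivity), ← ENNReal.ofReal_mul (by positivity)]
      congr 1
      have e : (2 : ℝ) ^ (2 * ((3 : ℤ) - i)) = 64 * (4⁻¹ : ℝ) ^ i := by
        rw [zpow_mul, zpow_sub₀ (by norm_num), zpow_natCast, inv_pow]
        norm_num
        rfl
      rw [e]
      ring
    refine (ENNReal.tsum_le_tsum hterm).trans ?_
    rw [ENNReal.tsum_mul_right, ← ENNReal.ofReal_tsum_of_nonneg (fun i => by positivity) hGs,
      ← ENNReal.ofReal_mul hG0]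
    refine ENNReal.ofReal_le_ofReal ?_
    calc G * (I₃ * (a * I₁)) = (0 + G * (I₃ * I₁)) * (a * 1) := by ring
      _ ≤ _ := by gcongr; positivity
  · have hzero (k : ℤ) (hk : k ∉ Finset.Icc ((N : ℤ) - 2) (N + 2)) :
        eLpNorm (block φ k u) 3 volume = 0 := by
      rw [Finset.mem_Icc, not_and_or, not_le, not_le] at hk
      rcases hk with hk | hk
      · rw [block_sinField_eq_zero_of_gt hφ hN2 hk]
        exact eLpNorm_zero
      · rw [block_sinField_eq_zero_of_lt hφ hN hk]
        exact eLpNorm_zero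
    rw [tsum_eq_sum hzero]
    have hterm (k : ℤ) : eLpNorm (block φ k u) 3 volume
        ≤ ENNReal.ofReal (I₁ * (a * (I₄ * ((n : ℝ) + 1) ^ (1 / 3 : ℝ)))) := by
      refine (eLpNorm_block_le k huc).trans ?_
      rw [eLpNorm_dyadic_one, ENNReal.ofReal_mul h₁]
      exact mul_le_mul_right hu3 _
    refine (Finset.sum_le_sum fun k _ => hterm k).trans ?_
    have hcard : (Finset.Icc ((N : ℤ) - 2) (N + 2)).card = 5 := by
      rw [Int.card_Icc]
      omega
    rw [Finset.sum_const, hcard, nsmul_eq_mul, ← ENNReal.ofReal_natCast,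
      ← ENNReal.ofReal_mul (Nat.cast_nonneg _)]
    refine ENNReal.ofReal_le_ofReal ?_
    calc _ = (5 * (I₁ * I₄) + 0) * (a * ((n : ℝ) + 1) ^ (1 / 3 : ℝ)) := by push_cast; ring
      _ ≤ _ := by gcongr; positivity

/-- The factor N^(-1/3) meets (n+1)^(1/3) with n ≤ δN. The quotient (δN+1)/N is kept because it is
at most 2δ when δN ≥ 1 and at most 2 in general. -/
theorem exists_besovNorm_initialVelocity_le {φ : 𝓢(E 3, ℝ)} (hφ : IsLittlewoodPaley φ) :
    ∃ C : ℝ, 0 ≤ C ∧ ∀ (δ R : ℝ) (N : ℕ), 0 < δ → δ < 1 → 0 < R → 1 ≤ N →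
      besovNorm φ 0 3 1 (initialVelocity φ R δ N)
        ≤ ENNReal.ofReal (C * (R * ((δ * N + 1) / N) ^ (1 / 3 : ℝ))) := by
  obtain ⟨C, hC, h⟩ := exists_besovNorm_sinField_le hφ
  refine ⟨C, hC, fun δ R N hδ hδ1 hR hN => ?_⟩
  have hN0 : (0 : ℝ) < N := by exact_mod_cast hN
  rw [initialVelocity_eq φ R hδ.le N]
  have hn : ⌊δ * N⌋₊ ≤ N := Nat.floor_le_of_le (mul_le_of_le_one_left hN0.le hδ1.le)
  -- Since δ < 1, there is a single bump when N = 1.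
  have hn1 (h1 : N = 1) : ⌊δ * N⌋₊ = 0 := by
    rw [Nat.floor_eq_zero, h1]
    simpa using hδ1
  refine (h N _ (R * (N : ℝ) ^ (-(1 / ((3 : ℕ) : ℝ)))) (by positivity) hN hn hn1).trans
    (ENNReal.ofReal_le_ofReal ?_)
  have hfl : (⌊δ * N⌋₊ : ℝ) ≤ δ * N := Nat.floor_le (by positivity)
  rw [Real.div_rpow (by positivity) hN0.le, Nat.cast_ofNat, Real.rpow_neg hN0.le]
  calc _ ≤ C * (R * ((N : ℝ) ^ (1 / 3 : ℝ))⁻¹ * (δ * N + 1) ^ (1 / 3 : ℝ)) := by gcongr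
    _ = _ := by ring

theorem rpow_third_le_two_mul {x y : ℝ} (hx : 0 ≤ x) (hy : 0 ≤ y) (h : x ≤ 2 * y) :
    x ^ (1 / 3 : ℝ) ≤ 2 * y ^ (1 / 3 : ℝ) := by
  refine (Real.rpow_le_rpow hx h (by norm_num)).trans ?_
  rw [Real.mul_rpow two_pos.le hy]
  refine mul_le_mul_of_nonneg_right ?_ (by positivity)
  calc (2 : ℝ) ^ (1 / 3 : ℝ) ≤ 2 ^ (1 : ℝ) :=
        Real.rpow_le_rpow_of_exponent_le one_le_two (by norm_num)
    _ = 2 := Real.rpow_one 2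

end HighFreq

end

/-! ### Assembly of the bounds -/

theorem mainTheorem3 (d : ℕ) [NeZero d] (hd : 2 ≤ d)
    (φ : SchwartzMap (HighFreq.E d) ℝ) (hφ : HighFreq.IsLittlewoodPaley φ)
    (μ lam κ : ℝ) (hμ : 0 < μ) (hlam : 0 < 2 * μ + lam) (hκ : 0 < κ) :
    -- the lower bound in dimension `d`, and both bounds in dimension three
    (∃ ε₁ : ℝ, 0 < ε₁ ∧ ∀ ε₀ : ℝ, 0 < ε₀ → ε₀ ≤ ε₁ →
      (∃ c : ℝ, 0 < c ∧ ∀ (δ R : ℝ) (N : ℕ), 0 < δ → δ < 1 → 0 < R → 1 ≤ N →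
        ENNReal.ofReal (c * δ * R ^ 2 * (N : ℝ) ^ (1 / (d : ℝ))
            - (R * (N : ℝ) ^ (-(1 / (d : ℝ)))) ^ 2 * (2 : ℝ) ^ (-((1 - 2 * δ) * N)))
          ≤ HighFreq.besovNorm φ (-1) d 1
              (HighFreq.duhamel μ lam κ (ε₀ * (2 : ℝ) ^ (-(2 * (N : ℝ))))
                (HighFreq.initialVelocity φ R δ N))) ∧
      (d = 3 → ∃ C c : ℝ, 1 < C ∧ 0 < c ∧ c < 1 ∧
        ∀ (δ R : ℝ) (N : ℕ), 0 < δ → δ < 1 → 0 < R → 1 ≤ N →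
          (1 ≤ δ * N → HighFreq.besovNorm φ 0 3 1 (HighFreq.initialVelocity φ R δ N)
            ≤ ENNReal.ofReal (C * R * δ ^ (1 / 3 : ℝ))) ∧
          ENNReal.ofReal (c * δ * R ^ 2 * (N : ℝ) ^ (1 / 3 : ℝ)
              - C * (R * (N : ℝ) ^ (-(1 / 3 : ℝ))) ^ 2 * (2 : ℝ) ^ (-(c * N)))
            ≤ HighFreq.besovNorm φ (-1) 3 1
                (HighFreq.duhamel μ lam κ (ε₀ * (2 : ℝ) ^ (-(2 * (N : ℝ))))
                  (HighFreq.initialVelocity φ R δ N)))) ∧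
    -- for fixed `δ`, the upper bound in dimension three for all `N`
    (d = 3 → ∀ δ : ℝ, 0 < δ → δ < 1 → ∃ C : ℝ, 1 < C ∧ ∀ (R : ℝ) (N : ℕ), 0 < R → 1 ≤ N →
      HighFreq.besovNorm φ 0 3 1 (HighFreq.initialVelocity φ R δ N)
        ≤ ENNReal.ofReal (C * R * δ ^ (1 / 3 : ℝ))) := by
  have hφ0 := hφ.ne_zero
  -- The only smallness needed is ε₀ ≤ 1, which keeps sM² ≤ 1 up to time t.
  refine ⟨⟨1, one_pos, fun ε₀ hε₀ hε₁ => ?_⟩, ?_⟩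
  · obtain ⟨c, hc, hc1, h⟩ :=
      HighFreq.exists_besovNorm_duhamel_lower_bound hd hφ0 hμ hlam hκ hε₀ hε₁
    refine ⟨⟨c, hc, fun δ R N hδ hδ1 hR hN => h δ R N _ hδ hδ1 hR hN ?_⟩, ?_⟩
    · have hN0 : (0 : ℝ) ≤ N := Nat.cast_nonneg N
      have : 0 ≤ δ * N := by positivity
      linarith
    · rintro rfl
      obtain ⟨C, hC, hu⟩ := HighFreq.exists_besovNorm_initialVelocity_le hφ
      -- 2C covers the upper bound. The added 2 makes the constant exceed 1, so that the subtracted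
      -- term is at least the one already available.
      refine ⟨2 * C + 2, c, by linarith, hc, hc1, fun δ R N hδ hδ1 hR hN => ⟨fun hδN => ?_, ?_⟩⟩
      · have hN0 : (0 : ℝ) < N := by exact_mod_cast hN
        refine (hu δ R N hδ hδ1 hR hN).trans (ENNReal.ofReal_le_ofReal ?_)
        have h1 : ((δ * N + 1) / N) ^ (1 / 3 : ℝ) ≤ 2 * δ ^ (1 / 3 : ℝ) := by
          refine HighFreq.rpow_third_le_two_mul (by positivity) hδ.le ?_
          rw [div_le_iff₀ hN0]
          linarith
        calc C * (R * ((δ * N + 1) / N) ^ (1 / 3 : ℝ)) ≤ C * (R * (2 * δ ^ (1 / 3 : ℝ))) := by gcongr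
          _ = 2 * C * R * δ ^ (1 / 3 : ℝ) := by ring
          _ ≤ _ := by gcongr; linarith
      · have hN0 : (0 : ℝ) ≤ N := Nat.cast_nonneg N
        have h1 := h δ R N (-(c * N)) hδ hδ1 hR hN
          (neg_le_neg (mul_le_of_le_one_left hN0 hc1.le))
        simp only [Nat.cast_ofNat] at h1
        refine le_trans (ENNReal.ofReal_le_ofReal ?_) h1
        have h2 : 0 ≤ (R * (N : ℝ) ^ (-(1 / 3 : ℝ))) ^ 2 * (2 : ℝ) ^ (-(c * N)) := by positivity
        nlinarith
  · rintro rfl δ hδ hδ1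
    obtain ⟨C, hC, hu⟩ := HighFreq.exists_besovNorm_initialVelocity_le hφ
    have hδ3 : 0 < δ ^ (1 / 3 : ℝ) := by positivity
    -- For δN < 1 the norm need not be small with δ, so the constant carries δ^(-1/3) to cancel the
    -- factor in the statement.
    refine ⟨2 * C * (δ ^ (1 / 3 : ℝ))⁻¹ + 2, by
      have : 0 ≤ 2 * C * (δ ^ (1 / 3 : ℝ))⁻¹ := by positivity
      linarith, fun R N hR hN => ?_⟩
    have hN1 : (1 : ℝ) ≤ N := by exact_mod_cast hN
    refine (hu δ R N hδ hδ1 hR hN).trans (ENNReal.ofReal_le_ofReal ?_)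
    have h1 : ((δ * N + 1) / N) ^ (1 / 3 : ℝ) ≤ 2 * 1 ^ (1 / 3 : ℝ) := by
      refine HighFreq.rpow_third_le_two_mul (by positivity) zero_le_one ?_
      rw [div_le_iff₀ (by linarith)]
      nlinarith
    rw [Real.one_rpow] at h1
    calc C * (R * ((δ * N + 1) / N) ^ (1 / 3 : ℝ)) ≤ C * (R * (2 * 1)) := by gcongr
      _ = 2 * C * (δ ^ (1 / 3 : ℝ))⁻¹ * R * δ ^ (1 / 3 : ℝ) := by field_simp
      _ ≤ _ := by gcongr; linarith
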